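/- **Theorem (Borel summability of formal solutions).** *Setting.* Let $X\subset\mathbb C_x$ be a domain, $\theta\in\mathbb R$, $A_\theta=(\theta-\frac\pi2,\theta+\frac\pi2)$. For $d>0$ let $S_\theta(d)=\{\hbar : \operatorname{Re}(e^{i\theta}/\hbar)>1/d\}$ (a Borel disc). A *sectorial domain with opening $A_\theta$* is a simply connected domain in $\mathbb C_\hbar\setminus\{0\}$ whose closure in the real-oriented blowup of $\mathbb C_\hbar$ at $0$ meets the circle of directions exactly in $\bar A_\theta$, and which contains some Borel disc $S_\theta(d)$. Let $S$ be such a domain. Consider the Riccati equation $$\hbar\,\partial_x f = a f^2+bf+c ,$$ with $a,b,c$ holomorphic on $X\times S$ and admitting asymptotic expansions $\hat a=\sum a_n\hbar^n$, $\hat b=\sum b_n\hbar^n$, $\hat c=\sum c_n\hbar^n$ with coefficients holomorphic on $X$, as $\hbar\to0$ along $A_\theta$, locally uniformly on $X$. Put $D_0=b_0^2-4a_0c_0$. For a subset $U\subset X$ and a positive function $w$ on $U$, write $f\simeq\hat f$ along $\bar A_\theta$, with respect to $w$, uniformly on $U$, if there are $C,M>0$ and a sectorial domain $S_1$ with opening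 $A_\theta$ inside the domain of definition in $\hbar$ such that $|f(x,\hbar)-\sum_{k<n}f_k(x)\hbar^k|\le w(x)\,C M^n n!\,|\hbar|^n$ for all $n\ge0$, $x\in U$, $\hbar\in S_1$ (and omit $w$ if $w=1$). *Hypotheses.* Fix $x_0\in X$ with $D_0(x_0)\ne0$, a sign $\alpha\in\{+,-\}$, and a square-root branch $\sqrt{D_0}$ near $x_0$. Assume: 1. There is a WKB $(\theta,\alpha)$-halfstrip domain $W\subset X$ containing $x_0$: there are $z_1\in\mathbb C$, $r>0$ such that $H=\{z:\operatorname{dist}(z,\,z_1+\alpha e^{i\theta}\mathbb R_{\ge0})<r\}$ contains $0$, and a holomorphic $\Psi:H\to X$ with $\Psi(0)=x_0$, $\sqrt{D_0}(\Psi(z))\,\Psi'(z)=1$ and $W=\Psi(H)$ (so $\Psi$ is the inverse of the Liouville transformation $x\mapsto\int_{x_0}^x\sqrt{D_0}$, and $\sqrt{D_0}$ is continued to $W$). If $\alpha=-$, then $a_0$ has no zeros on $W$. If $\alpha=+$, then $\sqrt{D_0}=b_0$ at every zero of $a_0$ in $W$. 2. $a\simeq\hat a$, $b\simeq\hat b$,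 $c\simeq\hat c$ along $\bar A_\theta$, with respect to $|\sqrt{D_0}|$, uniformly on $W$. *Conclusion.* There is a unique formal solution $\hat f_\alpha=\sum_{k\ge0}f_k^\alpha(x)\hbar^k$ of $\hbar\,\partial_x\hat f=\hat a\hat f^2+\hat b\hat f+\hat c$ with coefficients holomorphic on $W$ and $2a_0f_0^\alpha+b_0=\alpha\sqrt{D_0}$. For every domain $U_0$ whose closure is compact and contained in $W$ there is $d_0>0$ such that, with $S_0=S_\theta(d_0)\subset S$: * The Riccati equation has a unique holomorphic solution $f_\alpha^\theta$ on $U_0\times S_0$ (the canonical exact solution) with $f^\theta_\alpha\simeq\hat f_\alpha$ along $\bar A_\theta$, uniformly on $U_0$; the Gevrey bounds hold on all of $U_0\times S_0$. * There are $C,M>0$ with $|f_k^\alpha(x)|\le CM^kk!$ for all $k\ge0$, $x\in U_0$. * $\hat f_\alpha$ is uniformly Borel summable on $U_0$ in the direction $\theta$: the formal Borel transform $\sum_{k\ge0}\frac1{k!}f_{k+1}^\alpha(x)\xi^k$ converges uniformly on $U_0$ times a disc around $\xi=0$, and for some $\varepsilon>0$ it has a holomorphic continuation $\phi$ to $U_0\times\Xi_\theta$,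 $\Xi_\theta=\{\xi:\operatorname{dist}(\xi,e^{i\theta}\mathbb R_{\ge0})<\varepsilon\}$, with $|\phi(x,\xi)|\le Ae^{L|\xi|}$ there for some constants $A,L>0$. * $f^\theta_\alpha$ is the uniform Borel resummation of $\hat f_\alpha$, that is, for all $(x,\hbar)\in U_0\times S_0$, $$f_\alpha^\theta(x,\hbar)=f_0^\alpha(x)+\int_{e^{i\theta}\mathbb R_{\ge0}}e^{-\xi/\hbar}\phi(x,\xi)\,d\xi ,$$ where the integral converges absolutely, and uniformly on $U_0\times S_0$. * $\phi$ is the analytic Borel transform of $f_\alpha^\theta-f_0^\alpha$ on the open ray: for every $0<\delta<d_0$ and every $\xi\in e^{i\theta}\mathbb R_{>0}$, $$\phi(x,\xi)=\lim_{T\to\infty}\frac1{2\pi i}\int_{\wp(T)}\big(f_\alpha^\theta(x,\hbar)-f_0^\alpha(x)\big)e^{\xi/\hbar}\frac{d\hbar}{\hbar^2}$$ uniformly for $x\in U_0$, where $\wp(T)$ is the arc $\hbar=e^{i\theta}(\delta^{-1}+it)^{-1}$, $|t|\le T$, of the boundary of $S_\theta(\delta)$, traversed anticlockwise. -/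

import Mathlib

open Set Filter Topology

noncomputable section

namespace ExactRiccati

/-! ### Sectorial domains with halfplane opening -/

/-- The Borel disc of diameter `d` bisected by the direction `θ`. (For `ħ = 0` the junk value
`exp (iθ) / 0 = 0` shows that the origin is not a member.) -/
def borelDisc (θ d : ℝ) : Set ℂ :=
  {h | 1 / d < (Complex.exp (θ * Complex.I) / h).re}

/-- The directions at the origin in which `S` accumulates: the intersection of the closure of `S`
in the real-oriented blowup of the plane at `0` with the boundary circle. -/
def limitDirections (S : Set ℂ) : Set ℂ :=
  {u | ‖u‖ = 1 ∧ ∀ ε > (0 : ℝ), ∃ h ∈ S, h ≠ 0 ∧ ‖h‖ < ε ∧ ‖h / (‖h‖ : ℂ) - u‖ < ε}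

/-- `S` is a sectorial domain at the origin with opening `(θ - π/2, θ + π/2)`. As usual for
halfplane openings, it is understood that `S` contains a Borel disc. -/
structure IsSectorialDomain (θ : ℝ) (S : Set ℂ) : Prop where
  isOpen : IsOpen S
  simplyConnected : IsSimplyConnected S
  zero_notMem : (0 : ℂ) ∉ S
  opening : limitDirections S =
    (fun t : ℝ => Complex.exp (t * Complex.I)) '' Icc (θ - Real.pi / 2) (θ + Real.pi / 2)
  exists_borelDisc : ∃ d > 0, borelDisc θ d ⊆ S

/-- The straight sector of radius `δ` with opening `(t₁, t₂)`. -/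
def straightSector (t₁ t₂ δ : ℝ) : Set ℂ :=
  {h | ∃ ρ ∈ Ioo 0 δ, ∃ t ∈ Ioo t₁ t₂, h = ρ * Complex.exp (t * Complex.I)}

/-! ### Asymptotic expansions.

A formal power series in `ħ` with coefficients depending on `x` is a sequence
`fhat : ℕ → ℂ → ℂ`, with `fhat k x` the coefficient of `ħ ^ k` at `x`. -/

/-- The remainder of order `n`. -/
def remainder (f : ℂ → ℂ → ℂ) (fhat : ℕ → ℂ → ℂ) (n : ℕ) (x h : ℂ) : ℂ :=
  f x h - ∑ k ∈ Finset.range n, fhat k x * h ^ k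

/-- `f` is holomorphic in both variables on `U × S`. -/
def HolomorphicOn₂ (f : ℂ → ℂ → ℂ) (U S : Set ℂ) : Prop :=
  DifferentiableOn ℂ (fun p : ℂ × ℂ => f p.1 p.2) (U ×ˢ S)

/-- `f ∼ fhat` as `ħ → 0` along the open arc `(θ - π/2, θ + π/2)`, locally uniformly on `X`, with
coefficients holomorphic on `X`. -/
def LocUnifAsymptotic (θ : ℝ) (S X : Set ℂ) (f : ℂ → ℂ → ℂ) (fhat : ℕ → ℂ → ℂ) : Prop :=
  (∀ n, DifferentiableOn ℂ (fhat n) X) ∧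
  ∀ x ∈ X, ∃ U ∈ 𝓝 x, ∀ n : ℕ, ∀ t₁ t₂ : ℝ,
    θ - Real.pi / 2 < t₁ → t₁ < t₂ → t₂ < θ + Real.pi / 2 →
    ∃ δ > 0, ∃ C > 0, ∀ y ∈ U ∩ X, ∀ h ∈ S ∩ straightSector t₁ t₂ δ,
      ‖remainder f fhat n y h‖ ≤ C * ‖h‖ ^ n

/-- Uniform Gevrey bounds on `U × S`, with respect to the scale `w`. -/
def HasGevreyBounds (S U : Set ℂ) (w : ℂ → ℝ) (f : ℂ → ℂ → ℂ) (fhat : ℕ → ℂ → ℂ) : Prop :=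
  ∃ C > 0, ∃ M > 0, ∀ n : ℕ, ∀ x ∈ U, ∀ h ∈ S,
    ‖remainder f fhat n x h‖ ≤ w x * (C * M ^ n * n.factorial * ‖h‖ ^ n)

/-- `f ≃ fhat` as `ħ → 0` along the closed arc `[θ - π/2, θ + π/2]`, with respect to the scale `w`,
uniformly for all `x ∈ U`. -/
def GevreyAsymptotic (θ : ℝ) (S U : Set ℂ) (w : ℂ → ℝ) (f : ℂ → ℂ → ℂ) (fhat : ℕ → ℂ → ℂ) : Prop :=
  ∃ S₁ ⊆ S, IsSectorialDomain θ S₁ ∧ HasGevreyBounds S₁ U w f fhat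

/-! ### Formal and exact solutions of the Riccati equation -/

/-- The formal power series in `ħ` obtained from `fhat` at the point `x`. -/
def seriesAt (fhat : ℕ → ℂ → ℂ) (x : ℂ) : PowerSeries ℂ :=
  PowerSeries.mk fun k => fhat k x

/-- `fhat` has coefficients holomorphic on `U` and satisfies
`ħ ∂ₓ fhat = ahat * fhat² + bhat * fhat + chat` there. -/
def IsFormalSolution (ahat bhat chat : ℕ → ℂ → ℂ) (U : Set ℂ) (fhat : ℕ → ℂ → ℂ) : Prop :=
  (∀ k, DifferentiableOn ℂ (fhat k) U) ∧
  ∀ x ∈ U, PowerSeries.X * seriesAt (fun k => deriv (fhat k)) x =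
    seriesAt ahat x * seriesAt fhat x ^ 2 + seriesAt bhat x * seriesAt fhat x + seriesAt chat x

/-- The formal solution on `U` labelled by the sign `α` and the square-root branch `sq`: its
leading-order term satisfies `2 a₀ f₀ + b₀ = α √D₀`; equivalently `f₀ = (-b₀ + α √D₀) / (2 a₀)`
where `a₀ ≠ 0`, and `f₀ = -c₀ / b₀` where `a₀ = 0`. -/
def IsLabelledFormalSolution (ahat bhat chat : ℕ → ℂ → ℂ) (sq : ℂ → ℂ) (α : ℝ) (U : Set ℂ)
    (fhat : ℕ → ℂ → ℂ) : Prop :=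
  IsFormalSolution ahat bhat chat U fhat ∧
  ∀ x ∈ U, 2 * ahat 0 x * fhat 0 x + bhat 0 x = α * sq x

/-- `f` is a holomorphic solution of `ħ ∂ₓ f = a f² + b f + c` on `U × S`. -/
def IsExactSolution (a b c : ℂ → ℂ → ℂ) (U S : Set ℂ) (f : ℂ → ℂ → ℂ) : Prop :=
  HolomorphicOn₂ f U S ∧
  ∀ x ∈ U, ∀ h ∈ S,
    h * deriv (fun y => f y h) x = a x h * f x h ^ 2 + b x h * f x h + c x h

/-- `f` is a holomorphic solution on `U × S`, Gevrey asymptotic to `fhat` along the closed arc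
`[θ - π/2, θ + π/2]` uniformly on `U`. -/
def IsCanonicalSolution (θ : ℝ) (a b c : ℂ → ℂ → ℂ) (fhat : ℕ → ℂ → ℂ) (U S : Set ℂ)
    (f : ℂ → ℂ → ℂ) : Prop :=
  IsExactSolution a b c U S f ∧ GevreyAsymptotic θ S U (fun _ => 1) f fhat

/-! ### WKB halfstrips -/

/-- The leading-order discriminant. -/
def discriminant (ahat bhat chat : ℕ → ℂ → ℂ) (x : ℂ) : ℂ :=
  bhat 0 x ^ 2 - 4 * ahat 0 x * chat 0 x

/-- `sq` is a holomorphic square-root branch of `D` on `U`. -/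
def IsSqrtBranch (D sq : ℂ → ℂ) (U : Set ℂ) : Prop :=
  DifferentiableOn ℂ sq U ∧ ∀ x ∈ U, sq x ^ 2 = D x

/-- The ray from `z₁` in the direction `α e^{iθ}`. -/
def ray (θ α : ℝ) (z₁ : ℂ) : Set ℂ :=
  {z | ∃ t : ℝ, 0 ≤ t ∧ z = z₁ + α * t * Complex.exp (θ * Complex.I)}

/-- The halfstrip of all points at distance less than `r` from the ray. -/
def halfstrip (θ α : ℝ) (z₁ : ℂ) (r : ℝ) : Set ℂ :=
  Metric.thickening r (ray θ α z₁)

/-- `W` is a WKB `(θ, α)`-halfstrip domain containing `x₀`: the image of a halfstrip `H` under the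
inverse `Ψ` of the Liouville transformation `x ↦ ∫_{x₀}^x √D₀`, that is, of the solution of
`√D₀(Ψ) Ψ' = 1`, `Ψ 0 = x₀`. The map `Ψ` is a local biholomorphism; it need not be injective,
since trajectories may be closed. -/
def IsWKBHalfstrip (θ α : ℝ) (sq : ℂ → ℂ) (x₀ : ℂ) (W : Set ℂ) : Prop :=
  ∃ (z₁ : ℂ) (r : ℝ) (Ψ : ℂ → ℂ), 0 < r ∧ (0 : ℂ) ∈ halfstrip θ α z₁ r ∧ Ψ 0 = x₀ ∧
    DifferentiableOn ℂ Ψ (halfstrip θ α z₁ r) ∧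
    (∀ z ∈ halfstrip θ α z₁ r, sq (Ψ z) * deriv Ψ z = 1) ∧
    Ψ '' halfstrip θ α z₁ r = W

/-! ### Borel and Laplace transforms -/

/-- Tubular neighbourhood of thickness `η` of the ray `e^{iθ} ℝ₊`. -/
def tube (θ η : ℝ) : Set ℂ := Metric.thickening η (ray θ 1 0)

/-- Coefficients of the formal Borel transform. -/
def formalBorel (fhat : ℕ → ℂ → ℂ) (k : ℕ) (x : ℂ) : ℂ := fhat (k + 1) x / k.factorial

/-- The integrand, in the parameter `u ≥ 0` of `ξ = u e^{iθ}`, of the Laplace transform. -/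
def laplaceIntegrand (θ : ℝ) (φ : ℂ → ℂ) (h : ℂ) (u : ℝ) : ℂ :=
  Complex.exp (-(u * Complex.exp (θ * Complex.I)) / h) * φ (u * Complex.exp (θ * Complex.I)) *
    Complex.exp (θ * Complex.I)

/-- The Laplace transform `∫_{e^{iθ} ℝ₊} e^{-ξ/ħ} φ(ξ) dξ`. -/
def laplace (θ : ℝ) (φ : ℂ → ℂ) (h : ℂ) : ℂ := ∫ u in Ioi (0 : ℝ), laplaceIntegrand θ φ h u

/-- The boundary of the Borel disc of diameter `δ` bisected by `θ`, parameterised by `t ∈ ℝ`. -/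
def borelPath (θ δ t : ℝ) : ℂ :=
  Complex.exp (θ * Complex.I) / ((1 / δ : ℝ) + t * Complex.I)

/-- The truncation at `T` of the analytic Borel transform
`(2πi)⁻¹ ∮_θ g(ħ) e^{ξ/ħ} dħ / ħ²` along `borelPath θ δ` (anticlockwise: from `t = T` to
`t = -T`). The transform is the limit as `T → ∞`. -/
def truncatedBorel (θ δ T : ℝ) (g : ℂ → ℂ) (ξ : ℂ) : ℂ :=
  (2 * Real.pi * Complex.I)⁻¹ *
    ∫ t in T..(-T), g (borelPath θ δ t) * Complex.exp (ξ / borelPath θ δ t) *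
      (deriv (borelPath θ δ) t / borelPath θ δ t ^ 2)

/-- `fhat` is a uniformly Gevrey series on `U`. -/
def IsUniformlyGevrey (U : Set ℂ) (fhat : ℕ → ℂ → ℂ) : Prop :=
  ∃ C > 0, ∃ M > 0, ∀ k : ℕ, ∀ x ∈ U, ‖fhat k x‖ ≤ C * M ^ k * k.factorial

/-- The formal Borel transform of `fhat` converges uniformly on `U` times a disc around `ξ = 0`, and
`φ` is its analytic continuation to `U × tube θ η`, with uniformly at most exponential growth. -/
structure IsBorelContinuation (θ η : ℝ) (U : Set ℂ) (fhat : ℕ → ℂ → ℂ) (φ : ℂ → ℂ → ℂ) :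
    Prop where
  holomorphic : HolomorphicOn₂ φ U (tube θ η)
  germ : ∃ ρ > 0, ρ ≤ η ∧
    TendstoUniformlyOn
      (fun (N : ℕ) (p : ℂ × ℂ) => ∑ k ∈ Finset.range N, formalBorel fhat k p.1 * p.2 ^ k)
      (fun p => φ p.1 p.2) atTop (U ×ˢ Metric.ball 0 ρ)
  growth : ∃ A > 0, ∃ L > 0, ∀ x ∈ U, ∀ ξ ∈ tube θ η, ‖φ x ξ‖ ≤ A * Real.exp (L * ‖ξ‖)

/-- `f` is, on `U × S`, the uniform Borel resummation in the direction `θ` of `fhat`, through the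
analytic continuation `φ` of the formal Borel transform: the Laplace integrals converge absolutely,
and uniformly on `U × S`, and `f` is the leading term of `fhat` plus the Laplace transform. -/
structure IsBorelResummation (θ η : ℝ) (U S : Set ℂ) (fhat : ℕ → ℂ → ℂ) (φ f : ℂ → ℂ → ℂ) :
    Prop where
  continuation : IsBorelContinuation θ η U fhat φ
  integrable : ∀ x ∈ U, ∀ h ∈ S,
    MeasureTheory.IntegrableOn (laplaceIntegrand θ (φ x) h) (Ioi 0)
  uniform : TendstoUniformlyOn
    (fun (R : ℝ) (p : ℂ × ℂ) => ∫ u in (0 : ℝ)..R, laplaceIntegrand θ (φ p.1) p.2 u)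
    (fun p => laplace θ (φ p.1) p.2) atTop (U ×ˢ S)
  eq_laplace : ∀ x ∈ U, ∀ h ∈ S, f x h = fhat 0 x + laplace θ (φ x) h

end ExactRiccati

end

/-!
# Borel summability of formal solutions of a singularly perturbed Riccati equation

The whole construction takes place in the `ħ`-plane; the Borel plane enters only at the end.

*Formal solution.* At the leading order the equation `ħ ∂ₓ f = a f² + b f + c` is the quadratic
equation `a₀ f₀² + b₀ f₀ + c₀ = 0`, whose root labelled by `α` is holomorphic on `W` under the sign
conditions at the zeros of `a₀` (`exists_leadingTerm`). The equation of order `n + 1` is linear in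
the coefficient of order `n + 1`, with slope `2 a₀ f₀ + b₀ = α √D₀`, which does not vanish
(`exists_formalSolution`, `formalSolution_unique`).

*Exact solution on the halfstrip.* In the coordinate `z` with `x = Ψ z`, and after division by
`√D₀`, the coefficients are bounded and the leading-order discriminant is `1`, but the root `φ = f₀`
can be unbounded. The Möbius substitution `f = φ + y / (1 - κ y)` with `κ = α a₀ / √D₀` moves the
two roots to `y = 0` and `y = ∞`, and a gauge factor `exp g` with `g' = 2 κ φ'` removes the only
unbounded linear term (`riccati_transform`). In the coordinate `s = e^{iθ} / ħ`, and with the strip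
rotated to a horizontal one, the equation becomes `∂Y = s Y + p + q Y + r Y²`, where `p`, `q`, `r`
are bounded by multiples of `w`, `1`, `1 / w` for the weight `w = (1 + |φ|²) |exp (-g)|`. The point
is that `w` grows at most exponentially along the strip (`LeadingData.translationWeight`), so that
for large `Re s` the equation is solved by the contraction
`Y ↦ -∫₀^∞ e^{-s u} (p + q Y + r Y²)(ζ + u) du`, with a solution as small as desired
(`TranslationWeight.exists_riccati_solution`, `exists_exactSolution_halfstrip`).

*Gevrey bounds.* A remainder of order `m` divided by `ħ ^ m` obeys the same recursion as the
coefficients of the formal solution (`RemSeq.riccati`). An induction in which the loss of a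
derivative is paid for by the distance to the boundary, as in Nagumo's lemma, bounds the remainders
and the coefficients at once, for every bounded solution that stays close to `f₀`
(`exists_gevrey_bound`, `RiccatiData.hasGevreyBounds`).

*Descent and uniqueness.* By Watson's lemma two functions on a Borel disc with the same uniform
Gevrey expansion agree (`eq_of_hasGevreyBounds`): in the coordinate `s` their difference decays
exponentially on a half plane, and the Phragmén–Lindelöf principle applies. This gives the
uniqueness of the canonical solution (`IsCanonicalSolution.eq`). It also shows that the solution on
the halfstrip takes the same values at points with the same image under `Ψ`, hence descends to a
neighbourhood of the closure of `U₀` although `Ψ` need not be injective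
(`RiccatiData.exists_exactSolution`).

*Borel summability.* It follows from the uniform Gevrey bounds by Nevanlinna's theorem
(`exists_isBorelResummation`). The inverse Laplace transforms of the remainders are the successive
derivatives of the Borel transform along the half line, with Taylor series of a fixed radius of
convergence at every point; these glue to a holomorphic function on a tube (`taylorSum_sub_eq`), and
Fourier inversion identifies its Laplace transform (`QuadDecay.laplace_invLaplace`).
-/

namespace ExactRiccati

open MeasureTheory

/-! ### Holomorphic functions of two variables -/

/-- If `f` is continuous in both variables and holomorphic in the first, then its partial derivative
is continuous in both: the functions `f (·, y)` converge locally uniformly, hence so do their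
derivatives. -/
theorem continuousAt_deriv_of_continuousOn {f : ℂ × ℂ → ℂ} {U : Set (ℂ × ℂ)} (hU : IsOpen U)
    (hc : ContinuousOn f U) (h1 : ∀ p ∈ U, DifferentiableAt ℂ (fun x => f (x, p.2)) p.1)
    {p : ℂ × ℂ} (hp : p ∈ U) :
    ContinuousAt (fun q : ℂ × ℂ => deriv (fun x => f (x, q.2)) q.1) p := by
  obtain ⟨x0, y0⟩ := p
  obtain ⟨A, hA, B, hB, hAB⟩ := mem_nhds_prod_iff.1 (hU.mem_nhds hp)
  obtain ⟨V, hVA, hVo, hxV⟩ := mem_nhds_iff.1 hA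
  have hlim : TendstoLocallyUniformlyOn (fun y x => f (x, y)) (fun x => f (x, y0)) (𝓝 y0) V := by
    rw [Metric.tendstoLocallyUniformlyOn_iff]
    intro ε hε x hx
    have hxy : (x, y0) ∈ U := hAB ⟨hVA hx, mem_of_mem_nhds hB⟩
    have h := Metric.continuousAt_iff'.1 (hc.continuousAt (hU.mem_nhds hxy)) (ε / 2) (by positivity)
    rw [nhds_prod_eq, eventually_prod_iff] at h
    obtain ⟨P, hP, Q, hQ, hPQ⟩ := h
    refine ⟨{x | P x}, mem_nhdsWithin_of_mem_nhds hP, ?_⟩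
    filter_upwards [hQ] with y hy x' hx'
    have e1 := hPQ hx' hy
    have e2 := hPQ hx' hQ.self_of_nhds
    calc dist (f (x', y0)) (f (x', y)) ≤ dist (f (x', y0)) (f (x, y0)) +
          dist (f (x', y)) (f (x, y0)) := dist_triangle_right _ _ _
      _ < ε := by linarith
  have hd := hlim.deriv (by
    filter_upwards [hB] with y hy x hx
    exact (h1 (x, y) (hAB ⟨hVA hx, hy⟩)).differentiableWithinAt) hVo
  have hc0 : ContinuousAt (deriv fun x => f (x, y0)) x0 := by
    have : DifferentiableOn ℂ (fun x => f (x, y0)) V := fun x hx =>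
      (h1 (x, y0) (hAB ⟨hVA hx, mem_of_mem_nhds hB⟩)).differentiableWithinAt
    exact ((this.deriv hVo).continuousOn.continuousAt (hVo.mem_nhds hxV))
  rw [Metric.continuousAt_iff']
  intro ε hε
  obtain ⟨t, ht, ht'⟩ := (Metric.tendstoLocallyUniformlyOn_iff.1 hd) (ε / 2) (by positivity) x0 hxV
  rw [hVo.nhdsWithin_eq hxV] at ht
  have h2 := Metric.continuousAt_iff'.1 hc0 (ε / 2) (by positivity)
  rw [nhds_prod_eq]
  filter_upwards [(eventually_mem_set.2 ht |>.and h2).prod_mk ht'] with q hq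
  have e1 := hq.2 q.1 hq.1.1
  have e2 := hq.1.2
  simp only [Function.comp] at e1
  calc _ ≤ dist (deriv (fun x => f (x, q.2)) q.1) (deriv (fun x => f (x, y0)) q.1) +
        dist (deriv (fun x => f (x, y0)) q.1) (deriv (fun x => f (x, y0)) x0) :=
        dist_triangle _ _ _
    _ < ε := by rw [dist_comm (deriv (fun x => f (x, q.2)) q.1)]; linarith

/-- Osgood's lemma in two variables. -/
theorem differentiableOn_prod_of_separately {f : ℂ × ℂ → ℂ} {U : Set (ℂ × ℂ)} (hU : IsOpen U)
    (hc : ContinuousOn f U) (h1 : ∀ p ∈ U, DifferentiableAt ℂ (fun x => f (x, p.2)) p.1)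
    (h2 : ∀ p ∈ U, DifferentiableAt ℂ (fun y => f (p.1, y)) p.2) : DifferentiableOn ℂ f U := by
  intro p hp
  have c1 := continuousAt_deriv_of_continuousOn hU hc h1 hp
  have c2 : ContinuousAt (fun q : ℂ × ℂ => deriv (fun y => f (q.1, y)) q.2) p := by
    have hs : ContinuousOn (fun q : ℂ × ℂ => f q.swap) (Prod.swap ⁻¹' U) :=
      hc.comp continuous_swap.continuousOn (fun q hq => hq)
    have := continuousAt_deriv_of_continuousOn (f := fun q => f q.swap)
      (hU.preimage continuous_swap) hs (fun q hq => h2 q.swap hq) (p := p.swap) (by simpa using hp)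
    exact ContinuousAt.comp (g := fun q : ℂ × ℂ => deriv (fun x => f (q.2, x)) q.1)
      (f := Prod.swap) (x := p) this continuous_swap.continuousAt
  have key := hasStrictFDerivAt_uncurry_coprod (𝕜 := ℂ) (u := p) (f := fun x y => f (x, y))
    (f₁ := fun x y => ContinuousLinearMap.toSpanSingleton ℂ (deriv (fun x => f (x, y)) x))
    (f₂ := fun x y => ContinuousLinearMap.toSpanSingleton ℂ (deriv (fun y => f (x, y)) y))
    (by
      filter_upwards [hU.mem_nhds hp] with q hq
      exact (h1 q hq).hasDerivAt.hasFDerivAt)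
    (by
      filter_upwards [hU.mem_nhds hp] with q hq
      exact (h2 q hq).hasDerivAt.hasFDerivAt)
    (by
      exact (ContinuousLinearMap.toSpanSingletonCLE (𝕜 := ℂ)
        (E := ℂ)).continuous.continuousAt.comp c1)
    (by
      exact (ContinuousLinearMap.toSpanSingletonCLE (𝕜 := ℂ)
        (E := ℂ)).continuous.continuousAt.comp c2)
  exact key.hasFDerivAt.differentiableAt.differentiableWithinAt

theorem differentiableOn_prod_of_tendstoLocallyUniformlyOn {ι : Type*} {l : Filter ι} [l.NeBot]
    {F : ι → ℂ × ℂ → ℂ} {f : ℂ × ℂ → ℂ} {U : Set (ℂ × ℂ)} (hU : IsOpen U)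
    (hF : ∀ᶠ n in l, DifferentiableOn ℂ (F n) U) (h : TendstoLocallyUniformlyOn F f l U) :
    DifferentiableOn ℂ f U := by
  refine differentiableOn_prod_of_separately hU
    (h.continuousOn (hF.mono fun n hn => hn.continuousOn).frequently) ?_ ?_
  · intro p hp
    have hV : IsOpen ((fun x : ℂ => (x, p.2)) ⁻¹' U) := hU.preimage (by fun_prop)
    have := (h.comp (fun x : ℂ => (x, p.2)) (t := (fun x : ℂ => (x, p.2)) ⁻¹' U) (fun x hx => hx)
      (by fun_prop)).differentiableOn (hF.mono fun n hn => hn.comp (by fun_prop) fun x hx => hx) hV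
    exact this.differentiableAt (hV.mem_nhds hp)
  · intro p hp
    have hV : IsOpen ((fun x : ℂ => (p.1, x)) ⁻¹' U) := hU.preimage (by fun_prop)
    have := (h.comp (fun x : ℂ => (p.1, x)) (t := (fun x : ℂ => (p.1, x)) ⁻¹' U) (fun x hx => hx)
      (by fun_prop)).differentiableOn (hF.mono fun n hn => hn.comp (by fun_prop) fun x hx => hx) hV
    exact this.differentiableAt (hV.mem_nhds hp)

/-! ### Integrals depending holomorphically on parameters -/

theorem differentiableOn_integral_of_dominated {T : Type*} [MeasurableSpace T] {μ : Measure T}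
    {f : ℂ → T → ℂ} {U : Set ℂ} (hU : IsOpen U) (hmeas : ∀ z ∈ U, AEStronglyMeasurable (f z) μ)
    (hd : ∀ᵐ t ∂μ, DifferentiableOn ℂ (fun z => f z t) U)
    (hb : ∀ z₀ ∈ U, ∃ V ∈ 𝓝 z₀, ∃ g : T → ℝ, Integrable g μ ∧ ∀ᵐ t ∂μ, ∀ z ∈ V, ‖f z t‖ ≤ g t) :
    DifferentiableOn ℂ (fun z => ∫ t, f z t ∂μ) U := by
  intro z₀ hz₀
  obtain ⟨V, hV, g, hg, hfg⟩ := hb z₀ hz₀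
  obtain ⟨R, hR, hball⟩ := Metric.mem_nhds_iff.1 (inter_mem hV (hU.mem_nhds hz₀))
  have hsub : ∀ z ∈ Metric.ball z₀ (R / 2), Metric.closedBall z (R / 4) ⊆ Metric.ball z₀ R := by
    intro z hz w hw
    have h1 := Metric.mem_ball.1 hz
    have h2 := Metric.mem_closedBall.1 hw
    have h3 := dist_triangle w z z₀
    exact Metric.mem_ball.2 (by linarith)
  have hmem : z₀ ∈ Metric.ball z₀ (R / 2) := Metric.mem_ball_self (by positivity)
  -- the derivative of the integrand is measurable, being a limit of difference quotients
  have hderivmeas : AEStronglyMeasurable (fun t => deriv (fun z => f z t) z₀) μ := by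
    obtain ⟨u, hu⟩ : ∃ u : ℕ → ℂ, u = fun n : ℕ => (↑((R / 2) / ((n : ℝ) + 1)) : ℂ) := ⟨_, rfl⟩
    have hun : ∀ n, ‖u n‖ = (R / 2) / ((n : ℝ) + 1) := fun n => by
      rw [hu]; simp only [Complex.norm_real, Real.norm_eq_abs]; exact abs_of_pos (by positivity)
    have hu0 : ∀ n, u n ≠ 0 := fun n => by
      rw [← norm_pos_iff, hun]; positivity
    have hut : Tendsto u atTop (𝓝 0) := by
      rw [tendsto_zero_iff_norm_tendsto_zero]
      simp_rw [hun]
      exact tendsto_const_nhds.div_atTop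
        (tendsto_atTop_add_const_right _ _ tendsto_natCast_atTop_atTop)
    have hin : ∀ n, z₀ + u n ∈ U := fun n => by
      refine (hball ?_).2
      rw [Metric.mem_ball, dist_self_add_left, hun]
      have h1 : (R / 2) / ((n : ℝ) + 1) ≤ R / 2 :=
        div_le_self (by positivity) (by linarith [n.cast_nonneg (α := ℝ)])
      linarith
    refine aestronglyMeasurable_of_tendsto_ae atTop
      (f := fun (n : ℕ) t => (u n)⁻¹ • (f (z₀ + u n) t - f z₀ t))
      (fun n => AEStronglyMeasurable.const_smul
        (f := fun t => f (z₀ + u n) t - f z₀ t) ((hmeas _ (hin n)).sub (hmeas _ hz₀)) (u n)⁻¹) ?_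
    filter_upwards [hd] with t ht
    have := (ht.differentiableAt (hU.mem_nhds hz₀)).hasDerivAt
    have h2 := hasDerivAt_iff_tendsto_slope_zero.1 this
    refine h2.comp (tendsto_nhdsWithin_iff.2 ⟨hut, Eventually.of_forall fun n => hu0 n⟩)
  refine (hasDerivAt_integral_of_dominated_loc_of_deriv_le (𝕜 := ℂ) (s := Metric.ball z₀ (R / 2))
    (F' := fun z t => deriv (fun z => f z t) z) (bound := fun t => g t / (R / 4))
    (Metric.ball_mem_nhds _ (by positivity)) ?_ ?_ hderivmeas ?_ (hg.div_const _)
    ?_).2.differentiableAt.differentiableWithinAt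
  · filter_upwards [hU.mem_nhds hz₀] with z hz using hmeas z hz
  · refine hg.mono' (hmeas _ hz₀) ?_
    filter_upwards [hfg] with t ht using ht _ (mem_of_mem_nhds hV)
  · filter_upwards [hfg, hd] with t ht hdt z hz
    refine Complex.norm_deriv_le_of_forall_mem_sphere_norm_le (by positivity) ?_ ?_
    · refine (DifferentiableOn.diffContOnCl ?_)
      rw [closure_ball _ (by positivity)]
      exact hdt.mono ((hsub z hz).trans fun y hy => (hball hy).2)
    · intro w hw
      exact ht w (hball (hsub z hz (Metric.sphere_subset_closedBall hw))).1
  · filter_upwards [hd] with t ht z hz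
    have : z ∈ U := (hball (Metric.ball_subset_ball (by linarith) hz)).2
    exact (ht.differentiableAt (hU.mem_nhds this)).hasDerivAt

theorem differentiableOn_prod_integral_of_dominated {T : Type*} [MeasurableSpace T]
    {μ : Measure T} {f : ℂ × ℂ → T → ℂ} {U : Set (ℂ × ℂ)} (hU : IsOpen U)
    (hmeas : ∀ z ∈ U, AEStronglyMeasurable (f z) μ)
    (hd : ∀ᵐ t ∂μ, DifferentiableOn ℂ (fun z => f z t) U)
    (hb : ∀ z₀ ∈ U, ∃ V ∈ 𝓝 z₀, ∃ g : T → ℝ, Integrable g μ ∧ ∀ᵐ t ∂μ, ∀ z ∈ V, ‖f z t‖ ≤ g t) :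
    DifferentiableOn ℂ (fun z => ∫ t, f z t ∂μ) U := by
  refine differentiableOn_prod_of_separately hU ?_ ?_ ?_
  · intro z₀ hz₀
    obtain ⟨V, hV, g, hg, hfg⟩ := hb z₀ hz₀
    refine ContinuousAt.continuousWithinAt (continuousAt_of_dominated (bound := g) ?_ ?_ hg ?_)
    · filter_upwards [hU.mem_nhds hz₀] with z hz using hmeas z hz
    · filter_upwards [hV] with z hz
      filter_upwards [hfg] with t ht using ht z hz
    · filter_upwards [hd] with t ht using (ht.differentiableAt (hU.mem_nhds hz₀)).continuousAt
  · intro p hp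
    have hc : Continuous fun x : ℂ => (x, p.2) := by fun_prop
    refine (differentiableOn_integral_of_dominated (f := fun x t => f (x, p.2) t)
      (hU.preimage hc) (fun z hz => hmeas _ hz) ?_ ?_).differentiableAt
      ((hU.preimage hc).mem_nhds hp)
    · filter_upwards [hd] with t ht
      exact ht.comp (by fun_prop) fun x hx => hx
    · intro z₀ hz₀
      obtain ⟨V, hV, g, hg, hfg⟩ := hb _ hz₀
      refine ⟨_, hc.continuousAt.preimage_mem_nhds hV, g, hg, ?_⟩
      filter_upwards [hfg] with t ht z hz using ht _ hz
  · intro p hp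
    have hc : Continuous fun x : ℂ => (p.1, x) := by fun_prop
    refine (differentiableOn_integral_of_dominated (f := fun x t => f (p.1, x) t)
      (hU.preimage hc) (fun z hz => hmeas _ hz) ?_ ?_).differentiableAt
      ((hU.preimage hc).mem_nhds hp)
    · filter_upwards [hd] with t ht
      exact ht.comp (by fun_prop) fun x hx => hx
    · intro z₀ hz₀
      obtain ⟨V, hV, g, hg, hfg⟩ := hb _ hz₀
      refine ⟨_, hc.continuousAt.preimage_mem_nhds hV, g, hg, ?_⟩
      filter_upwards [hfg] with t ht z hz using ht _ hz

/-! ### Primitives and derivative estimates -/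

/-- A consequence of the Poincaré lemma on convex sets. -/
theorem exists_primitive_of_convex {g : ℂ → ℂ} {U : Set ℂ} (hU : IsOpen U) (hc : Convex ℝ U)
    (hg : DifferentiableOn ℂ g U) : ∃ G : ℂ → ℂ, ∀ z ∈ U, HasDerivAt G (g z) z := by
  obtain ⟨G, hG⟩ := hc.exists_forall_hasFDerivWithinAt_of_hasFDerivWithinAt_symmetric
    (𝕜 := ℂ) (ω := fun z => ContinuousLinearMap.toSpanSingleton ℂ (g z))
    (dω := fun z =>
      ((ContinuousLinearMap.toSpanSingletonCLE (𝕜 := ℂ) (E := ℂ)).toContinuousLinearMap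
      ∘L (ContinuousLinearMap.toSpanSingleton ℂ (deriv g z))).restrictScalars ℝ)
    (fun z hz => by
      have h1 := (hg.differentiableAt (hU.mem_nhds hz)).hasDerivAt.hasFDerivAt
      have h2 := (ContinuousLinearMap.toSpanSingletonCLE (𝕜 := ℂ)
        (E := ℂ)).toContinuousLinearMap.hasFDerivAt.comp z h1
      exact (h2.restrictScalars ℝ).hasFDerivWithinAt)
    (fun a _ x _ y _ => by simp; ring)
  exact ⟨G, fun z hz => by
    simpa using ((hG z hz).hasFDerivAt (hU.mem_nhds hz)).hasDerivAt⟩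

/-- Cauchy's estimate on an open ball. -/
theorem norm_deriv_le_of_ball {f : ℂ → ℂ} {z : ℂ} {ρ C : ℝ} (hρ : 0 < ρ)
    (hd : DifferentiableOn ℂ f (Metric.ball z ρ)) (hC : ∀ w ∈ Metric.ball z ρ, ‖f w‖ ≤ C) :
    ‖deriv f z‖ ≤ C / ρ := by
  have hC0 : 0 ≤ C := (norm_nonneg _).trans (hC z (Metric.mem_ball_self hρ))
  have key : ∀ r ∈ Ioo 0 ρ, ‖deriv f z‖ * r ≤ C := by
    intro r hr
    have := Complex.norm_deriv_le_of_forall_mem_sphere_norm_le (f := f) (c := z) (C := C) hr.1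
      (DifferentiableOn.diffContOnCl (by
        rw [closure_ball _ hr.1.ne']
        exact hd.mono (Metric.closedBall_subset_ball hr.2)))
      (fun w hw => hC w ((Metric.sphere_subset_closedBall.trans
        (Metric.closedBall_subset_ball hr.2)) hw))
    rwa [le_div_iff₀ hr.1] at this
  rw [le_div_iff₀ hρ]
  refine ContinuousWithinAt.closure_le (s := Ioo 0 ρ) (f := fun r => ‖deriv f z‖ * r)
    (g := fun _ => C) (x := ρ) ?_ ?_ ?_ key
  · rw [closure_Ioo hρ.ne]; exact right_mem_Icc.2 hρ.le
  · fun_prop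
  · fun_prop

/-! ### The formal solution -/

theorem coeff_zero_mul' (F G : PowerSeries ℂ) :
    PowerSeries.coeff 0 (F * G) = PowerSeries.coeff 0 F * PowerSeries.coeff 0 G := by
  simp [PowerSeries.coeff_mul]

/-- The dependence of the coefficients of `A F² + B F + C` on the coefficient of `F` of the same
order, which is linear, with the derivative of the leading-order polynomial as its slope. -/
theorem coeff_riccati_sub {A B C F G : PowerSeries ℂ} {n : ℕ}
    (hFG : ∀ k ≤ n, PowerSeries.coeff k F = PowerSeries.coeff k G) :
    PowerSeries.coeff (n + 1) (A * F ^ 2 + B * F + C) =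
      PowerSeries.coeff (n + 1) (A * G ^ 2 + B * G + C) +
      (2 * PowerSeries.coeff 0 A * PowerSeries.coeff 0 F + PowerSeries.coeff 0 B) *
        (PowerSeries.coeff (n + 1) F - PowerSeries.coeff (n + 1) G) := by
  obtain ⟨H, hH⟩ : (PowerSeries.X : PowerSeries ℂ) ^ (n + 1) ∣ F - G := by
    rw [PowerSeries.X_pow_dvd_iff]
    intro m hm
    rw [map_sub, hFG m (by omega), sub_self]
  have h0 : PowerSeries.coeff (n + 1) (F - G) = PowerSeries.coeff 0 H := by
    rw [hH]
    have := PowerSeries.coeff_X_pow_mul H (n + 1) 0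
    rwa [zero_add] at this
  have h1 : A * F ^ 2 + B * F + C =
      A * G ^ 2 + B * G + C + PowerSeries.X ^ (n + 1) * ((A * (F + G) + B) * H) := by
    have : F = G + PowerSeries.X ^ (n + 1) * H := by rw [← hH]; ring
    rw [this]; ring
  have h2 := PowerSeries.coeff_X_pow_mul ((A * (F + G) + B) * H) (n + 1) 0
  rw [zero_add] at h2
  rw [h1, map_add, h2, ← map_sub, h0]
  simp only [coeff_zero_mul', map_add]
  rw [hFG 0 (Nat.zero_le n)]
  ring

theorem coeff_seriesAt (u : ℕ → ℂ → ℂ) (k : ℕ) (x : ℂ) :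
    PowerSeries.coeff k (seriesAt u x) = u k x := by
  simp [seriesAt]

/-- The right-hand side of the Riccati equation, as a power series. -/
noncomputable def riccatiSeries (ahat bhat chat fhat : ℕ → ℂ → ℂ) (x : ℂ) : PowerSeries ℂ :=
  seriesAt ahat x * seriesAt fhat x ^ 2 + seriesAt bhat x * seriesAt fhat x + seriesAt chat x

theorem coeff_zero_riccatiSeries (ahat bhat chat fhat : ℕ → ℂ → ℂ) (x : ℂ) :
    PowerSeries.coeff 0 (riccatiSeries ahat bhat chat fhat x) =
      ahat 0 x * fhat 0 x ^ 2 + bhat 0 x * fhat 0 x + chat 0 x := by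
  simp only [riccatiSeries, map_add, coeff_zero_mul', pow_two, coeff_seriesAt]

theorem isFormalSolution_iff {ahat bhat chat : ℕ → ℂ → ℂ} {U : Set ℂ} {fhat : ℕ → ℂ → ℂ} :
    IsFormalSolution ahat bhat chat U fhat ↔
      (∀ k, DifferentiableOn ℂ (fhat k) U) ∧ ∀ x ∈ U,
        ahat 0 x * fhat 0 x ^ 2 + bhat 0 x * fhat 0 x + chat 0 x = 0 ∧
        ∀ n, deriv (fhat n) x =
          PowerSeries.coeff (n + 1) (riccatiSeries ahat bhat chat fhat x) := by
  refine and_congr_right fun _ => forall₂_congr fun x _ => ?_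
  constructor
  · intro h
    refine ⟨?_, fun n => ?_⟩
    · rw [← coeff_zero_riccatiSeries, riccatiSeries, ← h]; simp
    · rw [riccatiSeries, ← h, PowerSeries.coeff_succ_X_mul, coeff_seriesAt]
  · rintro ⟨h0, h1⟩
    ext n
    cases n with
    | zero =>
      change _ = PowerSeries.coeff 0 (riccatiSeries ahat bhat chat fhat x)
      rw [coeff_zero_riccatiSeries, h0]; simp
    | succ n =>
      change _ = PowerSeries.coeff (n + 1) (riccatiSeries ahat bhat chat fhat x)
      rw [← h1, PowerSeries.coeff_succ_X_mul, coeff_seriesAt]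

theorem differentiableOn_coeff_riccatiSeries {ahat bhat chat fhat : ℕ → ℂ → ℂ} {U : Set ℂ}
    (ha : ∀ k, DifferentiableOn ℂ (ahat k) U) (hb : ∀ k, DifferentiableOn ℂ (bhat k) U)
    (hc : ∀ k, DifferentiableOn ℂ (chat k) U) (hf : ∀ k, DifferentiableOn ℂ (fhat k) U) (n : ℕ) :
    DifferentiableOn ℂ (fun x => PowerSeries.coeff n (riccatiSeries ahat bhat chat fhat x)) U := by
  simp only [riccatiSeries, map_add, pow_two, PowerSeries.coeff_mul, coeff_seriesAt]
  refine ((DifferentiableOn.fun_sum fun i _ => (ha _).mul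
    (DifferentiableOn.fun_sum fun j _ => (hf _).mul (hf _))).add
    (DifferentiableOn.fun_sum fun i _ => (hb _).mul (hf _))).add (hc _)

/-- The formal solution truncated after the term of order `n`, for a given leading term `f₀`; in the
recursion `s` stands for `2 a₀ f₀ + b₀`. -/
noncomputable def formalTrunc (ahat bhat chat : ℕ → ℂ → ℂ) (f₀ s : ℂ → ℂ) : ℕ → ℕ → ℂ → ℂ
  | 0 => Function.update (fun _ _ => 0) 0 f₀
  | n + 1 => Function.update (formalTrunc ahat bhat chat f₀ s n) (n + 1) fun x =>
      (deriv (formalTrunc ahat bhat chat f₀ s n n) x -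
        PowerSeries.coeff (n + 1)
          (riccatiSeries ahat bhat chat (formalTrunc ahat bhat chat f₀ s n) x)) / s x

theorem formalTrunc_of_lt (ahat bhat chat : ℕ → ℂ → ℂ) (f₀ s : ℂ → ℂ) {n k : ℕ} (h : n < k) :
    formalTrunc ahat bhat chat f₀ s n k = fun _ => 0 := by
  induction n with
  | zero => rw [formalTrunc, Function.update_of_ne (by omega)]
  | succ n ih => rw [formalTrunc, Function.update_of_ne (by omega), ih (by omega)]

theorem formalTrunc_of_le (ahat bhat chat : ℕ → ℂ → ℂ) (f₀ s : ℂ → ℂ) {n k : ℕ} (h : k ≤ n) :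
    formalTrunc ahat bhat chat f₀ s n k = formalTrunc ahat bhat chat f₀ s k k := by
  induction n with
  | zero => rw [Nat.le_zero.1 h]
  | succ n ih =>
    rcases h.lt_or_eq with h | rfl
    · rw [formalTrunc, Function.update_of_ne (by omega), ih (by omega)]
    · rfl

/-- A root of the leading-order polynomial that is simple everywhere is the leading term of a formal
solution: the coefficient of order `n + 1` solves a linear equation with slope
`s = 2 a₀ f₀ + b₀`. -/
theorem exists_formalSolution {ahat bhat chat : ℕ → ℂ → ℂ} {f₀ s : ℂ → ℂ} {U : Set ℂ}
    (hU : IsOpen U) (ha : ∀ k, DifferentiableOn ℂ (ahat k) U)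
    (hb : ∀ k, DifferentiableOn ℂ (bhat k) U) (hc : ∀ k, DifferentiableOn ℂ (chat k) U)
    (hf₀ : DifferentiableOn ℂ f₀ U) (hs : DifferentiableOn ℂ s U) (hs0 : ∀ x ∈ U, s x ≠ 0)
    (h0 : ∀ x ∈ U, ahat 0 x * f₀ x ^ 2 + bhat 0 x * f₀ x + chat 0 x = 0)
    (h1 : ∀ x ∈ U, 2 * ahat 0 x * f₀ x + bhat 0 x = s x) :
    ∃ fhat : ℕ → ℂ → ℂ, fhat 0 = f₀ ∧ IsFormalSolution ahat bhat chat U fhat := by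
  obtain ⟨F, hF⟩ : ∃ F, F = formalTrunc ahat bhat chat f₀ s := ⟨_, rfl⟩
  have hF0 : F 0 0 = f₀ := by rw [hF, formalTrunc, Function.update_self]
  have hle : ∀ {n k}, k ≤ n → F n k = F k k := fun h => by
    rw [hF]; exact formalTrunc_of_le _ _ _ _ _ h
  have hlt : ∀ {n k}, n < k → F n k = fun _ => 0 := fun h => by
    rw [hF]; exact formalTrunc_of_lt _ _ _ _ _ h
  have hsucc : ∀ n, F (n + 1) (n + 1) = fun x => (deriv (F n n) x -
      PowerSeries.coeff (n + 1) (riccatiSeries ahat bhat chat (F n) x)) / s x := fun n => by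
    rw [hF, formalTrunc, Function.update_self]
  have hdiff : ∀ n, DifferentiableOn ℂ (F n n) U := by
    intro n
    induction n using Nat.strong_induction_on with
    | _ n ih =>
      cases n with
      | zero => rwa [hF0]
      | succ n =>
        have hall : ∀ k, DifferentiableOn ℂ (F n k) U := by
          intro k
          rcases Nat.lt_or_ge n k with h | h
          · rw [hlt h]; fun_prop
          · rw [hle h]; exact ih k (by omega)
        rw [hsucc]
        exact ((((ih n (by omega)).deriv hU)).sub
          (differentiableOn_coeff_riccatiSeries ha hb hc hall (n + 1))).div hs hs0
  refine ⟨fun k => F k k, hF0, isFormalSolution_iff.2 ⟨hdiff, fun x hx => ⟨?_, fun n => ?_⟩⟩⟩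
  · simpa only [hF0] using h0 x hx
  · have key := coeff_riccati_sub (A := seriesAt ahat x) (B := seriesAt bhat x)
      (C := seriesAt chat x) (F := seriesAt (fun k => F k k) x) (G := seriesAt (F n) x) (n := n)
      (fun k hk => by rw [coeff_seriesAt, coeff_seriesAt, hle hk])
    simp only [coeff_seriesAt, hF0, h1 x hx, hlt (Nat.lt_succ_self n), hsucc] at key
    rw [riccatiSeries, key, riccatiSeries, sub_zero, mul_div_cancel₀ _ (hs0 x hx)]
    ring

theorem formalSolution_unique {ahat bhat chat : ℕ → ℂ → ℂ} {s : ℂ → ℂ} {U : Set ℂ}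
    (hU : IsOpen U) {fhat ghat : ℕ → ℂ → ℂ} (hf : IsFormalSolution ahat bhat chat U fhat)
    (hg : IsFormalSolution ahat bhat chat U ghat) (hs0 : ∀ x ∈ U, s x ≠ 0)
    (h1 : ∀ x ∈ U, 2 * ahat 0 x * fhat 0 x + bhat 0 x = s x)
    (h2 : ∀ x ∈ U, 2 * ahat 0 x * ghat 0 x + bhat 0 x = s x) (k : ℕ) :
    EqOn (ghat k) (fhat k) U := by
  rw [isFormalSolution_iff] at hf hg
  induction k using Nat.strong_induction_on with
  | _ k ih =>
    intro x hx
    cases k with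
    | zero =>
      have e1 := (hf.2 x hx).1
      have e2 := (hg.2 x hx).1
      have e3 := h1 x hx
      have e4 := h2 x hx
      -- the label determines the leading term where `a₀ ≠ 0`, the equation does where `a₀ = 0`
      have e5 : s x * (ghat 0 x - fhat 0 x) = 0 := by
        linear_combination e2 - e1 - (ghat 0 x - fhat 0 x) * e4 / 2 - (ghat 0 x - fhat 0 x) * e3 / 2
      exact sub_eq_zero.1 ((mul_eq_zero.1 e5).resolve_left (hs0 x hx))
    | succ n =>
      have key := coeff_riccati_sub (A := seriesAt ahat x) (B := seriesAt bhat x)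
        (C := seriesAt chat x) (F := seriesAt ghat x) (G := seriesAt fhat x) (n := n)
        (fun k hk => by rw [coeff_seriesAt, coeff_seriesAt, ih k (by omega) hx])
      have e1 := (hf.2 x hx).2 n
      have e2 := (hg.2 x hx).2 n
      rw [riccatiSeries] at e1 e2
      rw [← e1, ← e2] at key
      have e3 : deriv (ghat n) x = deriv (fhat n) x :=
        Filter.EventuallyEq.deriv_eq ((ih n (by omega)).eventuallyEq_of_mem (hU.mem_nhds hx))
      simp only [coeff_seriesAt, h2 x hx, e3] at key
      exact sub_eq_zero.1 ((mul_eq_zero.1 (left_eq_add.1 key)).resolve_left (hs0 x hx))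

/-- The leading term of the labelled formal solution. Under the sign conditions at the zeros of
`a₀` it is holomorphic: near such a zero it equals `-2 c₀ / (b₀ + √D₀)`. -/
theorem exists_leadingTerm {a₀ b₀ c₀ sq : ℂ → ℂ} {α : ℝ} {U : Set ℂ} (hU : IsOpen U)
    (hα : α = 1 ∨ α = -1)
    (ha : DifferentiableOn ℂ a₀ U) (hb : DifferentiableOn ℂ b₀ U) (hc : DifferentiableOn ℂ c₀ U)
    (hs : DifferentiableOn ℂ sq U) (hs0 : ∀ x ∈ U, sq x ≠ 0)
    (hD : ∀ x ∈ U, sq x ^ 2 = b₀ x ^ 2 - 4 * a₀ x * c₀ x)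
    (hplus : α = 1 → ∀ x ∈ U, a₀ x = 0 → b₀ x = sq x)
    (hminus : α = -1 → ∀ x ∈ U, a₀ x ≠ 0) :
    ∃ f₀ : ℂ → ℂ, DifferentiableOn ℂ f₀ U ∧
      (∀ x ∈ U, a₀ x * f₀ x ^ 2 + b₀ x * f₀ x + c₀ x = 0) ∧
      ∀ x ∈ U, 2 * a₀ x * f₀ x + b₀ x = α * sq x := by
  classical
  have hα2 : (α : ℂ) ^ 2 = 1 := by rcases hα with h | h <;> simp [h]
  have hz : ∀ x ∈ U, a₀ x = 0 → α = 1 ∧ b₀ x = sq x := fun x hx h0 => by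
    rcases hα with h | h
    · exact ⟨h, hplus h x hx h0⟩
    · exact absurd h0 (hminus h x hx)
  refine ⟨fun x => if a₀ x = 0 then -c₀ x / b₀ x else (-b₀ x + α * sq x) / (2 * a₀ x), ?_, ?_, ?_⟩
  · intro x hx
    refine DifferentiableAt.differentiableWithinAt ?_
    have da := ha.differentiableAt (hU.mem_nhds hx)
    have db := hb.differentiableAt (hU.mem_nhds hx)
    have dc := hc.differentiableAt (hU.mem_nhds hx)
    have ds := hs.differentiableAt (hU.mem_nhds hx)
    by_cases h0 : a₀ x = 0
    · obtain ⟨hα1, hbs⟩ := hz x hx h0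
      have hne : b₀ x + sq x ≠ 0 := by
        rw [hbs, ← two_mul]; exact mul_ne_zero two_ne_zero (hs0 x hx)
      have hd : DifferentiableAt ℂ (fun y => -2 * c₀ y / (b₀ y + sq y)) x :=
        (dc.const_mul _).div (db.add ds) hne
      refine hd.congr_of_eventuallyEq ?_
      filter_upwards [hU.mem_nhds hx, (db.add ds).continuousAt.eventually_ne hne] with y hy hney
      simp only [Pi.add_apply] at hney
      by_cases h0y : a₀ y = 0
      · have hbs := (hz y hy h0y).2
        have := hs0 y hy
        simp only [h0y, if_true]
        rw [hbs] at hney ⊢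
        field_simp
        ring
      · simp only [h0y, if_false, hα1]
        rw [div_eq_div_iff (mul_ne_zero two_ne_zero h0y) hney]
        push_cast
        linear_combination hD y hy
    · have hd : DifferentiableAt ℂ (fun y => (-b₀ y + α * sq y) / (2 * a₀ y)) x :=
        (db.neg.add (ds.const_mul _)).div (da.const_mul _) (mul_ne_zero two_ne_zero h0)
      refine hd.congr_of_eventuallyEq ?_
      filter_upwards [da.continuousAt.eventually_ne h0] with y hy
      simp only [hy, if_false]
  · intro x hx
    by_cases h0 : a₀ x = 0
    · have hb0 : b₀ x ≠ 0 := by rw [(hz x hx h0).2]; exact hs0 x hx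
      simp only [h0, if_true]
      field_simp
      ring
    · simp only [h0, if_false]
      field_simp
      linear_combination sq x ^ 2 * hα2 + hD x hx
  · intro x hx
    by_cases h0 : a₀ x = 0
    · obtain ⟨hα1, hbs⟩ := hz x hx h0
      simp [h0, hα1, hbs]
    · simp only [h0, if_false]
      field_simp
      ring

/-! ### Scaled remainders of asymptotic expansions -/

/-- `t m` is the remainder of order `m`, divided by `h ^ m`, of a quantity `t 0` with expansion `G`
at the value `h` of the parameter. At `h = 0` this forces `t m` to be the `m`-th coefficient, so
that an expansion and its remainders obey the same identities. -/
def RemSeq (h : ℂ) (t : ℕ → ℂ) (G : PowerSeries ℂ) : Prop :=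
  ∀ m, t m = PowerSeries.coeff m G + h * t (m + 1)

/-- The scaled remainders of a product. -/
noncomputable def prodRem (G : PowerSeries ℂ) (t t' : ℕ → ℂ) (m : ℕ) : ℂ :=
  ∑ k ∈ Finset.range m, PowerSeries.coeff k G * t' (m - k) + t m * t' 0

/-- The scaled remainders of a product are given by `prodRem`; at `h = 0` this is the Cauchy
product. -/
theorem RemSeq.mul {h : ℂ} {t t' : ℕ → ℂ} {G G' : PowerSeries ℂ} (ht : RemSeq h t G)
    (ht' : RemSeq h t' G') : RemSeq h (prodRem G t t') (G * G') := by
  intro m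
  rw [prodRem, prodRem, PowerSeries.coeff_mul, Finset.Nat.sum_antidiagonal_eq_sum_range_succ
    (fun i j => PowerSeries.coeff i G * PowerSeries.coeff j G'), Finset.sum_range_succ,
    Finset.sum_range_succ, Nat.sub_self, Nat.add_sub_cancel_left, ht m, ht' 0, zero_add]
  have h1 : ∑ k ∈ Finset.range m, PowerSeries.coeff k G * t' (m - k) =
      ∑ k ∈ Finset.range m, PowerSeries.coeff k G * PowerSeries.coeff (m - k) G' +
      h * ∑ k ∈ Finset.range m, PowerSeries.coeff k G * t' (m + 1 - k) := by
    rw [Finset.mul_sum, ← Finset.sum_add_distrib]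
    refine Finset.sum_congr rfl fun k hk => ?_
    have hk := Finset.mem_range.1 hk
    rw [ht' (m - k), show m - k + 1 = m + 1 - k by omega]
    ring
  rw [h1]
  ring

theorem RemSeq.add {h : ℂ} {t t' : ℕ → ℂ} {G G' : PowerSeries ℂ} (ht : RemSeq h t G)
    (ht' : RemSeq h t' G') : RemSeq h (fun m => t m + t' m) (G + G') := by
  intro m
  simp only [map_add, ht m, ht' m]
  ring

/-- Scaled remainders are determined by the quantity and its expansion. -/
theorem RemSeq.eq {h : ℂ} {t t' : ℕ → ℂ} {G : PowerSeries ℂ} (ht : RemSeq h t G)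
    (ht' : RemSeq h t' G) (h0 : t 0 = t' 0) (m : ℕ) : t m = t' m := by
  by_cases hh : h = 0
  · rw [ht m, ht' m, hh, zero_mul, zero_mul]
  · induction m with
    | zero => exact h0
    | succ m ih =>
      have := ht m
      rw [ih, ht' m] at this
      exact (mul_left_cancel₀ hh (add_left_cancel this)).symm

/-- The Riccati equation for an exact quantity and its expansion together, solved for the scaled
remainder of order `m`. -/
theorem RemSeq.riccati {h : ℂ} {ta tb tc tf td : ℕ → ℂ} {A B C F D : PowerSeries ℂ}
    (ha : RemSeq h ta A) (hb : RemSeq h tb B) (hc : RemSeq h tc C) (hf : RemSeq h tf F)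
    (hd : RemSeq h td D) (hformal : PowerSeries.X * D = A * F ^ 2 + B * F + C)
    (hexact : h * td 0 = ta 0 * tf 0 ^ 2 + tb 0 * tf 0 + tc 0) (m : ℕ) :
    (PowerSeries.coeff 0 A * (PowerSeries.coeff 0 F + tf 0) + PowerSeries.coeff 0 B) * tf (m + 1) =
      td m - (∑ k ∈ Finset.Ico 1 (m + 1), (PowerSeries.coeff k (A * F) +
          PowerSeries.coeff k A * tf 0 + PowerSeries.coeff k B) * tf (m + 1 - k) +
        ta (m + 1) * tf 0 ^ 2 + tb (m + 1) * tf 0 + tc (m + 1)) := by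
  have h1 := (((ha.mul hf).mul hf).add (hb.mul hf)).add hc
  have h2 : RemSeq h (fun m => Nat.casesOn m (h * td 0) td) (A * F * F + B * F + C) := by
    rw [show A * F * F + B * F + C = PowerSeries.X * D by rw [hformal]; ring]
    intro m
    cases m with
    | zero => simp
    | succ m => simpa [PowerSeries.coeff_succ_X_mul] using hd m
  have h3 := h1.eq h2 (by
    change _ = h * td 0
    simp only [prodRem, Finset.range_zero, Finset.sum_empty]; linear_combination -hexact)
    (m + 1)
  simp only [prodRem] at h3
  rw [← h3]
  have hs : ∀ u : ℕ → ℂ, ∑ k ∈ Finset.range (m + 1), u k = u 0 + ∑ k ∈ Finset.Ico 1 (m + 1), u k :=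
    fun u => by rw [Finset.range_eq_Ico, Finset.sum_eq_sum_Ico_succ_bot (Nat.succ_pos m)]
  rw [hs, hs, hs]
  simp only [add_mul, Finset.sum_add_distrib, coeff_zero_mul', Nat.sub_zero]
  have : ∀ u : ℕ → ℂ, ∑ k ∈ Finset.Ico 1 (m + 1), u k * tf 0 * tf (m + 1 - k) =
      (∑ k ∈ Finset.Ico 1 (m + 1), u k * tf (m + 1 - k)) * tf 0 := fun u => by
    rw [Finset.sum_mul]; exact Finset.sum_congr rfl fun _ _ => by ring
  rw [this]
  ring

theorem sum_factorial_mul_factorial_le (m : ℕ) :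
    ∑ k ∈ Finset.Ico 1 m, (k.factorial * (m - k).factorial : ℝ) ≤ m.factorial := by
  rcases Nat.eq_zero_or_pos m with rfl | hm
  · simp
  calc ∑ k ∈ Finset.Ico 1 m, (k.factorial * (m - k).factorial : ℝ)
      ≤ ∑ k ∈ Finset.Ico 1 m, ((m - 1).factorial : ℝ) := by
        refine Finset.sum_le_sum fun k hk => ?_
        obtain ⟨h1, h2⟩ := Finset.mem_Ico.1 hk
        -- `(m - 1)! = (m - 1).choose k * k! * (m - 1 - k)!`, with a binomial coefficient `≥ m - k`
        have h3 : k.factorial * (m - k).factorial ≤ (m - 1).factorial := by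
          obtain ⟨j, rfl⟩ : ∃ j, m = k + (j + 1) := ⟨m - k - 1, by omega⟩
          rw [show k + (j + 1) - k = j + 1 by omega, show k + (j + 1) - 1 = k + j by omega]
          obtain ⟨i, rfl⟩ : ∃ i, k = i + 1 := ⟨k - 1, by omega⟩
          have e := Nat.choose_mul_factorial_mul_factorial (Nat.le_add_right (i + 1) j)
          rw [Nat.add_sub_cancel_left] at e
          have e2 : j + 1 ≤ (i + 1 + j).choose (i + 1) := by
            calc j + 1 ≤ (i + j + 1).choose (i + 1) := by
                  clear e h1 h2 hk hm
                  induction i with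
                  | zero => simp
                  | succ i ih =>
                    rw [show i + 1 + j + 1 = (i + j + 1) + 1 by ring, Nat.choose_succ_succ]
                    omega
              _ = _ := by rw [show i + 1 + j = i + j + 1 by ring]
          rw [← e, Nat.factorial_succ j]
          calc (i + 1).factorial * ((j + 1) * j.factorial)
              = (j + 1) * (i + 1).factorial * j.factorial := by ring
            _ ≤ _ := by gcongr
        exact_mod_cast h3
    _ ≤ m.factorial := by
        rw [Finset.sum_const, Nat.card_Ico, nsmul_eq_mul]
        have : (m - 1) * (m - 1).factorial ≤ m.factorial := by
          rw [← Nat.mul_factorial_pred hm.ne']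
          gcongr
          omega
        exact_mod_cast this

/-- Interior convolution of sequences of Gevrey growth. -/
theorem norm_sum_mul_le {u v : ℕ → ℂ} {P Q K d : ℝ} {m : ℕ} (hP : 0 ≤ P) (hQ : 0 ≤ Q)
    (hK : 0 ≤ K) (hd : 0 ≤ d)
    (hu : ∀ k, 1 ≤ k → k < m → ‖u k‖ * d ^ k ≤ P * (K ^ k * k.factorial))
    (hv : ∀ k, 1 ≤ k → k < m → ‖v k‖ * d ^ k ≤ Q * (K ^ k * k.factorial)) :
    ‖∑ k ∈ Finset.Ico 1 m, u k * v (m - k)‖ * d ^ m ≤ P * Q * (K ^ m * m.factorial) := by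
  calc ‖∑ k ∈ Finset.Ico 1 m, u k * v (m - k)‖ * d ^ m
      ≤ (∑ k ∈ Finset.Ico 1 m, ‖u k‖ * ‖v (m - k)‖) * d ^ m := by
        gcongr
        exact (norm_sum_le _ _).trans_eq (Finset.sum_congr rfl fun _ _ => norm_mul _ _)
    _ = ∑ k ∈ Finset.Ico 1 m, (‖u k‖ * d ^ k) * (‖v (m - k)‖ * d ^ (m - k)) := by
        rw [Finset.sum_mul]
        refine Finset.sum_congr rfl fun k hk => ?_
        obtain ⟨h1, h2⟩ := Finset.mem_Ico.1 hk
        have : d ^ m = d ^ k * d ^ (m - k) := by rw [← pow_add, Nat.add_sub_cancel' h2.le]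
        rw [this]; ring
    _ ≤ ∑ k ∈ Finset.Ico 1 m, (P * Q * K ^ m) * (k.factorial * (m - k).factorial : ℝ) := by
        refine Finset.sum_le_sum fun k hk => ?_
        obtain ⟨h1, h2⟩ := Finset.mem_Ico.1 hk
        calc (‖u k‖ * d ^ k) * (‖v (m - k)‖ * d ^ (m - k))
            ≤ (P * (K ^ k * k.factorial)) * (Q * (K ^ (m - k) * (m - k).factorial)) :=
              mul_le_mul (hu k h1 h2) (hv (m - k) (by omega) (by omega)) (by positivity)
                (by positivity)
          _ = _ := by
            have : K ^ m = K ^ k * K ^ (m - k) := by rw [← pow_add, Nat.add_sub_cancel' h2.le]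
            rw [this]; ring
    _ ≤ P * Q * (K ^ m * m.factorial) := by
        rw [← Finset.mul_sum, ← mul_assoc]
        gcongr
        exact sum_factorial_mul_factorial_le m

/-- One step of the induction for the Gevrey bounds. The interactions of two terms of positive order
produce the factor `L`, the coefficients of positive order the factor `ε`, and the derivative the
factor `E`; all three are small compared with the slope `μ` if `L` is small and `K` is large. -/
theorem RemSeq.riccati_bound {h : ℂ} {ta tb tc tf td : ℕ → ℂ} {A B C F D : PowerSeries ℂ}
    (ha : RemSeq h ta A) (hb : RemSeq h tb B) (hc : RemSeq h tc C) (hf : RemSeq h tf F)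
    (hd : RemSeq h td D) (hformal : PowerSeries.X * D = A * F ^ 2 + B * F + C)
    (hexact : h * td 0 = ta 0 * tf 0 ^ 2 + tb 0 * tf 0 + tc 0) (m : ℕ)
    {μ α ε φ L K d E : ℝ} (hε : 0 ≤ ε) (hL : 0 ≤ L) (hK : 0 ≤ K) (hd0 : 0 ≤ d)
    (hμ : μ ≤ ‖PowerSeries.coeff 0 A * (PowerSeries.coeff 0 F + tf 0) + PowerSeries.coeff 0 B‖)
    (hA0 : ‖PowerSeries.coeff 0 A‖ ≤ α)
    (hA : ∀ k, 1 ≤ k → ‖PowerSeries.coeff k A‖ * d ^ k ≤ ε * (K ^ k * k.factorial))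
    (hB : ∀ k, 1 ≤ k → ‖PowerSeries.coeff k B‖ * d ^ k ≤ ε * (K ^ k * k.factorial))
    (hta : ‖ta (m + 1)‖ * d ^ (m + 1) ≤ ε * (K ^ (m + 1) * (m + 1).factorial))
    (htb : ‖tb (m + 1)‖ * d ^ (m + 1) ≤ ε * (K ^ (m + 1) * (m + 1).factorial))
    (htc : ‖tc (m + 1)‖ * d ^ (m + 1) ≤ ε * (K ^ (m + 1) * (m + 1).factorial))
    (hF0 : ‖PowerSeries.coeff 0 F‖ ≤ φ) (htf0 : ‖tf 0‖ ≤ φ)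
    (hF : ∀ k, 1 ≤ k → k < m + 1 →
      ‖PowerSeries.coeff k F‖ * d ^ k ≤ L * (K ^ k * k.factorial))
    (htf : ∀ k, 1 ≤ k → k < m + 1 → ‖tf k‖ * d ^ k ≤ L * (K ^ k * k.factorial))
    (htd : ‖td m‖ * d ^ (m + 1) ≤ E * (K ^ (m + 1) * (m + 1).factorial)) :
    μ * (‖tf (m + 1)‖ * d ^ (m + 1)) ≤
      (E + (α * L + ε * L + ε * φ + ε * φ + ε) * L + ε * (φ ^ 2 + φ + 1)) *
        (K ^ (m + 1) * (m + 1).factorial) := by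
  have hα : 0 ≤ α := (norm_nonneg _).trans hA0
  have hφ : 0 ≤ φ := (norm_nonneg _).trans hF0
  have key := RemSeq.riccati ha hb hc hf hd hformal hexact m
  obtain ⟨u, hu⟩ : ∃ u : ℕ → ℂ, u = fun k => PowerSeries.coeff k (A * F) +
    PowerSeries.coeff k A * tf 0 + PowerSeries.coeff k B := ⟨_, rfl⟩
  have hAF : ∀ k, 1 ≤ k → k < m + 1 → ‖PowerSeries.coeff k (A * F)‖ * d ^ k ≤
      (α * L + ε * L + ε * φ) * (K ^ k * k.factorial) := by
    intro k hk1 hk2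
    rw [PowerSeries.coeff_mul, Finset.Nat.sum_antidiagonal_eq_sum_range_succ
      (fun i j => PowerSeries.coeff i A * PowerSeries.coeff j F), Finset.sum_range_succ,
      Finset.range_eq_Ico, Finset.sum_eq_sum_Ico_succ_bot hk1, Nat.sub_self, Nat.sub_zero, zero_add]
    have h1 := norm_sum_mul_le (m := k) (u := fun i => PowerSeries.coeff i A)
      (v := fun i => PowerSeries.coeff i F) hε hL hK hd0 (fun i hi _ => hA i hi)
      (fun i hi hi2 => hF i hi (by omega))
    have h2 : ‖PowerSeries.coeff 0 A * PowerSeries.coeff k F‖ * d ^ k ≤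
        α * (L * (K ^ k * k.factorial)) := by
      rw [norm_mul, mul_assoc]
      exact mul_le_mul hA0 (hF k hk1 hk2) (by positivity) hα
    have h3 : ‖PowerSeries.coeff k A * PowerSeries.coeff 0 F‖ * d ^ k ≤
        (ε * (K ^ k * k.factorial)) * φ := by
      rw [norm_mul, mul_right_comm]
      exact mul_le_mul (hA k hk1) hF0 (by positivity) (by positivity)
    have h4 := norm_add₃_le (a := PowerSeries.coeff 0 A * PowerSeries.coeff k F)
      (b := ∑ i ∈ Finset.Ico 1 k, PowerSeries.coeff i A * PowerSeries.coeff (k - i) F)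
      (c := PowerSeries.coeff k A * PowerSeries.coeff 0 F)
    have h5 := mul_le_mul_of_nonneg_right h4 (pow_nonneg hd0 k)
    refine h5.trans ?_
    rw [add_mul, add_mul]
    calc _ ≤ α * (L * (K ^ k * k.factorial)) + ε * L * (K ^ k * k.factorial) +
          (ε * (K ^ k * k.factorial)) * φ := by gcongr
      _ = _ := by ring
  have hub : ∀ k, 1 ≤ k → k < m + 1 → ‖u k‖ * d ^ k ≤
      (α * L + ε * L + ε * φ + ε * φ + ε) * (K ^ k * k.factorial) := by
    intro k hk1 hk2
    have h3 : ‖PowerSeries.coeff k A * tf 0‖ * d ^ k ≤ (ε * (K ^ k * k.factorial)) * φ := by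
      rw [norm_mul, mul_right_comm]
      exact mul_le_mul (hA k hk1) htf0 (by positivity) (by positivity)
    rw [hu]
    refine (mul_le_mul_of_nonneg_right norm_add₃_le (pow_nonneg hd0 k)).trans ?_
    rw [add_mul, add_mul]
    calc _ ≤ (α * L + ε * L + ε * φ) * (K ^ k * k.factorial) + (ε * (K ^ k * k.factorial)) * φ +
          ε * (K ^ k * k.factorial) := add_le_add (add_le_add (hAF k hk1 hk2) h3) (hB k hk1)
      _ = _ := by ring
  have hsum := norm_sum_mul_le (u := u) (v := tf) (m := m + 1) (by positivity) hL hK hd0 hub htf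
  calc μ * (‖tf (m + 1)‖ * d ^ (m + 1))
      ≤ ‖PowerSeries.coeff 0 A * (PowerSeries.coeff 0 F + tf 0) + PowerSeries.coeff 0 B‖ *
        (‖tf (m + 1)‖ * d ^ (m + 1)) := by gcongr
    _ = ‖td m - (∑ k ∈ Finset.Ico 1 (m + 1), u k * tf (m + 1 - k) +
        ta (m + 1) * tf 0 ^ 2 + tb (m + 1) * tf 0 + tc (m + 1))‖ * d ^ (m + 1) := by
        rw [← mul_assoc, ← norm_mul, key, hu]
    _ ≤ (‖td m‖ + (‖∑ k ∈ Finset.Ico 1 (m + 1), u k * tf (m + 1 - k)‖ +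
        ‖ta (m + 1)‖ * φ ^ 2 + ‖tb (m + 1)‖ * φ + ‖tc (m + 1)‖)) * d ^ (m + 1) := by
        gcongr
        refine (norm_sub_le _ _).trans ?_
        gcongr
        refine norm_add₃_le.trans ?_
        rw [norm_mul (tb (m + 1))]
        gcongr
        refine (norm_add_le _ _).trans ?_
        rw [norm_mul, norm_pow]
        gcongr
    _ = ‖td m‖ * d ^ (m + 1) + ‖∑ k ∈ Finset.Ico 1 (m + 1), u k * tf (m + 1 - k)‖ * d ^ (m + 1) +
        (‖ta (m + 1)‖ * d ^ (m + 1)) * φ ^ 2 + (‖tb (m + 1)‖ * d ^ (m + 1)) * φ +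
        ‖tc (m + 1)‖ * d ^ (m + 1) := by ring
    _ ≤ E * (K ^ (m + 1) * (m + 1).factorial) +
        (α * L + ε * L + ε * φ + ε * φ + ε) * L * (K ^ (m + 1) * (m + 1).factorial) +
        (ε * (K ^ (m + 1) * (m + 1).factorial)) * φ ^ 2 +
        (ε * (K ^ (m + 1) * (m + 1).factorial)) * φ + ε * (K ^ (m + 1) * (m + 1).factorial) := by
        gcongr
    _ = _ := by ring

/-- Nagumo's estimate: the derivative of a function growing like `d ^ (-m)` in the distance `d` to
the boundary grows like `(m + 1) d ^ (-m - 1)`. -/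
theorem norm_deriv_mul_pow_le {g : ℂ → ℂ} {U : Set ℂ} {m : ℕ} {C : ℝ}
    (hg : DifferentiableOn ℂ g U)
    (hC : ∀ x d, 0 < d → d ≤ 1 → Metric.ball x d ⊆ U → ‖g x‖ * d ^ m ≤ C) {x : ℂ} {d : ℝ}
    (hd : 0 < d) (hd1 : d ≤ 1) (hx : Metric.ball x d ⊆ U) :
    ‖deriv g x‖ * d ^ (m + 1) ≤ 4 * (m + 1) * C := by
  have hC0 : 0 ≤ C := le_trans (by positivity) (hC x d hd hd1 hx)
  obtain ⟨q, hq⟩ : ∃ q : ℝ, q = 1 - 1 / (2 * (m + 1)) := ⟨_, rfl⟩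
  have hm : (0 : ℝ) < m + 1 := by positivity
  have hr1 : 1 / (2 * ((m : ℝ) + 1)) ≤ 1 / 2 := by
    rw [div_le_div_iff₀ (by positivity) (by norm_num)]; linarith [m.cast_nonneg (α := ℝ)]
  have hr0 : 0 < 1 / (2 * ((m : ℝ) + 1)) := by positivity
  have hq0 : 0 < q := by rw [hq]; linarith
  have hq1 : q ≤ 1 := by rw [hq]; linarith
  -- Bernoulli's inequality
  have hqm : 1 / 2 ≤ q ^ m := by
    have := one_add_mul_le_pow (a := -(1 / (2 * ((m : ℝ) + 1)))) (by linarith) m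
    rw [← sub_eq_add_neg, ← hq] at this
    refine le_trans ?_ this
    have : (m : ℝ) * (1 / (2 * ((m : ℝ) + 1))) ≤ 1 / 2 := by
      rw [mul_one_div, div_le_div_iff₀ (by positivity) (by norm_num)]; linarith
    linarith
  -- Cauchy's estimate on a ball of radius `d / (2 (m + 1))`, where the distance is at least `d q`
  have hρ : 0 < d * (1 / (2 * ((m : ℝ) + 1))) := by positivity
  have h1 := norm_deriv_le_of_ball (f := g) (z := x) (ρ := d * (1 / (2 * ((m : ℝ) + 1))))
    (C := C / (d * q) ^ m) hρ
    (hg.mono ((Metric.ball_subset_ball (by nlinarith)).trans hx)) (fun w hw => by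
      rw [le_div_iff₀ (by positivity)]
      refine hC w (d * q) (by positivity) (by nlinarith) (Subset.trans ?_ hx)
      intro y hy
      have := dist_triangle y w x
      have h2 := Metric.mem_ball.1 hw
      have h3 := Metric.mem_ball.1 hy
      refine Metric.mem_ball.2 ?_
      rw [hq] at h3
      nlinarith)
  have h2 : C / (d * q) ^ m ≤ 2 * C / d ^ m := by
    rw [mul_pow, div_le_div_iff₀ (by positivity) (by positivity)]
    have : 0 ≤ C * d ^ m := by positivity
    nlinarith
  calc ‖deriv g x‖ * d ^ (m + 1)
      ≤ (2 * C / d ^ m) / (d * (1 / (2 * ((m : ℝ) + 1)))) * d ^ (m + 1) := by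
        gcongr
        exact h1.trans (by gcongr)
    _ = 4 * (m + 1) * C := by field_simp; ring

/-- A bounded exact solution that stays near the leading term, together with the formal solution:
both are locally of Gevrey type, with the same constants. The set `J` of parameters contains `0`,
and `tf 0` is the formal solution. The constant `L` is fixed first, so small that the quadratic
interaction of the terms is dominated by the linear part, and then `K` is taken large. -/
theorem exists_gevrey_bound {U J : Set ℂ} (hU : IsOpen U) (hJ : (0 : ℂ) ∈ J)
    {ta tb tc tf : ℂ → ℕ → ℂ → ℂ} {ahat bhat chat fhat : ℕ → ℂ → ℂ}
    (ha : ∀ h ∈ J, ∀ x ∈ U, RemSeq h (fun m => ta h m x) (seriesAt ahat x))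
    (hb : ∀ h ∈ J, ∀ x ∈ U, RemSeq h (fun m => tb h m x) (seriesAt bhat x))
    (hc : ∀ h ∈ J, ∀ x ∈ U, RemSeq h (fun m => tc h m x) (seriesAt chat x))
    (hf : ∀ h ∈ J, ∀ x ∈ U, RemSeq h (fun m => tf h m x) (seriesAt fhat x))
    (hfd : ∀ h ∈ J, ∀ m, DifferentiableOn ℂ (tf h m) U)
    (hformal : IsFormalSolution ahat bhat chat U fhat)
    (hexact : ∀ h ∈ J, ∀ x ∈ U, h * deriv (tf h 0) x =
      ta h 0 x * tf h 0 x ^ 2 + tb h 0 x * tf h 0 x + tc h 0 x)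
    {α M φ μ : ℝ} (hM : 0 < M) (hμ0 : 0 < μ)
    (hta : ∀ h ∈ J, ∀ x ∈ U, ∀ m, ‖ta h m x‖ ≤ α * (M ^ m * m.factorial))
    (htb : ∀ h ∈ J, ∀ x ∈ U, ∀ m, ‖tb h m x‖ ≤ α * (M ^ m * m.factorial))
    (htc : ∀ h ∈ J, ∀ x ∈ U, ∀ m, ‖tc h m x‖ ≤ α * (M ^ m * m.factorial))
    (hφ : ∀ h ∈ J, ∀ x ∈ U, ‖tf h 0 x‖ ≤ φ)
    (hμ : ∀ h ∈ J, ∀ x ∈ U, μ ≤ ‖ahat 0 x * (fhat 0 x + tf h 0 x) + bhat 0 x‖) :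
    ∃ L > 0, ∃ K > 0, ∀ m, ∀ h ∈ J, ∀ x d, 0 < d → d ≤ 1 → Metric.ball x d ⊆ U →
      ‖tf h m x‖ * d ^ m ≤ L * (K ^ m * m.factorial) := by
  rcases U.eq_empty_or_nonempty with hUe | ⟨x₀, hx₀⟩
  · refine ⟨1, one_pos, 1, one_pos, fun m h _ x d hd _ hx => ?_⟩
    exact absurd (hx (Metric.mem_ball_self hd)) (by simp [hUe])
  have hα : 0 ≤ α := by simpa using (norm_nonneg _).trans (hta 0 hJ x₀ hx₀ 0)
  have hφ0 : 0 ≤ φ := (norm_nonneg _).trans (hφ 0 hJ x₀ hx₀)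
  obtain ⟨L, hL⟩ : ∃ L, L = μ / (2 * (α + 1)) := ⟨_, rfl⟩
  have hL0 : 0 < L := by rw [hL]; positivity
  have hαL : α * L ≤ μ / 2 := by
    rw [hL, mul_div_assoc', div_le_div_iff₀ (by positivity) (by norm_num)]
    nlinarith
  obtain ⟨B, hB⟩ : ∃ B, B = 4 * (L + φ) + (α * M * L + α * M * φ + α * M * φ + α * M) * L +
    α * M * (φ ^ 2 + φ + 1) := ⟨_, rfl⟩
  have hB0 : 0 ≤ B := by rw [hB]; positivity
  obtain ⟨K, hK⟩ : ∃ K, K = M + B / (μ / 2 * L) := ⟨_, rfl⟩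
  have hMK : M ≤ K := by
    have : 0 ≤ B / (μ / 2 * L) := by positivity
    linarith
  have hK0 : 0 < K := hM.trans_le hMK
  have hBK : B / K ≤ μ / 2 * L := by
    rw [div_le_iff₀ hK0, hK, mul_add, mul_div_cancel₀ _ (by positivity)]
    have : 0 ≤ μ / 2 * L * M := by positivity
    linarith
  have hcoef : ∀ {u : ℂ} {k : ℕ} {d : ℝ}, 1 ≤ k → 0 ≤ d → d ≤ 1 →
      ‖u‖ ≤ α * (M ^ k * k.factorial) → ‖u‖ * d ^ k ≤ α * (M / K) * (K ^ k * k.factorial) := by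
    intro u k d hk hd0 hd1 hu
    have h1 : M ^ k ≤ M / K * K ^ k := by
      obtain ⟨j, rfl⟩ : ∃ j, k = j + 1 := ⟨k - 1, by omega⟩
      rw [pow_succ' K, ← mul_assoc, div_mul_cancel₀ _ hK0.ne', pow_succ']
      gcongr
    calc ‖u‖ * d ^ k ≤ α * (M ^ k * k.factorial) * 1 :=
          mul_le_mul hu (pow_le_one₀ hd0 hd1) (by positivity) (by positivity)
      _ ≤ α * (M / K * K ^ k * k.factorial) * 1 := by gcongr
      _ = _ := by ring
  have h0seq : ∀ {t : ℂ → ℕ → ℂ → ℂ} {that : ℕ → ℂ → ℂ},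
      (∀ h ∈ J, ∀ x ∈ U, RemSeq h (fun m => t h m x) (seriesAt that x)) →
      ∀ x ∈ U, ∀ m, PowerSeries.coeff m (seriesAt that x) = t 0 m x := by
    intro t that ht x hx m
    have := ht 0 hJ x hx m
    simpa using this.symm
  have main : ∀ m, 1 ≤ m → ∀ h ∈ J, ∀ x d, 0 < d → d ≤ 1 → Metric.ball x d ⊆ U →
      ‖tf h m x‖ * d ^ m ≤ L * (K ^ m * m.factorial) := by
    intro m
    induction m using Nat.strong_induction_on with
    | _ m ih =>
      intro hm h hh x d hd hd1 hxd
      obtain ⟨m, rfl⟩ : ∃ n, m = n + 1 := ⟨m - 1, by omega⟩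
      have hx : x ∈ U := hxd (Metric.mem_ball_self hd)
      have hderiv : RemSeq h (fun m => deriv (tf h m) x)
          (seriesAt (fun k => deriv (fhat k)) x) := by
        intro m
        rw [coeff_seriesAt]
        have e : tf h m =ᶠ[𝓝 x] fun y => fhat m y + h * tf h (m + 1) y := by
          filter_upwards [hU.mem_nhds hx] with y hy
          have := hf h hh y hy m
          rwa [coeff_seriesAt] at this
        change deriv (tf h m) x = deriv (fhat m) x + h * deriv (tf h (m + 1)) x
        rw [e.deriv_eq]
        have d1 := (hformal.1 m).differentiableAt (hU.mem_nhds hx)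
        have d2 := (hfd h hh (m + 1)).differentiableAt (hU.mem_nhds hx)
        rw [deriv_fun_add d1 (d2.const_mul _), deriv_const_mul _ d2]
      have htd : ‖deriv (tf h m) x‖ * d ^ (m + 1) ≤
          4 * (L + φ) / K * (K ^ (m + 1) * (m + 1).factorial) := by
        have h1 := norm_deriv_mul_pow_le (m := m) (C := (L + φ) * (K ^ m * m.factorial))
          (hfd h hh m) (fun y e he he1 hye => by
            rcases Nat.eq_zero_or_pos m with rfl | hm
            · have := hφ h hh y (hye (Metric.mem_ball_self he))
              simp only [pow_zero, mul_one, Nat.factorial_zero, Nat.cast_one]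
              linarith
            · refine (ih m (by omega) hm h hh y e he he1 hye).trans ?_
              gcongr
              linarith) hd hd1 hxd
        refine h1.trans_eq ?_
        rw [Nat.factorial_succ, pow_succ]
        push_cast
        field_simp
      have step := RemSeq.riccati_bound (ha h hh x hx) (hb h hh x hx) (hc h hh x hx) (hf h hh x hx)
        hderiv (hformal.2 x hx) (hexact h hh x hx) m (μ := μ) (α := α) (ε := α * (M / K)) (φ := φ)
        (L := L) (K := K) (d := d) (by positivity) hL0.le hK0.le hd.le
        (by simpa only [coeff_seriesAt] using hμ h hh x hx)
        (by rw [h0seq ha x hx]; simpa using hta 0 hJ x hx 0)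
        (fun k hk => by rw [h0seq ha x hx]; exact hcoef hk hd.le hd1 (hta 0 hJ x hx k))
        (fun k hk => by rw [h0seq hb x hx]; exact hcoef hk hd.le hd1 (htb 0 hJ x hx k))
        (hcoef (by omega) hd.le hd1 (hta h hh x hx _))
        (hcoef (by omega) hd.le hd1 (htb h hh x hx _))
        (hcoef (by omega) hd.le hd1 (htc h hh x hx _))
        (by rw [h0seq hf x hx]; exact hφ 0 hJ x hx) (hφ h hh x hx)
        (fun k hk1 hk2 => by rw [h0seq hf x hx]; exact ih k hk2 hk1 0 hJ x d hd hd1 hxd)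
        (fun k hk1 hk2 => ih k hk2 hk1 h hh x d hd hd1 hxd) htd
      have hG : 0 < K ^ (m + 1) * ((m + 1).factorial : ℝ) := by positivity
      have hconst : 4 * (L + φ) / K + (α * L + α * (M / K) * L + α * (M / K) * φ +
          α * (M / K) * φ + α * (M / K)) * L + α * (M / K) * (φ ^ 2 + φ + 1) ≤ μ * L := by
        have : 4 * (L + φ) / K + (α * L + α * (M / K) * L + α * (M / K) * φ +
          α * (M / K) * φ + α * (M / K)) * L + α * (M / K) * (φ ^ 2 + φ + 1) =
            α * L * L + B / K := by rw [hB]; field_simp; ring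
        rw [this]
        nlinarith
      have := step.trans (mul_le_mul_of_nonneg_right hconst hG.le)
      rw [mul_assoc] at this
      exact le_of_mul_le_mul_left this hμ0
  refine ⟨L + φ, by positivity, K, hK0, fun m h hh x d hd hd1 hxd => ?_⟩
  rcases Nat.eq_zero_or_pos m with rfl | hm
  · have := hφ h hh x (hxd (Metric.mem_ball_self hd))
    simp only [pow_zero, mul_one, Nat.factorial_zero, Nat.cast_one]
    linarith
  · refine (main m hm h hh x d hd hd1 hxd).trans ?_
    gcongr
    linarith

/-- The remainder of order `m` divided by `h ^ m`, completed by the coefficient at `h = 0`. -/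
noncomputable def scaledRem (f : ℂ → ℂ → ℂ) (fhat : ℕ → ℂ → ℂ) (h : ℂ) (m : ℕ) (x : ℂ) : ℂ :=
  open Classical in if h = 0 then fhat m x else remainder f fhat m x h / h ^ m

theorem scaledRem_zero (f : ℂ → ℂ → ℂ) (fhat : ℕ → ℂ → ℂ) (m : ℕ) (x : ℂ) :
    scaledRem f fhat 0 m x = fhat m x := if_pos rfl

theorem scaledRem_of_ne {f : ℂ → ℂ → ℂ} {fhat : ℕ → ℂ → ℂ} {h : ℂ} (hh : h ≠ 0) (m : ℕ) (x : ℂ) :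
    scaledRem f fhat h m x = remainder f fhat m x h / h ^ m := if_neg hh

theorem scaledRem_order_zero {f : ℂ → ℂ → ℂ} {fhat : ℕ → ℂ → ℂ} {h : ℂ} (hh : h ≠ 0) (x : ℂ) :
    scaledRem f fhat h 0 x = f x h := by
  simp [scaledRem_of_ne hh, remainder]

theorem remSeq_scaledRem (f : ℂ → ℂ → ℂ) (fhat : ℕ → ℂ → ℂ) (h x : ℂ) :
    RemSeq h (fun m => scaledRem f fhat h m x) (seriesAt fhat x) := by
  intro m
  rw [coeff_seriesAt]
  by_cases hh : h = 0
  · simp only [hh, scaledRem_zero, zero_mul, add_zero]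
  · simp only [scaledRem_of_ne hh, remainder, Finset.sum_range_succ]
    field_simp
    ring

theorem differentiableOn_scaledRem {f : ℂ → ℂ → ℂ} {fhat : ℕ → ℂ → ℂ} {h : ℂ} {U : Set ℂ}
    (hf : h ≠ 0 → DifferentiableOn ℂ (fun x => f x h) U)
    (hfhat : ∀ k, DifferentiableOn ℂ (fhat k) U) (m : ℕ) :
    DifferentiableOn ℂ (scaledRem f fhat h m) U := by
  by_cases hh : h = 0
  · subst hh
    exact (hfhat m).congr fun x _ => scaledRem_zero f fhat m x
  · refine DifferentiableOn.congr ?_ fun x _ => scaledRem_of_ne hh m x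
    exact ((hf hh).sub (DifferentiableOn.fun_sum fun k _ => (hfhat k).mul_const _)).div_const _

/-- Gevrey bounds on `S` extend to the value `0` of the parameter, where they bound the coefficients
of the expansion, as soon as `0` is a limit point of `S`. -/
theorem HasGevreyBounds.scaledRem_le {S U : Set ℂ} {w : ℂ → ℝ} {f : ℂ → ℂ → ℂ}
    {fhat : ℕ → ℂ → ℂ} (hf : HasGevreyBounds S U w f fhat)
    (hS : ∀ ε > 0, ∃ h ∈ S, h ≠ 0 ∧ ‖h‖ < ε) :
    ∃ C > 0, ∃ M > 0, ∀ x ∈ U, ∀ h ∈ insert 0 S, ∀ m,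
      ‖scaledRem f fhat h m x‖ ≤ w x * (C * (M ^ m * m.factorial)) := by
  obtain ⟨C, hC, M, hM, hb⟩ := hf
  have hw : ∀ x ∈ U, 0 ≤ w x := fun x hx => by
    obtain ⟨h, hh, -, -⟩ := hS 1 one_pos
    have := (norm_nonneg _).trans (hb 0 x hx h hh)
    simp only [pow_zero, Nat.factorial_zero, Nat.cast_one, mul_one] at this
    exact nonneg_of_mul_nonneg_left this hC
  have key : ∀ x ∈ U, ∀ h ∈ S, h ≠ 0 → ∀ m,
      ‖scaledRem f fhat h m x‖ ≤ w x * (C * (M ^ m * m.factorial)) := by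
    intro x hx h hh h0 m
    rw [scaledRem_of_ne h0, norm_div, norm_pow, div_le_iff₀ (by positivity)]
    refine (hb m x hx h hh).trans_eq (by ring)
  have key0 : ∀ x ∈ U, ∀ m, ‖fhat m x‖ ≤ w x * (2 * C * (M ^ m * m.factorial)) := by
    intro x hx m
    obtain ⟨h, hh, h0, hlt⟩ := hS (1 / (M * (m + 1))) (by positivity)
    have e := remSeq_scaledRem f fhat h x m
    rw [coeff_seriesAt] at e
    have e' : fhat m x = scaledRem f fhat h m x - h * scaledRem f fhat h (m + 1) x := by
      linear_combination -e
    have h1 : ‖h‖ * (M * (m + 1)) ≤ 1 := ((lt_div_iff₀ (by positivity)).1 hlt).le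
    have hwx := hw x hx
    rw [e']
    refine (norm_sub_le _ _).trans ?_
    rw [norm_mul]
    calc _ ≤ w x * (C * (M ^ m * m.factorial)) +
          ‖h‖ * (w x * (C * (M ^ (m + 1) * (m + 1).factorial))) := by
          gcongr
          exacts [key x hx h hh h0 m, key x hx h hh h0 (m + 1)]
      _ = w x * (C * (M ^ m * m.factorial)) * (1 + ‖h‖ * (M * (m + 1))) := by
          rw [Nat.factorial_succ, pow_succ]; push_cast; ring
      _ ≤ w x * (C * (M ^ m * m.factorial)) * (1 + 1) := by gcongr
      _ = _ := by ring
  refine ⟨2 * C, by positivity, M, hM, fun x hx h hh m => ?_⟩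
  by_cases h0 : h = 0
  · rw [h0, scaledRem_zero]; exact key0 x hx m
  · refine (key x hx h (hh.resolve_left h0) h0 m).trans ?_
    have hwx := hw x hx
    gcongr
    linarith

/-! ### Borel discs -/

theorem exp_mul_I_ne_zero (θ : ℝ) : Complex.exp (θ * Complex.I) ≠ 0 := Complex.exp_ne_zero _

theorem div_mem_borelDisc_iff {θ d : ℝ} {s : ℂ} :
    Complex.exp (θ * Complex.I) / s ∈ borelDisc θ d ↔ 1 / d < s.re := by
  rw [borelDisc, mem_ofPred_eq, div_div_cancel₀ (exp_mul_I_ne_zero θ)]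

theorem zero_notMem_borelDisc {θ d : ℝ} (hd : 0 < d) : (0 : ℂ) ∉ borelDisc θ d := by
  simp only [borelDisc, mem_ofPred_eq, div_zero, Complex.zero_re, not_lt]
  positivity

theorem ne_zero_of_mem_borelDisc {θ d : ℝ} (hd : 0 < d) {h : ℂ} (hh : h ∈ borelDisc θ d) :
    h ≠ 0 := fun h0 => zero_notMem_borelDisc hd (h0 ▸ hh)

theorem borelDisc_subset {θ d d' : ℝ} (hd : 0 < d) (hdd : d ≤ d') :
    borelDisc θ d ⊆ borelDisc θ d' := fun h hh => by
  simp only [borelDisc, mem_ofPred_eq] at hh ⊢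
  exact lt_of_le_of_lt (one_div_le_one_div_of_le hd hdd) hh

theorem borelDisc_eq_ball {θ d : ℝ} (hd : 0 < d) :
    borelDisc θ d = Metric.ball ((d / 2 : ℝ) * Complex.exp (θ * Complex.I)) (d / 2) := by
  ext h
  have he : Complex.normSq (Complex.exp (θ * Complex.I)) = 1 := by
    rw [Complex.normSq_eq_norm_sq, Complex.norm_exp_ofReal_mul_I, one_pow]
  by_cases h0 : h = 0
  · subst h0
    simp only [zero_notMem_borelDisc hd, false_iff, Metric.mem_ball, dist_zero_left, norm_mul,
      Complex.norm_exp_ofReal_mul_I, Complex.norm_real, Real.norm_eq_abs, mul_one]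
    rw [abs_of_pos (by positivity)]
    exact lt_irrefl _
  obtain ⟨e, he'⟩ : ∃ e, e = Complex.exp (θ * Complex.I) := ⟨_, rfl⟩
  rw [← he'] at he ⊢
  have hn : 0 < Complex.normSq h := Complex.normSq_pos.2 h0
  have h1 : (e / h).re = (e.re * h.re + e.im * h.im) / Complex.normSq h := by
    rw [Complex.div_re]; ring
  rw [borelDisc, mem_ofPred_eq, ← he', h1, div_lt_div_iff₀ hd hn, Metric.mem_ball, dist_eq_norm,
    ← sq_lt_sq₀ (norm_nonneg _) (by positivity), ← Complex.normSq_eq_norm_sq]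
  simp only [Complex.normSq_apply, Complex.sub_re, Complex.sub_im, Complex.mul_re, Complex.mul_im,
    Complex.ofReal_re, Complex.ofReal_im, zero_mul, sub_zero, add_zero] at he ⊢
  have e1 : (h.re - d / 2 * e.re) * (h.re - d / 2 * e.re) +
      (h.im - d / 2 * e.im) * (h.im - d / 2 * e.im) = h.re * h.re + h.im * h.im -
      (e.re * h.re + e.im * h.im) * d + (d / 2) ^ 2 := by
    linear_combination (d / 2) ^ 2 * he
  rw [e1]
  constructor <;> intro hh <;> linarith

theorem isOpen_borelDisc {θ d : ℝ} (hd : 0 < d) : IsOpen (borelDisc θ d) := by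
  rw [borelDisc_eq_ball hd]; exact Metric.isOpen_ball

theorem convex_borelDisc {θ d : ℝ} (hd : 0 < d) : Convex ℝ (borelDisc θ d) := by
  rw [borelDisc_eq_ball hd]; exact convex_ball _ _

theorem borelDisc_nonempty {θ d : ℝ} (hd : 0 < d) : (borelDisc θ d).Nonempty := by
  rw [borelDisc_eq_ball hd]; exact Metric.nonempty_ball.2 (by positivity)

theorem exists_mem_borelDisc_norm_lt {θ d : ℝ} {ε : ℝ} (hε : 0 < ε) :
    ∃ h ∈ borelDisc θ d, h ≠ 0 ∧ ‖h‖ < ε := by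
  have h1 : 0 < max (1 / d + 1) (1 / ε + 1) := lt_max_of_lt_right (by positivity)
  refine ⟨Complex.exp (θ * Complex.I) / ((max (1 / d + 1) (1 / ε + 1) : ℝ) : ℂ),
    div_mem_borelDisc_iff.2 ?_, ?_, ?_⟩
  · rw [Complex.ofReal_re]; exact (lt_add_one _).trans_le (le_max_left _ _)
  · exact div_ne_zero (exp_mul_I_ne_zero θ) (by exact_mod_cast h1.ne')
  · rw [norm_div, Complex.norm_exp_ofReal_mul_I, Complex.norm_real, Real.norm_eq_abs,
      abs_of_pos h1, div_lt_comm₀ h1 hε]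
    exact (lt_add_one _).trans_le (le_max_right _ _)

theorem isSectorialDomain_borelDisc {θ d : ℝ} (hd : 0 < d) :
    IsSectorialDomain θ (borelDisc θ d) where
  isOpen := isOpen_borelDisc hd
  simplyConnected := by
    have := (convex_borelDisc (θ := θ) hd).contractibleSpace (borelDisc_nonempty hd)
    exact SimplyConnectedSpace.ofContractible _
  zero_notMem := zero_notMem_borelDisc hd
  exists_borelDisc := ⟨d, hd, Subset.rfl⟩
  opening := by
    ext u
    constructor
    · rintro ⟨hu, hlim⟩
      -- the closed half plane `0 ≤ Re (e^{iθ} / u)` contains all limit directions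
      obtain ⟨v, hv⟩ : ∃ v, v = u * Complex.exp (-(θ * Complex.I)) := ⟨_, rfl⟩
      have hvn : ‖v‖ = 1 := by
        rw [hv, norm_mul, hu, one_mul, ← neg_mul, ← Complex.ofReal_neg,
          Complex.norm_exp_ofReal_mul_I]
      have hvre : 0 ≤ v.re := by
        refine le_of_forall_pos_le_add fun ε hε => ?_
        obtain ⟨h, hh, h0, -, hdir⟩ := hlim ε hε
        have h1 : 0 < (Complex.exp (θ * Complex.I) / h).re := lt_trans (by positivity) hh
        have h2 : 0 < (h / (‖h‖ : ℂ) * Complex.exp (-(θ * Complex.I))).re := by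
          have e : h / (‖h‖ : ℂ) * Complex.exp (-(θ * Complex.I)) =
              (‖h‖⁻¹ : ℝ) * (Complex.exp (θ * Complex.I) / h)⁻¹ := by
            rw [Complex.exp_neg, inv_div]
            push_cast
            ring
          have hq : Complex.exp (θ * Complex.I) / h ≠ 0 := div_ne_zero (Complex.exp_ne_zero _) h0
          rw [e, Complex.re_ofReal_mul, Complex.inv_re]
          have := norm_pos_iff.2 h0
          have := Complex.normSq_pos.2 hq
          positivity
        have h3 : |(h / (‖h‖ : ℂ) * Complex.exp (-(θ * Complex.I))).re - v.re| < ε := by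
          rw [← Complex.sub_re, hv, ← sub_mul]
          refine (Complex.abs_re_le_norm _).trans_lt ?_
          rwa [norm_mul, ← neg_mul, ← Complex.ofReal_neg, Complex.norm_exp_ofReal_mul_I, mul_one]
        have := (abs_lt.1 h3).2
        linarith
      refine ⟨θ + Complex.arg v, ?_, ?_⟩
      · have := abs_le.1 (Complex.abs_arg_le_pi_div_two_iff.2 hvre)
        exact ⟨by linarith, by linarith⟩
      · have h1 := Complex.norm_mul_exp_arg_mul_I v
        rw [hvn, Complex.ofReal_one, one_mul] at h1
        simp only [Complex.ofReal_add, add_mul, Complex.exp_add]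
        rw [h1, hv, mul_comm u, ← mul_assoc, ← Complex.exp_add, add_neg_cancel, Complex.exp_zero,
          one_mul]
    · rintro ⟨t, ⟨ht1, ht2⟩, rfl⟩
      refine ⟨Complex.norm_exp_ofReal_mul_I t, fun ε hε => ?_⟩
      -- move the direction slightly towards `θ`, into the open arc
      have hcont : ContinuousAt (fun q : ℝ => Complex.exp ((θ + q * (t - θ) : ℝ) * Complex.I))
          1 := by
        fun_prop
      obtain ⟨δ, hδ, hδ'⟩ := Metric.continuousAt_iff.1 hcont ε hε
      obtain ⟨q, hq⟩ : ∃ q : ℝ, q = 1 - min (δ / 2) (1 / 2) := ⟨_, rfl⟩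
      have hm0 : 0 < min (δ / 2) (1 / 2) := lt_min (by positivity) (by norm_num)
      have hm1 : min (δ / 2) (1 / 2) ≤ 1 / 2 := min_le_right _ _
      have hm2 : min (δ / 2) (1 / 2) ≤ δ / 2 := min_le_left _ _
      have hqd : dist q 1 < δ := by
        rw [Real.dist_eq, hq, sub_sub_cancel_left, abs_neg, abs_of_pos hm0]; linarith
      have hdir := hδ' hqd
      obtain ⟨t', ht'⟩ : ∃ t', t' = θ + q * (t - θ) := ⟨_, rfl⟩
      rw [← ht', dist_eq_norm, show θ + 1 * (t - θ) = t by ring] at hdir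
      have hcos : 0 < Real.cos (θ - t') := by
        refine Real.cos_pos_of_mem_Ioo ⟨?_, ?_⟩ <;>
          · rw [ht']
            nlinarith [Real.pi_pos]
      obtain ⟨ρ, hρ⟩ : ∃ ρ, ρ = min (ε / 2) (d * Real.cos (θ - t') / 2) := ⟨_, rfl⟩
      have hρ0 : 0 < ρ := by rw [hρ]; exact lt_min (by positivity) (by positivity)
      have hρ1 : ρ ≤ ε / 2 := hρ ▸ min_le_left _ _
      have hρ2 : ρ ≤ d * Real.cos (θ - t') / 2 := hρ ▸ min_le_right _ _
      have hρn : ‖(ρ : ℂ) * Complex.exp (t' * Complex.I)‖ = ρ := by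
        rw [norm_mul, Complex.norm_exp_ofReal_mul_I, mul_one, Complex.norm_real, Real.norm_eq_abs,
          abs_of_pos hρ0]
      have hρC : (ρ : ℂ) ≠ 0 := by exact_mod_cast hρ0.ne'
      refine ⟨ρ * Complex.exp (t' * Complex.I), ?_, mul_ne_zero hρC (Complex.exp_ne_zero _), ?_, ?_⟩
      · have e : Complex.exp (θ * Complex.I) / (ρ * Complex.exp (t' * Complex.I)) =
            (ρ⁻¹ : ℝ) * Complex.exp ((θ - t' : ℝ) * Complex.I) := by
          rw [Complex.ofReal_sub, sub_mul, Complex.exp_sub]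
          push_cast
          field_simp
        rw [borelDisc, mem_ofPred_eq, e, Complex.re_ofReal_mul, Complex.exp_ofReal_mul_I_re,
          inv_mul_eq_div, div_lt_div_iff₀ hd hρ0]
        nlinarith
      · rw [hρn]; linarith
      · rw [hρn, mul_div_cancel_left₀ _ hρC]; exact hdir

/-! ### Uniqueness of functions with a given Gevrey expansion -/

/-- A function on a half plane that decays exponentially in all directions vanishes. The factor
`exp (-(2c/π) (s + 1) log (s + 1))` grows like `exp (c |Im s|)` on the imaginary axis, where it is
compensated by the decay, and makes the product decay superexponentially on the real axis. -/
theorem eq_zero_of_exp_decay {F : ℂ → ℂ} {σ C c : ℝ} (hc : 0 < c)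
    (hF : DifferentiableOn ℂ F {s | σ < s.re})
    (hb : ∀ s : ℂ, σ < s.re → ‖F s‖ ≤ C * Real.exp (-c * ‖s‖)) {s : ℂ} (hs : σ < s.re) :
    F s = 0 := by
  obtain ⟨σ₁, hσ1, hσ2⟩ : ∃ σ₁, σ < σ₁ ∧ σ₁ < s.re := exists_between hs
  obtain ⟨k, hk⟩ : ∃ k, k = 2 * c / Real.pi := ⟨_, rfl⟩
  have hpi := Real.pi_pos
  have hk0 : 0 < k := by rw [hk]; positivity
  obtain ⟨E, hE⟩ : ∃ E : ℂ → ℂ, E = fun z => -(k : ℂ) * ((z + 1) * Complex.log (z + 1)) := ⟨_, rfl⟩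
  obtain ⟨G, hG⟩ : ∃ G : ℂ → ℂ, G = fun z => F (σ₁ + z) * Complex.exp (E z) := ⟨_, rfl⟩
  obtain ⟨C', hC'⟩ : ∃ C', C' = |C| * Real.exp (c * |σ₁|) := ⟨_, rfl⟩
  have hC'0 : 0 ≤ C' := by rw [hC']; positivity
  have hre : ∀ z : ℂ, ((σ₁ : ℂ) + z).re = σ₁ + z.re := fun z => by simp
  have hFb : ∀ z : ℂ, 0 ≤ z.re → ‖F (σ₁ + z)‖ ≤ C' * Real.exp (-c * ‖z‖) := by
    intro z hz
    refine (hb _ (by rw [hre]; linarith)).trans ?_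
    rw [hC', mul_assoc, ← Real.exp_add]
    have h1 : ‖z‖ ≤ ‖(σ₁ : ℂ) + z‖ + |σ₁| := by
      have := norm_sub_le ((σ₁ : ℂ) + z) σ₁
      rwa [add_sub_cancel_left, Complex.norm_real] at this
    have h2 : -c * ‖(σ₁ : ℂ) + z‖ ≤ c * |σ₁| + -c * ‖z‖ := by nlinarith
    gcongr
    exact le_abs_self C
  have hFb' : ∀ z : ℂ, 0 ≤ z.re → ‖F (σ₁ + z)‖ ≤ C' := fun z hz =>
    (hFb z hz).trans (mul_le_of_le_one_right hC'0 (Real.exp_le_one_iff.2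
      (by have := norm_nonneg z; nlinarith)))
  have hEre : ∀ z : ℂ, 0 ≤ z.re → (E z).re =
      -k * ((z.re + 1) * Real.log ‖z + 1‖ - z.im * (z + 1).arg) := by
    intro z hz
    rw [hE]
    change (-(k : ℂ) * ((z + 1) * Complex.log (z + 1))).re = _
    rw [← Complex.ofReal_neg, Complex.re_ofReal_mul]
    simp only [Complex.mul_re, Complex.log_re,
      Complex.log_im, Complex.add_re, Complex.add_im, Complex.one_re, Complex.one_im, add_zero]
  have hn1 : ∀ z : ℂ, 0 ≤ z.re → 1 ≤ ‖z + 1‖ := fun z hz => by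
    refine le_trans ?_ (Complex.re_le_norm _)
    simp [hz]
  have hGn : ∀ z, ‖G z‖ = ‖F (σ₁ + z)‖ * Real.exp (E z).re := fun z => by
    rw [hG]; simp only [norm_mul, Complex.norm_exp]
  have hres : EqOn G 0 {z : ℂ | 0 ≤ z.re} := by
    refine PhragmenLindelof.eq_zero_on_right_half_plane_of_superexponential_decay ?_ ?_ ?_ ?_
    · refine DifferentiableOn.diffContOnCl fun z hz => ?_
      rw [Complex.closure_setOfPred_lt_re] at hz
      have hz : 0 ≤ z.re := hz
      refine DifferentiableAt.differentiableWithinAt ?_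
      have h1 : DifferentiableAt ℂ F (σ₁ + z) := hF.differentiableAt
        ((isOpen_lt continuous_const Complex.continuous_re).mem_nhds (by
          change σ < ((σ₁ : ℂ) + z).re; rw [hre]; linarith))
      have h2 : z + 1 ∈ Complex.slitPlane := Or.inl (by simp; linarith)
      rw [hG, hE]
      have h3 : DifferentiableAt ℂ (fun z => F (σ₁ + z)) z :=
        DifferentiableAt.comp z h1 (by fun_prop)
      refine h3.mul (DifferentiableAt.cexp ?_)
      refine DifferentiableAt.const_mul (DifferentiableAt.mul (by fun_prop) ?_) _
      exact DifferentiableAt.clog (by fun_prop) h2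
    · refine ⟨3 / 2, by norm_num, k * (4 * (2 + Real.pi)), ?_⟩
      refine Asymptotics.IsBigO.of_bound C' ?_
      have : ∀ᶠ z : ℂ in Bornology.cobounded ℂ ⊓ 𝓟 {z : ℂ | 0 < z.re}, 1 ≤ ‖z‖ ∧ 0 < z.re :=
        ((eventually_cobounded_le_norm 1).filter_mono inf_le_left).and
          ((eventually_principal.2 fun z hz => hz).filter_mono inf_le_right)
      filter_upwards [this] with z ⟨hz1, hz⟩
      rw [hGn, Real.norm_eq_abs, Real.abs_exp]
      have hzn := hn1 z hz.le
      have hz2 : ‖z + 1‖ ≤ 2 * ‖z‖ := by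
        refine (norm_add_le _ _).trans ?_
        rw [norm_one]; linarith
      have hlog : Real.log ‖z + 1‖ ≤ 2 * ‖z + 1‖ ^ (1 / 2 : ℝ) := by
        have := Real.log_le_rpow_div (x := ‖z + 1‖) (by positivity) (ε := 1 / 2) (by norm_num)
        linarith
      have hlog0 := Real.log_nonneg hzn
      have hp1 : 1 ≤ ‖z + 1‖ ^ (1 / 2 : ℝ) := Real.one_le_rpow hzn (by norm_num)
      have hEn : (E z).re ≤ k * (4 * (2 + Real.pi)) * ‖z‖ ^ (3 / 2 : ℝ) := by
        calc (E z).re ≤ ‖E z‖ := Complex.re_le_norm _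
          _ = k * (‖z + 1‖ * ‖Complex.log (z + 1)‖) := by
            rw [hE]
            simp only [norm_mul, norm_neg, Complex.norm_real, Real.norm_eq_abs, abs_of_pos hk0]
          _ ≤ k * (‖z + 1‖ * ((2 + Real.pi) * ‖z + 1‖ ^ (1 / 2 : ℝ))) := by
            gcongr
            refine (Complex.norm_le_abs_re_add_abs_im _).trans ?_
            rw [Complex.log_re, Complex.log_im, abs_of_nonneg hlog0]
            have := Complex.abs_arg_le_pi (z + 1)
            nlinarith
          _ = k * (2 + Real.pi) * ‖z + 1‖ ^ (3 / 2 : ℝ) := by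
            rw [show (3 / 2 : ℝ) = 1 + 1 / 2 by norm_num, Real.rpow_add (by positivity),
              Real.rpow_one]
            ring
          _ ≤ k * (2 + Real.pi) * (2 * ‖z‖) ^ (3 / 2 : ℝ) := by gcongr
          _ = k * (2 + Real.pi) * 2 ^ (3 / 2 : ℝ) * ‖z‖ ^ (3 / 2 : ℝ) := by
            rw [Real.mul_rpow (by norm_num) (norm_nonneg _)]; ring
          _ ≤ k * (2 + Real.pi) * 4 * ‖z‖ ^ (3 / 2 : ℝ) := by
            have : (2 : ℝ) ^ (3 / 2 : ℝ) ≤ 2 ^ (2 : ℝ) :=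
              Real.rpow_le_rpow_of_exponent_le (by norm_num) (by norm_num)
            have h4 : (2 : ℝ) ^ (2 : ℝ) = 4 := by norm_num
            rw [h4] at this
            gcongr
          _ = _ := by ring
      exact mul_le_mul (hFb' z hz.le) (Real.exp_le_exp.2 hEn) (Real.exp_pos _).le hC'0
    · intro n
      have hlim : Tendsto (fun x : ℝ => C' * Real.exp (-x)) atTop (𝓝 0) := by
        simpa using (Real.tendsto_exp_neg_atTop_nhds_zero).const_mul C'
      refine squeeze_zero' (Eventually.of_forall fun x => by positivity) ?_ hlim
      filter_upwards [eventually_ge_atTop (0 : ℝ),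
        eventually_ge_atTop (Real.exp ((n + 1) / k))] with x hx0 hx1
      have e1 : (E (x : ℂ)).re = -k * ((x + 1) * Real.log (x + 1)) := by
        rw [hEre _ (by simpa using hx0)]
        have : ‖(x : ℂ) + 1‖ = x + 1 := by
          rw [← Complex.ofReal_one, ← Complex.ofReal_add, Complex.norm_real, Real.norm_eq_abs,
            abs_of_pos (by linarith)]
        rw [this]; simp
      have h2 : (n + 1) / k ≤ Real.log (x + 1) := by
        rw [Real.le_log_iff_exp_le (by linarith)]; linarith
      rw [div_le_iff₀ hk0] at h2
      rw [hGn, e1]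
      calc Real.exp x ^ n * (‖F (σ₁ + x)‖ * Real.exp (-k * ((x + 1) * Real.log (x + 1))))
          ≤ Real.exp x ^ n * (C' * Real.exp (-k * ((x + 1) * Real.log (x + 1)))) := by
            gcongr; exact hFb' _ (by simpa using hx0)
        _ = C' * Real.exp (n * x + -k * ((x + 1) * Real.log (x + 1))) := by
            rw [← Real.exp_nat_mul, Real.exp_add]; ring
        _ ≤ C' * Real.exp (-x) := by
            gcongr
            nlinarith
    · refine ⟨C', fun y => ?_⟩
      have hy : ((y : ℂ) * Complex.I).re = 0 := by simp
      have hy' : ((y : ℂ) * Complex.I).im = y := by simp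
      rw [hGn]
      have h1 := hFb (y * Complex.I) hy.ge
      have hn : ‖(y : ℂ) * Complex.I‖ = |y| := by simp
      rw [hn] at h1
      have harg : |((y : ℂ) * Complex.I + 1).arg| ≤ Real.pi / 2 :=
        Complex.abs_arg_le_pi_div_two_iff.2 (by simp)
      have h2 : (E (y * Complex.I)).re ≤ c * |y| := by
        rw [hEre _ hy.ge, hy, hy']
        have h3 := Real.log_nonneg (hn1 (y * Complex.I) hy.ge)
        have h4 : y * ((y : ℂ) * Complex.I + 1).arg ≤ |y| * (Real.pi / 2) :=
          (le_abs_self _).trans (by rw [abs_mul]; gcongr)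
        calc _ ≤ k * (|y| * (Real.pi / 2)) := by nlinarith
          _ = c * |y| := by rw [hk]; field_simp
      calc _ ≤ C' * Real.exp (-c * |y|) * Real.exp (c * |y|) := by gcongr
        _ = C' := by rw [mul_assoc, ← Real.exp_add]; simp
  have h0 := hres (show 0 ≤ (s - σ₁).re by simp; linarith)
  simp only [hG, Pi.zero_apply, mul_eq_zero, Complex.exp_ne_zero, or_false] at h0
  rwa [add_sub_cancel] at h0

/-- Gevrey bounds of all orders for the zero expansion amount to exponential smallness, through the
truncation at the order `n = ⌊1 / (2 M t)⌋`. -/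
theorem exists_exp_decay_of_gevrey {C M : ℝ} (hC : 0 < C) (hM : 0 < M) {t r : ℝ} (ht : 0 < t)
    (h : ∀ n : ℕ, r ≤ C * M ^ n * n.factorial * t ^ n) :
    r ≤ 2 * C * Real.exp (-(Real.log 2 / (2 * M)) * t⁻¹) := by
  obtain ⟨n, hn⟩ : ∃ n, n = ⌊1 / (2 * (M * t))⌋₊ := ⟨_, rfl⟩
  have hMt : 0 < M * t := by positivity
  have h1 : (n : ℝ) ≤ 1 / (2 * (M * t)) := hn ▸ Nat.floor_le (by positivity)
  have h2 : 1 / (2 * (M * t)) < n + 1 := hn ▸ Nat.lt_floor_add_one _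
  have h3 : (n : ℝ) * (M * t) ≤ 1 / 2 := by
    rw [le_div_iff₀ (by positivity)] at h1
    linarith
  have h4 : (n.factorial : ℝ) ≤ (n : ℝ) ^ n := by exact_mod_cast Nat.factorial_le_pow n
  calc r ≤ C * M ^ n * n.factorial * t ^ n := h n
    _ ≤ C * M ^ n * (n : ℝ) ^ n * t ^ n := by gcongr
    _ = C * ((n : ℝ) * (M * t)) ^ n := by rw [mul_pow, mul_pow]; ring
    _ ≤ C * (1 / 2) ^ n := by gcongr
    _ = 2 * C * Real.exp (-(Real.log 2) * (n + 1)) := by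
        rw [neg_mul, Real.exp_neg, mul_comm (Real.log 2), ← Nat.cast_succ, Real.exp_nat_mul,
          Real.exp_log (by norm_num), pow_succ]
        field_simp
        rw [← mul_pow]
        norm_num
    _ ≤ 2 * C * Real.exp (-(Real.log 2 / (2 * M)) * t⁻¹) := by
        refine mul_le_mul_of_nonneg_left (Real.exp_le_exp.2 ?_) (by positivity)
        have hl := Real.log_pos (x := 2) (by norm_num)
        have : Real.log 2 / (2 * M) * t⁻¹ = Real.log 2 * (1 / (2 * (M * t))) := by field_simp
        rw [neg_mul, neg_mul, this, neg_le_neg_iff]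
        gcongr

/-- Watson's lemma: two functions on a Borel disc with the same uniform Gevrey expansion are equal.
In the variable `s = e^{iθ} / ħ` their difference decays exponentially on a half plane. -/
theorem eq_of_hasGevreyBounds {θ d : ℝ} (hd : 0 < d) {U : Set ℂ} {f g : ℂ → ℂ → ℂ}
    {fhat : ℕ → ℂ → ℂ} {x : ℂ} (hx : x ∈ U)
    (hf : DifferentiableOn ℂ (f x) (borelDisc θ d)) (hg : DifferentiableOn ℂ (g x) (borelDisc θ d))
    (hfG : HasGevreyBounds (borelDisc θ d) U (fun _ => 1) f fhat)
    (hgG : HasGevreyBounds (borelDisc θ d) U (fun _ => 1) g fhat) {h : ℂ}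
    (hh : h ∈ borelDisc θ d) : f x h = g x h := by
  obtain ⟨C, hC, M, hM, hfb⟩ := hfG
  obtain ⟨C', hC', M', hM', hgb⟩ := hgG
  have hne : ∀ s : ℂ, 1 / d < s.re → s ≠ 0 := fun s hs h0 => by
    rw [h0, Complex.zero_re] at hs
    have : 0 < 1 / d := by positivity
    linarith
  have hdiff : DifferentiableOn ℂ (fun s => f x (Complex.exp (θ * Complex.I) / s) -
      g x (Complex.exp (θ * Complex.I) / s)) {s | 1 / d < s.re} := by
    have hm : MapsTo (fun s => Complex.exp (θ * Complex.I) / s) {s : ℂ | 1 / d < s.re}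
        (borelDisc θ d) := fun s hs => div_mem_borelDisc_iff.2 hs
    have hdd : DifferentiableOn ℂ (fun s => Complex.exp (θ * Complex.I) / s)
        {s : ℂ | 1 / d < s.re} := fun s hs =>
      ((differentiableAt_const _).div differentiableAt_id (hne s hs)).differentiableWithinAt
    exact (hf.comp hdd hm).sub (hg.comp hdd hm)
  have hM2 : 0 < max M M' := lt_max_of_lt_left hM
  have hbound : ∀ s : ℂ, 1 / d < s.re → ‖f x (Complex.exp (θ * Complex.I) / s) -
      g x (Complex.exp (θ * Complex.I) / s)‖ ≤
      2 * (C + C') * Real.exp (-(Real.log 2 / (2 * max M M')) * ‖s‖) := by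
    intro s hs
    have hs0 := norm_pos_iff.2 (hne s hs)
    have hmem := div_mem_borelDisc_iff (θ := θ).2 hs
    have hnorm : ‖Complex.exp (θ * Complex.I) / s‖ = ‖s‖⁻¹ := by
      rw [norm_div, Complex.norm_exp_ofReal_mul_I, one_div]
    have := exists_exp_decay_of_gevrey (C := C + C') (M := max M M') (t := ‖s‖⁻¹)
      (r := ‖f x (Complex.exp (θ * Complex.I) / s) - g x (Complex.exp (θ * Complex.I) / s)‖)
      (by positivity) hM2 (by positivity) (fun n => by
        have h1 := hfb n x hx _ hmem
        have h2 := hgb n x hx _ hmem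
        rw [hnorm, one_mul] at h1 h2
        rw [show f x (Complex.exp (θ * Complex.I) / s) - g x (Complex.exp (θ * Complex.I) / s) =
          remainder f fhat n x (Complex.exp (θ * Complex.I) / s) -
          remainder g fhat n x (Complex.exp (θ * Complex.I) / s) by simp only [remainder]; ring]
        calc _ ≤ C * M ^ n * n.factorial * ‖s‖⁻¹ ^ n + C' * M' ^ n * n.factorial * ‖s‖⁻¹ ^ n :=
              (norm_sub_le _ _).trans (add_le_add h1 h2)
          _ ≤ C * max M M' ^ n * n.factorial * ‖s‖⁻¹ ^ n +
              C' * max M M' ^ n * n.factorial * ‖s‖⁻¹ ^ n := by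
              gcongr
              · exact le_max_left _ _
              · exact le_max_right _ _
          _ = _ := by ring)
    rwa [inv_inv] at this
  have hh' : 1 / d < (Complex.exp (θ * Complex.I) / h).re := hh
  have hl : 0 < Real.log 2 := Real.log_pos (by norm_num)
  have := eq_zero_of_exp_decay (by positivity) hdiff hbound hh'
  simp only [div_div_cancel₀ (exp_mul_I_ne_zero θ)] at this
  exact sub_eq_zero.1 this

/-! ### Inverse Laplace transforms of functions of quadratic decay -/

/-- The inverse Laplace transform of `G` at `u`, along the vertical line of abscissa `σ`. -/
noncomputable def invLaplace (σ u : ℝ) (G : ℂ → ℂ) : ℂ :=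
  (2 * Real.pi : ℂ)⁻¹ * ∫ y : ℝ, Complex.exp (u * (σ + y * Complex.I)) * G (σ + y * Complex.I)

/-- Holomorphy and quadratic decay, with constant `C`, on the half plane `σ₀ < Re s`. -/
structure QuadDecay (σ₀ C : ℝ) (G : ℂ → ℂ) : Prop where
  diff : DifferentiableOn ℂ G {s | σ₀ < s.re}
  bound : ∀ s : ℂ, σ₀ < s.re → ‖G s‖ ≤ C * (‖s‖ ^ 2)⁻¹

theorem vertical_re (σ y : ℝ) : ((σ : ℂ) + y * Complex.I).re = σ := by simp

theorem vertical_norm_sq (σ y : ℝ) : ‖(σ : ℂ) + y * Complex.I‖ ^ 2 = σ ^ 2 + y ^ 2 := by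
  rw [← Complex.normSq_eq_norm_sq, Complex.normSq_add_mul_I]

theorem norm_exp_vertical (u σ y : ℝ) :
    ‖Complex.exp (u * (σ + y * Complex.I))‖ = Real.exp (u * σ) := by
  rw [Complex.norm_exp, Complex.re_ofReal_mul, vertical_re]

theorem integrable_inv_sq_add_sq {σ : ℝ} (hσ : 0 < σ) :
    Integrable fun y : ℝ => (σ ^ 2 + y ^ 2)⁻¹ := by
  have h := (integrable_inv_one_add_sq.comp_div hσ.ne').const_mul (σ ^ 2)⁻¹
  refine h.congr (Eventually.of_forall fun y => ?_)
  simp only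
  rw [← mul_inv]
  congr 1
  field_simp

theorem integral_inv_sq_add_sq {σ : ℝ} (hσ : 0 < σ) :
    ∫ y : ℝ, (σ ^ 2 + y ^ 2)⁻¹ = Real.pi / σ := by
  have h := Measure.integral_comp_div (fun y : ℝ => (1 + y ^ 2)⁻¹) σ
  rw [integral_univ_inv_one_add_sq, abs_of_pos hσ, smul_eq_mul] at h
  have e : ∀ y : ℝ, (σ ^ 2 + y ^ 2)⁻¹ = (σ ^ 2)⁻¹ * (1 + (y / σ) ^ 2)⁻¹ := fun y => by
    rw [← mul_inv]
    congr 1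
    field_simp
  simp_rw [e]
  rw [integral_const_mul, h]
  field_simp

namespace QuadDecay

variable {σ₀ C : ℝ} {G : ℂ → ℂ}

theorem nonneg (hG : QuadDecay σ₀ C G) (hσ : 0 ≤ σ₀) : 0 ≤ C := by
  have h1 := (norm_nonneg _).trans (hG.bound ((σ₀ + 1 : ℝ) : ℂ) (by simp))
  refine nonneg_of_mul_nonneg_left h1 ?_
  have : ((σ₀ + 1 : ℝ) : ℂ) ≠ 0 := by exact_mod_cast (by linarith : (σ₀ + 1) ≠ 0)
  have := norm_pos_iff.2 this
  positivity

theorem norm_le (hG : QuadDecay σ₀ C G) {σ : ℝ} (hσ : σ₀ < σ) (u y : ℝ) :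
    ‖Complex.exp (u * (σ + y * Complex.I)) * G (σ + y * Complex.I)‖ ≤
      Real.exp (u * σ) * C * (σ ^ 2 + y ^ 2)⁻¹ := by
  rw [norm_mul, norm_exp_vertical, mul_assoc, ← vertical_norm_sq]
  gcongr
  exact hG.bound _ (by rwa [vertical_re])

theorem continuous_vertical (hG : QuadDecay σ₀ C G) {σ : ℝ} (hσ : σ₀ < σ) :
    Continuous fun y : ℝ => G (σ + y * Complex.I) :=
  hG.diff.continuousOn.comp_continuous (by fun_prop) fun y => by
    change σ₀ < _
    rwa [vertical_re]

theorem continuous_integrand (hG : QuadDecay σ₀ C G) {σ : ℝ} (hσ : σ₀ < σ) (u : ℝ) :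
    Continuous fun y : ℝ => Complex.exp (u * (σ + y * Complex.I)) * G (σ + y * Complex.I) :=
  Continuous.mul (by fun_prop) (hG.continuous_vertical hσ)

theorem integrable (hG : QuadDecay σ₀ C G) (h0 : 0 ≤ σ₀) {σ : ℝ} (hσ : σ₀ < σ) (u : ℝ) :
    Integrable fun y : ℝ => Complex.exp (u * (σ + y * Complex.I)) * G (σ + y * Complex.I) :=
  ((integrable_inv_sq_add_sq (h0.trans_lt hσ)).const_mul _).mono'
    (hG.continuous_integrand hσ u).aestronglyMeasurable
    (Eventually.of_forall fun y => hG.norm_le hσ u y)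

theorem norm_invLaplace_le (hG : QuadDecay σ₀ C G) (h0 : 0 ≤ σ₀) {σ : ℝ} (hσ : σ₀ < σ) (u : ℝ) :
    ‖invLaplace σ u G‖ ≤ Real.exp (u * σ) * C / (2 * σ) := by
  have hσ0 := h0.trans_lt hσ
  have hn : ‖(2 * Real.pi : ℂ)⁻¹‖ = (2 * Real.pi)⁻¹ := by
    rw [norm_inv, norm_mul, Complex.norm_ofNat, Complex.norm_real, Real.norm_eq_abs,
      abs_of_pos Real.pi_pos]
  rw [invLaplace, norm_mul, hn]
  calc _ ≤ (2 * Real.pi)⁻¹ * ∫ y : ℝ, Real.exp (u * σ) * C * (σ ^ 2 + y ^ 2)⁻¹ := by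
        gcongr
        exact norm_integral_le_of_norm_le ((integrable_inv_sq_add_sq hσ0).const_mul _)
          (Eventually.of_forall fun y => hG.norm_le hσ u y)
    _ = _ := by
        rw [integral_const_mul, integral_inv_sq_add_sq hσ0]
        have := Real.pi_pos.ne'
        field_simp

/-- The inverse Laplace transform does not depend on the abscissa, by Cauchy's theorem on long
rectangles. -/
theorem invLaplace_eq_of_lt (hG : QuadDecay σ₀ C G) (h0 : 0 ≤ σ₀) {σ₁ σ₂ : ℝ} (h1 : σ₀ < σ₁)
    (h12 : σ₁ < σ₂) (u : ℝ) : invLaplace σ₁ u G = invLaplace σ₂ u G := by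
  obtain ⟨f, hf⟩ : ∃ f : ℂ → ℂ, f = fun s => Complex.exp (u * s) * G s := ⟨_, rfl⟩
  have hfd : DifferentiableOn ℂ f {s | σ₀ < s.re} := by
    rw [hf]; exact (Differentiable.differentiableOn (by fun_prop)).mul hG.diff
  have hfb : ∀ σ y : ℝ, σ₁ ≤ σ → σ ≤ σ₂ → 0 < y ^ 2 → ‖f (σ + y * Complex.I)‖ ≤
      Real.exp (|u| * σ₂) * C * (y ^ 2)⁻¹ := by
    intro σ y hσ hσ' hy
    have hC := hG.nonneg h0
    rw [hf]
    refine (hG.norm_le (h1.trans_le hσ) u y).trans ?_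
    have hu : u * σ ≤ |u| * σ₂ := (mul_le_mul_of_nonneg_right (le_abs_self u) (by linarith)).trans
      (mul_le_mul_of_nonneg_left hσ' (abs_nonneg u))
    gcongr
    nlinarith
  have hrect : ∀ T : ℝ, (∫ x : ℝ in σ₁..σ₂, f (x + (-T : ℝ) * Complex.I)) -
      (∫ x : ℝ in σ₁..σ₂, f (x + T * Complex.I)) +
      Complex.I • (∫ y : ℝ in (-T)..T, f (σ₂ + y * Complex.I)) -
      Complex.I • (∫ y : ℝ in (-T)..T, f (σ₁ + y * Complex.I)) = 0 := by
    intro T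
    have := Complex.integral_boundary_rect_eq_zero_of_differentiableOn f (σ₁ + (-T : ℝ) * Complex.I)
      (σ₂ + T * Complex.I) (hfd.mono fun s hs => by
        have := hs.1
        simp only [mem_preimage, vertical_re, uIcc_of_le h12.le, mem_Icc] at this
        exact h1.trans_le this.1)
    simpa using this
  have hv : ∀ σ : ℝ, σ₀ < σ → Tendsto (fun T : ℝ => ∫ y : ℝ in (-T)..T, f (σ + y * Complex.I))
      atTop (𝓝 (∫ y : ℝ, f (σ + y * Complex.I))) := by
    intro σ hσ
    rw [hf]
    exact intervalIntegral_tendsto_integral (hG.integrable h0 hσ u) tendsto_neg_atTop_atBot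
      tendsto_id
  have hh : ∀ q : ℝ → ℝ, (∀ T, (q T) ^ 2 = T ^ 2) →
      Tendsto (fun T : ℝ => ∫ x : ℝ in σ₁..σ₂, f (x + (q T) * Complex.I)) atTop (𝓝 0) := by
    intro q hq
    have hlim : Tendsto (fun T : ℝ => Real.exp (|u| * σ₂) * C * (T ^ 2)⁻¹ * |σ₂ - σ₁|) atTop
        (𝓝 (Real.exp (|u| * σ₂) * C * 0 * |σ₂ - σ₁|)) :=
      ((tendsto_inv_atTop_zero.comp (tendsto_pow_atTop two_ne_zero)).const_mul _).mul_const _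
    rw [mul_zero, zero_mul] at hlim
    refine squeeze_zero_norm' ?_ hlim
    filter_upwards [eventually_gt_atTop 0] with T hT
    refine intervalIntegral.norm_integral_le_of_norm_le_const fun x hx => ?_
    rw [uIoc_of_le h12.le] at hx
    rw [← hq T]
    exact hfb x (q T) hx.1.le hx.2 (by rw [hq]; positivity)
  have hlim := (((hh (fun T => -T) fun T => by ring).sub (hh (fun T => T) fun T => rfl)).add
    ((hv σ₂ (h1.trans h12)).const_smul Complex.I)).sub ((hv σ₁ h1).const_smul Complex.I)
  have := tendsto_nhds_unique hlim (tendsto_const_nhds.congr fun T => (hrect T).symm)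
  rw [sub_zero, zero_add, ← smul_sub, smul_eq_zero, or_iff_right Complex.I_ne_zero] at this
  rw [invLaplace, invLaplace]
  congr 1
  rw [hf] at this
  exact (sub_eq_zero.1 this).symm

theorem invLaplace_eq (hG : QuadDecay σ₀ C G) (h0 : 0 ≤ σ₀) {σ₁ σ₂ : ℝ} (h1 : σ₀ < σ₁)
    (h2 : σ₀ < σ₂) (u : ℝ) : invLaplace σ₁ u G = invLaplace σ₂ u G := by
  rcases lt_trichotomy σ₁ σ₂ with h | h | h
  · exact hG.invLaplace_eq_of_lt h0 h1 h u
  · rw [h]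
  · exact (hG.invLaplace_eq_of_lt h0 h2 h u).symm

/-- For `u ≤ 0` the line of integration can be moved to `+∞`. -/
theorem invLaplace_of_nonpos (hG : QuadDecay σ₀ C G) (h0 : 0 ≤ σ₀) {σ : ℝ} (hσ : σ₀ < σ) {u : ℝ}
    (hu : u ≤ 0) : invLaplace σ u G = 0 := by
  have hlim : Tendsto (fun τ : ℝ => C / (2 * τ)) atTop (𝓝 0) :=
    tendsto_const_nhds.div_atTop (tendsto_id.const_mul_atTop two_pos)
  refine norm_le_zero_iff.1 (ge_of_tendsto hlim ?_)
  filter_upwards [eventually_gt_atTop σ₀] with τ hτ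
  rw [hG.invLaplace_eq h0 hσ hτ]
  refine (hG.norm_invLaplace_le h0 hτ u).trans ?_
  have hτ0 := h0.trans_lt hτ
  have hC := hG.nonneg h0
  gcongr
  refine mul_le_of_le_one_left hC (Real.exp_le_one_iff.2 ?_)
  nlinarith

theorem continuous_invLaplace (hG : QuadDecay σ₀ C G) (h0 : 0 ≤ σ₀) {σ : ℝ} (hσ : σ₀ < σ) :
    Continuous fun u => invLaplace σ u G := by
  have hC := hG.nonneg h0
  refine Continuous.mul continuous_const (continuous_iff_continuousAt.2 fun u₀ => ?_)
  refine continuousAt_of_dominated (bound := fun y => Real.exp ((|u₀| + 1) * σ) * C *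
    (σ ^ 2 + y ^ 2)⁻¹) (Eventually.of_forall fun u =>
      (hG.continuous_integrand hσ u).aestronglyMeasurable) ?_
    ((integrable_inv_sq_add_sq (h0.trans_lt hσ)).const_mul _)
    (Eventually.of_forall fun y => by fun_prop)
  filter_upwards [Metric.ball_mem_nhds u₀ one_pos] with u hu
  refine Eventually.of_forall fun y => (hG.norm_le hσ u y).trans ?_
  have hσ0 := h0.trans_lt hσ
  have : u ≤ |u₀| + 1 := by
    have h1 := (abs_lt.1 (Real.dist_eq u u₀ ▸ Metric.mem_ball.1 hu)).2
    linarith [le_abs_self u₀]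
  gcongr

theorem norm_exp_neg_mul_invLaplace_le (hG : QuadDecay σ₀ C G) (h0 : 0 ≤ σ₀) {σ : ℝ} (hσ : σ₀ < σ)
    {s : ℂ} (u : ℝ) : ‖Complex.exp (-u * s) * invLaplace σ u G‖ ≤
      C / (2 * σ) * Real.exp (-(s.re - σ) * u) := by
  rw [norm_mul, Complex.norm_exp]
  calc _ ≤ Real.exp (-u * s).re * (Real.exp (u * σ) * C / (2 * σ)) := by
        gcongr; exact hG.norm_invLaplace_le h0 hσ u
    _ = C / (2 * σ) * (Real.exp (-u * s).re * Real.exp (u * σ)) := by ring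
    _ = _ := by
        rw [← Real.exp_add, ← Complex.ofReal_neg, Complex.re_ofReal_mul]
        congr 2
        ring

theorem integrableOn_laplace (hG : QuadDecay σ₀ C G) (h0 : 0 ≤ σ₀) {σ : ℝ} (hσ : σ₀ < σ) {s : ℂ}
    (hs : σ < s.re) : IntegrableOn (fun u : ℝ => Complex.exp (-u * s) * invLaplace σ u G)
      (Ioi 0) := by
  refine ((integrableOn_exp_mul_Ioi (a := -(s.re - σ)) (by linarith) 0).const_mul
    (C / (2 * σ))).mono' ?_ (Eventually.of_forall fun u =>
      hG.norm_exp_neg_mul_invLaplace_le h0 hσ u)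
  have := hG.continuous_invLaplace h0 hσ
  exact Continuous.aestronglyMeasurable (by fun_prop)

theorem integrable_laplace (hG : QuadDecay σ₀ C G) (h0 : 0 ≤ σ₀) {σ : ℝ} (hσ : σ₀ < σ) {s : ℂ}
    (hs : σ < s.re) : Integrable fun u : ℝ => Complex.exp (-u * s) * invLaplace σ u G := by
  rw [← integrableOn_univ, ← Iic_union_Ioi (a := (0 : ℝ))]
  refine IntegrableOn.union ?_ (hG.integrableOn_laplace h0 hσ hs)
  exact (integrableOn_zero (μ := volume) (s := Iic (0 : ℝ))).congr_fun
    (fun u hu => by simp [hG.invLaplace_of_nonpos h0 hσ hu]) measurableSet_Iic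

/-- The Laplace transform inverts the inverse Laplace transform, by Fourier inversion on the
vertical line through `s`. -/
theorem laplace_invLaplace (hG : QuadDecay σ₀ C G) (h0 : 0 ≤ σ₀) {σ : ℝ} (hσ : σ₀ < σ) {s : ℂ}
    (hs : σ < s.re) : ∫ u in Ioi (0 : ℝ), Complex.exp (-u * s) * invLaplace σ u G = G s := by
  have hτ : σ₀ < s.re := hσ.trans hs
  obtain ⟨H, hH⟩ : ∃ H : ℝ → ℂ, H = fun y : ℝ => G (s.re + y * Complex.I) := ⟨_, rfl⟩
  have hHc : Continuous H := hH ▸ hG.continuous_vertical hτ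
  have hHi : Integrable H := by
    have := hG.integrable h0 hτ 0
    simpa [hH] using this
  have hwhole : ∫ u in Ioi (0 : ℝ), Complex.exp (-u * s) * invLaplace σ u G =
      ∫ u : ℝ, Complex.exp (-u * s) * invLaplace σ u G := by
    refine setIntegral_eq_integral_of_forall_compl_eq_zero fun u hu => ?_
    rw [hG.invLaplace_of_nonpos h0 hσ (not_lt.1 hu), mul_zero]
  have hpi : 2 * Real.pi ≠ 0 := by positivity
  have hpiC : (2 * Real.pi : ℂ) ≠ 0 := by exact_mod_cast hpi
  have hFour : FourierTransform.fourier H = fun v : ℝ => (2 * Real.pi : ℂ) *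
      (Complex.exp (-((-(2 * Real.pi) * v : ℝ) : ℂ) * (s.re : ℂ)) *
        invLaplace σ (-(2 * Real.pi) * v) G) := by
    ext v
    rw [hG.invLaplace_eq h0 hσ hτ, invLaplace, Real.fourier_real_eq_integral_exp_smul]
    rw [mul_left_comm, mul_inv_cancel_left₀ hpiC, ← integral_const_mul]
    refine integral_congr_ae (Eventually.of_forall fun y => ?_)
    simp only [hH, smul_eq_mul]
    rw [← mul_assoc, ← Complex.exp_add]
    congr 2
    push_cast
    ring
  have hFi : Integrable (FourierTransform.fourier H) := by
    rw [hFour]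
    exact ((hG.integrable_laplace h0 hσ (s := (s.re : ℂ)) (by simpa using hs)).comp_mul_left'
      (neg_ne_zero.2 hpi)).const_mul _
  have hinv := congrFun (hHc.fourierInv_fourier_eq hHi hFi) s.im
  rw [hwhole]
  have hHs : H s.im = G s := by rw [hH]; simp only [Complex.re_add_im]
  rw [← hHs, ← hinv, Real.fourierInv_eq_fourier_neg, Real.fourier_real_eq_integral_exp_smul, hFour]
  have hcomp := Measure.integral_comp_mul_left
    (fun u : ℝ => Complex.exp (-u * s) * invLaplace σ u G) (-(2 * Real.pi))
  have habs : |(-(2 * Real.pi))⁻¹| = (2 * Real.pi)⁻¹ := by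
    rw [abs_inv, abs_neg, abs_of_pos (by positivity)]
  rw [habs] at hcomp
  have hfin : ∀ v : ℝ, Complex.exp (((-2 * Real.pi * v * -s.im : ℝ) : ℂ) * Complex.I) •
      ((2 * Real.pi : ℂ) * (Complex.exp (-((-(2 * Real.pi) * v : ℝ) : ℂ) * (s.re : ℂ)) *
        invLaplace σ (-(2 * Real.pi) * v) G)) = (2 * Real.pi : ℂ) *
      (Complex.exp (-((-(2 * Real.pi) * v : ℝ) : ℂ) * s) *
        invLaplace σ (-(2 * Real.pi) * v) G) := by
    intro v
    rw [smul_eq_mul, mul_left_comm, ← mul_assoc (Complex.exp _), ← Complex.exp_add]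
    congr 3
    conv_rhs => rw [← Complex.re_add_im s]
    push_cast
    ring
  simp_rw [hfin]
  rw [integral_const_mul, hcomp, Complex.real_smul]
  push_cast
  rw [mul_inv_cancel_left₀ hpiC]

end QuadDecay

theorem quadDecay_inv_sq {σ₀ : ℝ} (h0 : 0 ≤ σ₀) : QuadDecay σ₀ 1 (fun s => (s ^ 2)⁻¹) where
  diff := fun s hs => by
    have : s ≠ 0 := fun h => by
      rw [h] at hs
      exact absurd (show σ₀ < 0 from hs) (not_lt.2 h0)
    exact ((differentiableAt_id.pow 2).inv (pow_ne_zero 2 this)).differentiableWithinAt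
  bound := fun s _ => by rw [norm_inv, norm_pow, one_mul]

/-- The inverse Laplace transform of `s⁻²` is the identity: it is linear by homogeneity, and the
slope is determined by the Laplace transform at `s = 1`. -/
theorem invLaplace_inv_sq {σ : ℝ} (hσ : 0 < σ) {u : ℝ} (hu : 0 ≤ u) :
    invLaplace σ u (fun s => (s ^ 2)⁻¹) = u := by
  have hQ := quadDecay_inv_sq le_rfl
  have hhom : ∀ {u : ℝ}, 0 < u → invLaplace (1 / 2) u (fun s => (s ^ 2)⁻¹) =
      u * invLaplace (1 / 2) 1 (fun s => (s ^ 2)⁻¹) := by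
    intro u hu
    have huC : (u : ℂ) ≠ 0 := by exact_mod_cast hu.ne'
    rw [hQ.invLaplace_eq le_rfl (σ₁ := 1 / 2) (σ₂ := 1 / 2 / u) (by positivity) (by positivity),
      invLaplace, invLaplace, mul_left_comm]
    congr 1
    have hcomp := Measure.integral_comp_div (fun y : ℝ => Complex.exp (u * (((1 / 2 / u : ℝ) : ℂ) +
      y * Complex.I)) * ((((1 / 2 / u : ℝ) : ℂ) + y * Complex.I) ^ 2)⁻¹) u
    rw [abs_of_pos hu, Complex.real_smul] at hcomp
    refine mul_left_cancel₀ huC (hcomp.symm.trans ?_)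
    rw [← mul_assoc, ← integral_const_mul]
    refine integral_congr_ae (Eventually.of_forall fun y => ?_)
    have e : (((1 / 2 / u : ℝ) : ℂ) + ((y / u : ℝ) : ℂ) * Complex.I) =
        (((1 / 2 : ℝ) : ℂ) + y * Complex.I) / u := by
      push_cast; field_simp
    simp only
    rw [e, mul_div_cancel₀ _ huC, div_pow, inv_div]
    push_cast
    rw [one_mul, div_eq_mul_inv]
    ring
  have hL := hQ.laplace_invLaplace le_rfl (σ := 1 / 2) (s := 1) (by norm_num) (by norm_num)
  have hG : ∫ u in Ioi (0 : ℝ), Complex.exp (-u * 1) * (u : ℂ) = 1 := by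
    have h1 : Real.Gamma 2 = 1 := Real.Gamma_two
    rw [Real.Gamma_eq_integral (by norm_num)] at h1
    have h2 : ∫ u in Ioi (0 : ℝ), Real.exp (-u) * u = 1 := by
      rw [← h1]
      refine setIntegral_congr_fun measurableSet_Ioi fun u _ => ?_
      norm_num
    have h3 := congrArg (fun r : ℝ => (r : ℂ)) h2
    simp only [← integral_complex_ofReal, Complex.ofReal_one] at h3
    refine Eq.trans (setIntegral_congr_fun measurableSet_Ioi fun u _ => ?_) h3
    simp
  have hslope : invLaplace (1 / 2) 1 (fun s => (s ^ 2)⁻¹) = 1 := by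
    have h3 : ∫ u in Ioi (0 : ℝ), Complex.exp (-u * 1) * invLaplace (1 / 2) u (fun s => (s ^ 2)⁻¹) =
        ∫ u in Ioi (0 : ℝ), (Complex.exp (-u * 1) * (u : ℂ)) *
          invLaplace (1 / 2) 1 (fun s => (s ^ 2)⁻¹) := by
      refine setIntegral_congr_fun measurableSet_Ioi fun u hu => ?_
      rw [hhom hu, mul_assoc]
    rw [h3, integral_mul_const, hG] at hL
    simpa using hL
  rcases hu.eq_or_lt with rfl | hu
  · rw [hQ.invLaplace_of_nonpos le_rfl hσ le_rfl, Complex.ofReal_zero]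
  · rw [hQ.invLaplace_eq le_rfl hσ (σ₂ := 1 / 2) (by norm_num), hhom hu, hslope, mul_one]

/-- The inverse Laplace transform turns multiplication by `s` into differentiation. -/
theorem hasDerivAt_invLaplace {σ₀ C C' : ℝ} {G : ℂ → ℂ} (hG : QuadDecay σ₀ C G)
    (hG' : QuadDecay σ₀ C' (fun s => s * G s)) (h0 : 0 ≤ σ₀) {σ : ℝ} (hσ : σ₀ < σ) (u : ℝ) :
    HasDerivAt (fun u => invLaplace σ u G) (invLaplace σ u (fun s => s * G s)) u := by
  have hC' := hG'.nonneg h0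
  refine HasDerivAt.const_mul _ ?_
  refine (hasDerivAt_integral_of_dominated_loc_of_deriv_le (𝕜 := ℝ) (s := Metric.ball u 1)
    (F' := fun v y => Complex.exp (v * (σ + y * Complex.I)) *
      ((σ + y * Complex.I) * G (σ + y * Complex.I)))
    (bound := fun y => Real.exp ((|u| + 1) * σ) * C' * (σ ^ 2 + y ^ 2)⁻¹)
    (Metric.ball_mem_nhds u one_pos)
    (Eventually.of_forall fun v => (hG.continuous_integrand hσ v).aestronglyMeasurable)
    (hG.integrable h0 hσ u) (hG'.continuous_integrand hσ u).aestronglyMeasurable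
    (Eventually.of_forall fun y v hv => ?_)
    ((integrable_inv_sq_add_sq (h0.trans_lt hσ)).const_mul _)
    (Eventually.of_forall fun y v hv => ?_)).2
  · refine (hG'.norm_le hσ v y).trans ?_
    have hσ0 := h0.trans_lt hσ
    have : v ≤ |u| + 1 := by
      have h1 := (abs_lt.1 (Real.dist_eq v u ▸ Metric.mem_ball.1 hv)).2
      linarith [le_abs_self u]
    gcongr
  · have h1 : HasDerivAt (fun v : ℝ => (v : ℂ) * (σ + y * Complex.I)) (1 * (σ + y * Complex.I)) v :=
      (Complex.ofRealCLM.hasDerivAt (x := v)).mul_const _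
    refine (h1.cexp.mul_const _).congr_deriv ?_
    ring

/-! ### Gluing Taylor expansions along the half line -/

/-- The Taylor series with derivatives `Φ n u` at the point `u`. -/
noncomputable def taylorSum (Φ : ℕ → ℝ → ℂ) (u : ℝ) (w : ℂ) : ℂ :=
  ∑' n : ℕ, Φ n u * w ^ n / n.factorial

theorem norm_taylor_term_le {c w : ℂ} {A R q : ℝ} {n : ℕ} (hR : 0 ≤ R) (hA : 0 ≤ A)
    (hc : ‖c‖ ≤ A * R ^ n * n.factorial) (hw : ‖w‖ * R ≤ q) :
    ‖c * w ^ n / n.factorial‖ ≤ A * q ^ n := by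
  rw [norm_div, norm_mul, norm_pow, Complex.norm_natCast, div_le_iff₀ (by positivity)]
  calc ‖c‖ * ‖w‖ ^ n ≤ (A * R ^ n * n.factorial) * ‖w‖ ^ n := by gcongr
    _ = A * (‖w‖ * R) ^ n * n.factorial := by rw [mul_pow]; ring
    _ ≤ A * q ^ n * n.factorial := by gcongr

/-- The sum of the Taylor series at `u` does not depend on `u`: in the derivative of a partial sum
along `u ↦ ξ - u` all but the last term cancel. -/
theorem taylorSum_sub_eq {Φ : ℕ → ℝ → ℂ} {B R σ : ℝ} (hR : 0 < R) (hσ : 0 ≤ σ) (hB : 0 ≤ B)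
    (hderiv : ∀ n, ∀ u, 0 ≤ u → HasDerivWithinAt (Φ n) (Φ (n + 1) u) (Ici 0) u)
    (hbound : ∀ n, ∀ u, 0 ≤ u → ‖Φ n u‖ ≤ B * Real.exp (σ * u) * R ^ n * n.factorial)
    {ξ : ℂ} {u₁ u₂ : ℝ} (h1 : 0 ≤ u₁) (h2 : 0 ≤ u₂) (hξ1 : ‖ξ - u₁‖ * R ≤ 1 / 2)
    (hξ2 : ‖ξ - u₂‖ * R ≤ 1 / 2) : taylorSum Φ u₁ (ξ - u₁) = taylorSum Φ u₂ (ξ - u₂) := by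
  obtain ⟨S, hS⟩ : ∃ S : ℕ → ℝ → ℂ, S = fun N u =>
    ∑ n ∈ Finset.range N, Φ n u * (ξ - u) ^ n / n.factorial := ⟨_, rfl⟩
  have hconv : ∀ u : ℝ, 0 ≤ u → ‖ξ - u‖ * R ≤ 1 / 2 →
      Tendsto (fun N => S N u) atTop (𝓝 (taylorSum Φ u (ξ - u))) := by
    intro u hu hξ
    have hs : Summable fun n : ℕ => Φ n u * (ξ - u) ^ n / n.factorial :=
      Summable.of_norm_bounded (((summable_geometric_of_lt_one (by norm_num)
        (by norm_num : (1 / 2 : ℝ) < 1)).mul_left (B * Real.exp (σ * u))))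
        fun n => norm_taylor_term_le hR.le (by positivity) (hbound n u hu) hξ
    rw [hS]
    exact hs.hasSum.tendsto_sum_nat
  obtain ⟨b, hb⟩ : ∃ b, b = max u₁ u₂ := ⟨_, rfl⟩
  obtain ⟨K, hKdef⟩ : ∃ K, K = {u : ℝ | 0 ≤ u ∧ u ≤ b ∧ ‖ξ - u‖ * R ≤ 1 / 2} := ⟨_, rfl⟩
  have hKc : Convex ℝ K := by
    have e : K = Ici 0 ∩ (Iic b ∩ (fun u : ℝ => (u : ℂ)) ⁻¹' Metric.closedBall ξ (1 / 2 / R)) := by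
      rw [hKdef]
      ext u
      simp only [mem_ofPred_eq, mem_inter_iff, mem_Ici, mem_Iic, mem_preimage,
        Metric.mem_closedBall, dist_eq_norm, le_div_iff₀ hR, norm_sub_rev (u : ℂ) ξ]
    rw [e]
    refine (convex_Ici _).inter ((convex_Iic _).inter ?_)
    exact (convex_closedBall ξ (1 / 2 / R)).linear_preimage Complex.ofRealLI.toLinearMap
  have hd : ∀ N, ∀ u, 0 ≤ u → HasDerivWithinAt (S (N + 1))
      (Φ (N + 1) u * (ξ - u) ^ N / N.factorial) (Ici 0) u := by
    intro N u hu
    have hsub : ∀ v : ℝ, HasDerivAt (fun v : ℝ => ξ - (v : ℂ)) (-1) v := fun v =>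
      (Complex.ofRealCLM.hasDerivAt (x := v)).const_sub ξ
    induction N with
    | zero =>
      have := hderiv 0 u hu
      simpa [hS, Finset.sum_range_one] using this
    | succ N ih =>
      have e : S (N + 1 + 1) = fun u => S (N + 1) u + Φ (N + 1) u * (ξ - u) ^ (N + 1) /
          (N + 1).factorial := by
        rw [hS]; ext u; exact Finset.sum_range_succ _ _
      rw [e]
      have h3 := ((hderiv (N + 1) u hu).mul ((hsub u).pow (N + 1)).hasDerivWithinAt).div_const
        ((N + 1).factorial : ℂ)
      refine (ih.add h3).congr_deriv ?_
      have hf : ((N + 1).factorial : ℂ) ≠ 0 := by exact_mod_cast (Nat.factorial_pos _).ne'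
      have hf' : (N.factorial : ℂ) ≠ 0 := by exact_mod_cast (Nat.factorial_pos _).ne'
      have hN : (N : ℂ) + 1 ≠ 0 := by exact_mod_cast Nat.succ_ne_zero N
      rw [Nat.factorial_succ]
      simp only [Pi.pow_apply]
      push_cast
      field_simp
      ring
  have hmem1 : u₁ ∈ K := by rw [hKdef]; exact ⟨h1, hb ▸ le_max_left _ _, hξ1⟩
  have hmem2 : u₂ ∈ K := by rw [hKdef]; exact ⟨h2, hb ▸ le_max_right _ _, hξ2⟩
  have hdiff : ∀ N : ℕ, ‖S (N + 1) u₂ - S (N + 1) u₁‖ ≤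
      B * Real.exp (σ * b) * R * ((N + 1 : ℕ) * (1 / 2) ^ N) * ‖u₂ - u₁‖ := by
    intro N
    refine hKc.norm_image_sub_le_of_norm_hasDerivWithin_le
      (f' := fun u => Φ (N + 1) u * (ξ - u) ^ N / N.factorial) (fun u hu => ?_) (fun u hu => ?_)
      hmem1 hmem2
    · rw [hKdef] at hu
      refine (hd N u hu.1).mono fun v hv => ?_
      rw [hKdef] at hv
      exact hv.1
    · rw [hKdef] at hu
      have h4 : ‖Φ (N + 1) u‖ ≤ (B * Real.exp (σ * b) * R * (N + 1 : ℕ)) * R ^ N * N.factorial := by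
        have : Real.exp (σ * u) ≤ Real.exp (σ * b) :=
          Real.exp_le_exp.2 (mul_le_mul_of_nonneg_left hu.2.1 hσ)
        have h5 := hbound (N + 1) u hu.1
        rw [Nat.factorial_succ, pow_succ] at h5
        push_cast at h5 ⊢
        calc _ ≤ _ := h5
          _ ≤ B * Real.exp (σ * b) * (R ^ N * R) * (((N : ℝ) + 1) * N.factorial) := by gcongr
          _ = _ := by ring
      refine (norm_taylor_term_le hR.le (by positivity) h4 hu.2.2).trans_eq (by ring)
  have hzero : Tendsto (fun N : ℕ => B * Real.exp (σ * b) * R * ((N + 1 : ℕ) * (1 / 2 : ℝ) ^ N) *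
      ‖u₂ - u₁‖) atTop (𝓝 (B * Real.exp (σ * b) * R * (0 + 0) * ‖u₂ - u₁‖)) := by
    refine ((Tendsto.congr (fun N => ?_) ((tendsto_self_mul_const_pow_of_lt_one
      (r := (1 / 2 : ℝ)) (by norm_num) (by norm_num)).add
      (tendsto_pow_atTop_nhds_zero_of_lt_one (r := (1 / 2 : ℝ)) (by norm_num)
        (by norm_num)))).const_mul _).mul_const _
    push_cast
    ring
  rw [add_zero, mul_zero, zero_mul] at hzero
  have hlim := ((hconv u₂ h2 hξ2).comp (tendsto_add_atTop_nat 1)).sub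
    ((hconv u₁ h1 hξ1).comp (tendsto_add_atTop_nat 1))
  have := tendsto_nhds_unique hlim (squeeze_zero_norm hdiff hzero)
  exact (sub_eq_zero.1 this).symm

theorem norm_setIntegral_sub_setIntegral_le {T : Type*} [MeasurableSpace T] {μ : Measure T}
    {f : T → ℂ} {b : T → ℝ} {s t : Set T} (hts : t ⊆ s) (hs : MeasurableSet s)
    (ht : MeasurableSet t) (hf : IntegrableOn f s μ) (hb : IntegrableOn b s μ)
    (hfb : ∀ x ∈ s, ‖f x‖ ≤ b x) :
    ‖∫ x in s, f x ∂μ - ∫ x in t, f x ∂μ‖ ≤ ∫ x in s, b x ∂μ - ∫ x in t, b x ∂μ := by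
  rw [← setIntegral_sdiff ht hf hts, ← setIntegral_sdiff ht hb hts]
  exact norm_integral_le_of_norm_le (hb.mono_set sdiff_subset)
    (ae_restrict_of_forall_mem (hs.diff ht) fun x hx => hfb x hx.1)

/-! ### Nevanlinna's theorem in a half plane -/

/-- In the variable `s = e^{iθ} / ħ`: `F` is holomorphic on `U × {σ₀ < Re s}` and has an expansion
in powers of `s⁻¹` with Gevrey bounds, uniformly on `U`. -/
structure GevreyHalfPlane (U : Set ℂ) (σ₀ C M : ℝ) (F : ℂ → ℂ → ℂ) (g : ℕ → ℂ → ℂ) : Prop where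
  isOpen : IsOpen U
  pos : 0 < σ₀
  pos_const : 0 < C
  pos_rate : 0 < M
  diff : DifferentiableOn ℂ (fun p : ℂ × ℂ => F p.1 p.2) (U ×ˢ {s | σ₀ < s.re})
  diff_coeff : ∀ k, DifferentiableOn ℂ (g k) U
  bound : ∀ n, ∀ x ∈ U, ∀ s : ℂ, σ₀ < s.re →
    ‖F x s - ∑ k ∈ Finset.range n, g k x * s⁻¹ ^ k‖ ≤ C * M ^ n * n.factorial * ‖s‖⁻¹ ^ n
  bound_coeff : ∀ k, ∀ x ∈ U, ‖g k x‖ ≤ C * M ^ k * k.factorial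

/-- The remainder of order `n + m`, multiplied by `s ^ n`. -/
noncomputable def shiftRem (F : ℂ → ℂ → ℂ) (g : ℕ → ℂ → ℂ) (m n : ℕ) (x s : ℂ) : ℂ :=
  s ^ n * (F x s - ∑ k ∈ Finset.range (n + m), g k x * s⁻¹ ^ k)

/-- The `n`-th derivative along the half line of the Borel transform of `F`. -/
noncomputable def borelCoeff (σ : ℝ) (F : ℂ → ℂ → ℂ) (g : ℕ → ℂ → ℂ) (n : ℕ) (x : ℂ) (u : ℝ) : ℂ :=
  g (n + 1) x + invLaplace σ u (shiftRem F g 2 n x)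

/-- The Borel transform near the half line, as the sum of the Taylor series at the nearest point of
the half line. -/
noncomputable def borelFun (σ : ℝ) (F : ℂ → ℂ → ℂ) (g : ℕ → ℂ → ℂ) (x ξ : ℂ) : ℂ :=
  taylorSum (fun n => borelCoeff σ F g n x) (max ξ.re 0) (ξ - (max ξ.re 0 : ℝ))

theorem norm_sub_max_re_le {ξ : ℂ} {u : ℝ} (hu : 0 ≤ u) :
    ‖ξ - (max ξ.re 0 : ℝ)‖ ≤ ‖ξ - u‖ := by
  rw [Complex.norm_def, Complex.norm_def]
  refine Real.sqrt_le_sqrt ?_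
  simp only [Complex.normSq_apply, Complex.sub_re, Complex.sub_im, Complex.ofReal_re,
    Complex.ofReal_im]
  rcases le_total ξ.re 0 with h | h
  · rw [max_eq_right h]; nlinarith
  · rw [max_eq_left h]; nlinarith [mul_self_nonneg (ξ.re - u)]

theorem ne_zero_of_lt_re {σ₀ : ℝ} {s : ℂ} (h0 : 0 < σ₀) (hs : σ₀ < s.re) : s ≠ 0 := by
  rintro rfl
  exact absurd (h0.trans hs) (lt_irrefl _)

/-- The inverse Laplace transform of `s⁻¹` is `1`, as a principal value. -/
theorem tendsto_integral_exp_div {σ : ℝ} (hσ : 0 < σ) {u : ℝ} (hu : 0 < u) :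
    Tendsto (fun T : ℝ => (2 * Real.pi : ℂ)⁻¹ * ∫ y : ℝ in (-T)..T,
      Complex.exp (u * (σ + y * Complex.I)) / (σ + y * Complex.I)) atTop (𝓝 1) := by
  have huC : (u : ℂ) ≠ 0 := by exact_mod_cast hu.ne'
  have hne : ∀ y : ℝ, (σ + y * Complex.I : ℂ) ≠ 0 := fun y =>
    ne_zero_of_lt_re (σ₀ := σ / 2) (by positivity) (by rw [vertical_re]; linarith)
  obtain ⟨E, hE⟩ : ∃ E : ℝ → ℂ, E = fun y : ℝ =>
    Complex.exp (u * (σ + y * Complex.I)) / (σ + y * Complex.I) := ⟨_, rfl⟩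
  obtain ⟨Q, hQ⟩ : ∃ Q : ℝ → ℂ, Q = fun y : ℝ =>
    Complex.exp (u * (σ + y * Complex.I)) * ((σ + y * Complex.I) ^ 2)⁻¹ := ⟨_, rfl⟩
  have hEc : Continuous E := by
    rw [hE]; exact Continuous.div (by fun_prop) (by fun_prop) hne
  have hQc : Continuous Q := by
    rw [hQ]
    exact Continuous.mul (by fun_prop)
      (Continuous.inv₀ (by fun_prop) fun y => pow_ne_zero 2 (hne y))
  have hd : ∀ y, HasDerivAt E (Complex.I * (u * E y - Q y)) y := by
    intro y
    have h1 : HasDerivAt (fun y : ℝ => (σ + y * Complex.I : ℂ)) (1 * Complex.I) y :=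
      ((Complex.ofRealCLM.hasDerivAt (x := y)).mul_const Complex.I).const_add (σ : ℂ)
    rw [hE, hQ]
    refine ((h1.const_mul (u : ℂ)).cexp.div h1 (hne y)).congr_deriv ?_
    have := hne y
    field_simp
  have hparts : ∀ T : ℝ, ∫ y : ℝ in (-T)..T, E y =
      (u : ℂ)⁻¹ * ((∫ y : ℝ in (-T)..T, Q y) - Complex.I * (E T - E (-T))) := by
    intro T
    have h1 := intervalIntegral.integral_eq_sub_of_hasDerivAt (a := -T) (b := T)
      (fun y _ => hd y) (Continuous.intervalIntegrable (by fun_prop) _ _)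
    rw [intervalIntegral.integral_const_mul, intervalIntegral.integral_sub
      (Continuous.intervalIntegrable (by fun_prop) _ _) (hQc.intervalIntegrable _ _),
      intervalIntegral.integral_const_mul] at h1
    rw [← h1]
    field_simp
    linear_combination (u * (∫ y : ℝ in (-T)..T, E y) - ∫ y : ℝ in (-T)..T, Q y) * Complex.I_sq
  have hE0 : ∀ q : ℝ → ℝ, (∀ T, q T ^ 2 = T ^ 2) → Tendsto (fun T => E (q T)) atTop (𝓝 0) := by
    intro q hq
    have hlim : Tendsto (fun T : ℝ => Real.exp (u * σ) / T) atTop (𝓝 0) :=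
      tendsto_const_nhds.div_atTop tendsto_id
    refine squeeze_zero_norm' ?_ hlim
    filter_upwards [eventually_gt_atTop 0] with T hT
    rw [hE]
    simp only [norm_div, norm_exp_vertical]
    gcongr
    refine (sq_le_sq₀ hT.le (norm_nonneg _)).1 ?_
    rw [vertical_norm_sq, hq]
    nlinarith
  have hQi : Integrable Q := by
    rw [hQ]; exact (quadDecay_inv_sq le_rfl).integrable le_rfl hσ u
  have hQl : Tendsto (fun T : ℝ => ∫ y : ℝ in (-T)..T, Q y) atTop (𝓝 (∫ y, Q y)) :=
    intervalIntegral_tendsto_integral hQi tendsto_neg_atTop_atBot tendsto_id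
  have hlim := (((hQl.sub (((hE0 id fun _ => rfl).sub
    (hE0 (fun T => -T) fun T => by ring)).const_mul Complex.I)).const_mul
      (u : ℂ)⁻¹)).const_mul (2 * Real.pi : ℂ)⁻¹
  have hval : (2 * Real.pi : ℂ)⁻¹ * ((u : ℂ)⁻¹ * ((∫ y, Q y) - Complex.I * (0 - 0))) = 1 := by
    have h1 := invLaplace_inv_sq hσ hu.le
    rw [invLaplace] at h1
    rw [sub_zero, mul_zero, sub_zero, mul_left_comm, hQ, h1, inv_mul_cancel₀ huC]
  rw [hval] at hlim
  refine hlim.congr fun T => ?_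
  simp only [id]
  rw [← hparts T, hE]

namespace GevreyHalfPlane

variable {U : Set ℂ} {σ₀ C M : ℝ} {F : ℂ → ℂ → ℂ} {g : ℕ → ℂ → ℂ}

theorem diffOn_slice (hF : GevreyHalfPlane U σ₀ C M F g) {x : ℂ} (hx : x ∈ U) :
    DifferentiableOn ℂ (F x) {s | σ₀ < s.re} :=
  hF.diff.comp (f := fun s => (x, s)) (by fun_prop) fun _ hs => ⟨hx, hs⟩

theorem norm_shiftRem_le (hF : GevreyHalfPlane U σ₀ C M F g) (m n : ℕ) {x : ℂ} (hx : x ∈ U) {s : ℂ}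
    (hs : σ₀ < s.re) : ‖shiftRem F g m n x s‖ ≤
      C * M ^ (n + m) * (n + m).factorial * ‖s‖⁻¹ ^ m := by
  have h0 := norm_pos_iff.2 (ne_zero_of_lt_re hF.pos hs)
  rw [shiftRem, norm_mul, norm_pow]
  calc _ ≤ ‖s‖ ^ n * (C * M ^ (n + m) * (n + m).factorial * ‖s‖⁻¹ ^ (n + m)) := by
        gcongr; exact hF.bound _ x hx s hs
    _ = _ := by
        have h : ‖s‖ ^ n * ‖s‖⁻¹ ^ n = 1 := by rw [← mul_pow, mul_inv_cancel₀ h0.ne', one_pow]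
        rw [pow_add ‖s‖⁻¹]
        linear_combination (C * M ^ (n + m) * (n + m).factorial * ‖s‖⁻¹ ^ m) * h

theorem differentiableOn_shiftRem (hF : GevreyHalfPlane U σ₀ C M F g) (m n : ℕ) {x : ℂ}
    (hx : x ∈ U) : DifferentiableOn ℂ (shiftRem F g m n x) {s | σ₀ < s.re} := by
  refine DifferentiableOn.mul (by fun_prop) ((hF.diffOn_slice hx).sub ?_)
  refine DifferentiableOn.fun_sum fun k _ => DifferentiableOn.const_mul ?_ _
  exact (differentiableOn_inv.mono fun s hs => ne_zero_of_lt_re hF.pos hs).pow k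

theorem quadDecay_two (hF : GevreyHalfPlane U σ₀ C M F g) (n : ℕ) {x : ℂ} (hx : x ∈ U) :
    QuadDecay σ₀ (C * M ^ (n + 2) * (n + 2).factorial) (shiftRem F g 2 n x) where
  diff := hF.differentiableOn_shiftRem 2 n hx
  bound := fun s hs => by
    rw [← inv_pow]
    exact hF.norm_shiftRem_le 2 n hx hs

theorem quadDecay_three (hF : GevreyHalfPlane U σ₀ C M F g) (n : ℕ) {x : ℂ} (hx : x ∈ U) :
    QuadDecay σ₀ (C * M ^ (n + 3) * (n + 3).factorial * σ₀⁻¹) (shiftRem F g 3 n x) where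
  diff := hF.differentiableOn_shiftRem 3 n hx
  bound := fun s hs => by
    have h1 := hF.pos
    have h2 := hF.pos_const
    have h3 := hF.pos_rate
    have h0 : σ₀ ≤ ‖s‖ := hs.le.trans (Complex.re_le_norm s)
    refine (hF.norm_shiftRem_le 3 n hx hs).trans ?_
    rw [← inv_pow, pow_succ' ‖s‖⁻¹, ← mul_assoc]
    gcongr

theorem mul_shiftRem_three {s : ℂ} (n : ℕ) (x : ℂ) :
    s * shiftRem F g 3 n x s = shiftRem F g 2 (n + 1) x s := by
  rw [shiftRem, shiftRem, pow_succ' s n, mul_assoc, Nat.add_right_comm n 1 2]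

theorem shiftRem_two {s : ℂ} (hs : s ≠ 0) (n : ℕ) (x : ℂ) :
    shiftRem F g 2 n x s = g (n + 2) x * (s ^ 2)⁻¹ + shiftRem F g 3 n x s := by
  rw [shiftRem, shiftRem, show n + 3 = n + 2 + 1 from rfl, Finset.sum_range_succ _ (n + 2),
    pow_add s⁻¹]
  have h : s ^ n * s⁻¹ ^ n = 1 := by rw [← mul_pow, mul_inv_cancel₀ hs, one_pow]
  rw [← inv_pow]
  linear_combination (g (n + 2) x * s⁻¹ ^ 2) * h

/-- The functions `borelCoeff` are successive derivatives of each other: splitting off the term of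
order `n + 2`, whose inverse Laplace transform is linear in `u`, leaves a remainder that decays even
after multiplication by `s`. -/
theorem hasDerivWithinAt_borelCoeff (hF : GevreyHalfPlane U σ₀ C M F g) {σ : ℝ} (hσ : σ₀ < σ)
    (n : ℕ) {x : ℂ} (hx : x ∈ U) {u : ℝ} (hu : 0 ≤ u) :
    HasDerivWithinAt (borelCoeff σ F g n x) (borelCoeff σ F g (n + 1) x u) (Ici 0) u := by
  have hσ0 := hF.pos.trans hσ
  have h3 := hF.quadDecay_three n hx
  have he : ∀ v : ℝ, 0 ≤ v → borelCoeff σ F g n x v =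
      g (n + 1) x + (g (n + 2) x * v + invLaplace σ v (shiftRem F g 3 n x)) := by
    intro v hv
    rw [borelCoeff]
    congr 1
    have h4 := invLaplace_inv_sq hσ0 hv
    rw [← h4, invLaplace, invLaplace, invLaplace, mul_left_comm, ← mul_add,
      ← integral_const_mul (g (n + 2) x), ← integral_add]
    · congr 1
      refine integral_congr_ae (Eventually.of_forall fun y => ?_)
      simp only
      rw [shiftRem_two (ne_zero_of_lt_re hF.pos (s := σ + y * Complex.I) (by rwa [vertical_re]))]
      ring
    · exact ((quadDecay_inv_sq le_rfl).integrable le_rfl hσ0 v).const_mul _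
    · exact h3.integrable hF.pos.le hσ v
  have hd := hasDerivAt_invLaplace h3 (C' := C * M ^ (n + 1 + 2) * (n + 1 + 2).factorial)
    (by simp_rw [mul_shiftRem_three]; exact hF.quadDecay_two (n + 1) hx) hF.pos.le hσ u
  simp_rw [mul_shiftRem_three] at hd
  have h5 : HasDerivAt (fun v : ℝ => g (n + 2) x * (v : ℂ)) (g (n + 2) x * 1) u :=
    (Complex.ofRealCLM.hasDerivAt (x := u)).const_mul _
  have h6 := ((h5.add hd).const_add (g (n + 1) x)).hasDerivWithinAt (s := Ici 0)
  rw [mul_one] at h6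
  exact h6.congr he (he u hu)

/-- The derivatives of the Borel transform grow like those of a function with radius of convergence
`1 / (4 M)` at every point of the half line. The remainder of order `n + 2` costs a factor
`(n + 2)! ≤ 2 * 4 ^ n * n!`. -/
theorem norm_borelCoeff_le (hF : GevreyHalfPlane U σ₀ C M F g) {σ : ℝ} (hσ : σ₀ < σ)
    (n : ℕ) {x : ℂ} (hx : x ∈ U) {u : ℝ} (hu : 0 ≤ u) :
    ‖borelCoeff σ F g n x u‖ ≤
      2 * C * (M + M ^ 2 / (2 * σ)) * Real.exp (σ * u) * (4 * M) ^ n * n.factorial := by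
  have hσ0 := hF.pos.trans hσ
  have hC := hF.pos_const
  have hM := hF.pos_rate
  have h1 : 1 ≤ Real.exp (σ * u) := Real.one_le_exp (by positivity)
  have h2 := (hF.quadDecay_two n hx).norm_invLaplace_le hF.pos.le hσ u
  have hn1 : ((n : ℝ) + 1) ≤ 2 ^ n := by exact_mod_cast Nat.lt_two_pow_self
  have hn2 : ((n : ℝ) + 2) ≤ 2 * 2 ^ n := by
    have : (1 : ℝ) ≤ 2 ^ n := one_le_pow₀ (by norm_num)
    linarith
  have h4 : (4 : ℝ) ^ n = 2 ^ n * 2 ^ n := by rw [← mul_pow]; norm_num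
  have hf1 : ((n + 1).factorial : ℝ) ≤ 2 * 4 ^ n * n.factorial := by
    rw [Nat.factorial_succ]; push_cast
    have : (1 : ℝ) ≤ 2 ^ n := one_le_pow₀ (by norm_num)
    have h5 : (n : ℝ) + 1 ≤ 2 * 4 ^ n := by rw [h4]; nlinarith
    gcongr
  have hf2 : ((n + 2).factorial : ℝ) ≤ 2 * 4 ^ n * n.factorial := by
    rw [Nat.factorial_succ, Nat.factorial_succ]; push_cast
    rw [← mul_assoc]
    have h5 : ((n : ℝ) + 1 + 1) * (n + 1) ≤ 2 * 4 ^ n := by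
      rw [h4, ← mul_assoc]
      exact mul_le_mul (by linarith) hn1 (by positivity) (by positivity)
    gcongr
  calc _ ≤ C * M ^ (n + 1) * (n + 1).factorial +
        Real.exp (u * σ) * (C * M ^ (n + 2) * (n + 2).factorial) / (2 * σ) :=
        (norm_add_le _ _).trans (add_le_add (hF.bound_coeff _ x hx) h2)
    _ ≤ C * M ^ (n + 1) * (2 * 4 ^ n * n.factorial) * Real.exp (σ * u) +
        Real.exp (σ * u) * (C * M ^ (n + 2) * (2 * 4 ^ n * n.factorial)) / (2 * σ) := by
        rw [mul_comm u σ]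
        have h6 : C * M ^ (n + 1) * (n + 1).factorial ≤
            C * M ^ (n + 1) * (2 * 4 ^ n * n.factorial) * Real.exp (σ * u) :=
          le_trans (by gcongr) (le_mul_of_one_le_right (by positivity) h1)
        gcongr
    _ = _ := by rw [mul_pow]; field_simp; ring

theorem borelCoeff_zero (hF : GevreyHalfPlane U σ₀ C M F g) {σ : ℝ} (hσ : σ₀ < σ)
    (n : ℕ) {x : ℂ} (hx : x ∈ U) : borelCoeff σ F g n x 0 = g (n + 1) x := by
  rw [borelCoeff, (hF.quadDecay_two n hx).invLaplace_of_nonpos hF.pos.le hσ le_rfl, add_zero]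

theorem differentiableOn_borelCoeff (hF : GevreyHalfPlane U σ₀ C M F g) {σ : ℝ} (hσ : σ₀ < σ)
    (n : ℕ) (u : ℝ) : DifferentiableOn ℂ (fun x => borelCoeff σ F g n x u) U := by
  have hσ0 := hF.pos.trans hσ
  refine (hF.diff_coeff (n + 1)).add (DifferentiableOn.const_mul ?_ _)
  have hre : ∀ y : ℝ, σ₀ < (σ + y * Complex.I : ℂ).re := fun y => by rwa [vertical_re]
  refine differentiableOn_integral_of_dominated hF.isOpen (fun x hx =>
    ((hF.quadDecay_two n hx).continuous_integrand hσ u).aestronglyMeasurable)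
    (Eventually.of_forall fun y => ?_) (fun x hx => ⟨U, hF.isOpen.mem_nhds hx, _,
      (integrable_inv_sq_add_sq hσ0).const_mul _, Eventually.of_forall fun y z hz =>
        (hF.quadDecay_two n hz).norm_le hσ u y⟩)
  refine DifferentiableOn.const_mul (DifferentiableOn.const_mul (DifferentiableOn.sub ?_ ?_) _) _
  · exact hF.diff.comp (f := fun z => (z, (σ + y * Complex.I : ℂ))) (by fun_prop)
      fun z hz => ⟨hz, hre y⟩
  · exact DifferentiableOn.fun_sum fun k _ => (hF.diff_coeff k).mul_const _

end GevreyHalfPlane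

/-- The open neighbourhood of radius `ρ` of the half line. -/
def halfLineTube (ρ : ℝ) : Set ℂ := {ξ | ∃ u : ℝ, 0 ≤ u ∧ ‖ξ - u‖ < ρ}

namespace GevreyHalfPlane

variable {U : Set ℂ} {σ₀ C M : ℝ} {F : ℂ → ℂ → ℂ} {g : ℕ → ℂ → ℂ}

/-- Near the half line the Borel transform is the sum of the Taylor series at every close enough
point of the half line. -/
theorem borelFun_eq (hF : GevreyHalfPlane U σ₀ C M F g) {σ : ℝ} (hσ : σ₀ < σ) {x : ℂ} (hx : x ∈ U)
    {ξ : ℂ} {u : ℝ} (hu : 0 ≤ u) (hξ : ‖ξ - u‖ < 1 / (8 * M)) :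
    borelFun σ F g x ξ = taylorSum (fun n => borelCoeff σ F g n x) u (ξ - u) := by
  have hM := hF.pos_rate
  have hC := hF.pos_const
  have hσ0 := hF.pos.trans hσ
  have h1 : ∀ v : ℝ, ‖ξ - v‖ ≤ ‖ξ - u‖ → ‖ξ - v‖ * (4 * M) ≤ 1 / 2 := fun v hv => by
    rw [lt_div_iff₀ (by positivity)] at hξ
    nlinarith
  exact taylorSum_sub_eq (R := 4 * M) (by positivity) hσ0.le (by positivity)
    (fun n v hv => hF.hasDerivWithinAt_borelCoeff hσ n hx hv)
    (fun n v hv => hF.norm_borelCoeff_le hσ n hx hv) (le_max_right _ _) hu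
    (h1 _ (norm_sub_max_re_le hu)) (h1 _ le_rfl)

theorem norm_borelTerm_le (hF : GevreyHalfPlane U σ₀ C M F g) {σ : ℝ} (hσ : σ₀ < σ) {x : ℂ}
    (hx : x ∈ U) {w : ℂ} {u : ℝ} (hu : 0 ≤ u) (hw : ‖w‖ < 1 / (8 * M)) (n : ℕ) :
    ‖borelCoeff σ F g n x u * w ^ n / n.factorial‖ ≤
      2 * C * (M + M ^ 2 / (2 * σ)) * Real.exp (σ * u) * (1 / 2) ^ n := by
  have hM := hF.pos_rate
  have hC := hF.pos_const
  have hσ0 := hF.pos.trans hσ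
  refine norm_taylor_term_le (R := 4 * M) (by positivity) (by positivity)
    (hF.norm_borelCoeff_le hσ n hx hu) ?_
  rw [lt_div_iff₀ (by positivity)] at hw
  nlinarith

theorem norm_borelFun_le (hF : GevreyHalfPlane U σ₀ C M F g) {σ : ℝ} (hσ : σ₀ < σ) {x : ℂ}
    (hx : x ∈ U) {ξ : ℂ} (hξ : ξ ∈ halfLineTube (1 / (8 * M))) :
    ‖borelFun σ F g x ξ‖ ≤ 4 * C * (M + M ^ 2 / (2 * σ)) * Real.exp (σ * ‖ξ‖) := by
  have hM := hF.pos_rate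
  have hC := hF.pos_const
  have hσ0 := hF.pos.trans hσ
  obtain ⟨u, hu, hξu⟩ := hξ
  have h1 : ‖ξ - (max ξ.re 0 : ℝ)‖ < 1 / (8 * M) := (norm_sub_max_re_le hu).trans_lt hξu
  have h2 : max ξ.re 0 ≤ ‖ξ‖ := max_le (Complex.re_le_norm ξ) (norm_nonneg _)
  refine (tsum_of_norm_bounded (hasSum_geometric_two.mul_left _)
    fun n => hF.norm_borelTerm_le hσ hx (le_max_right ξ.re 0) h1 n).trans ?_
  have h3 : Real.exp (σ * max ξ.re 0) ≤ Real.exp (σ * ‖ξ‖) := by gcongr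
  calc _ ≤ 2 * C * (M + M ^ 2 / (2 * σ)) * Real.exp (σ * ‖ξ‖) * 2 := by gcongr
    _ = _ := by ring

theorem tendstoUniformlyOn_borelFun (hF : GevreyHalfPlane U σ₀ C M F g) {σ : ℝ} (hσ : σ₀ < σ)
    {u : ℝ} (hu : 0 ≤ u) : TendstoUniformlyOn (fun (N : ℕ) (p : ℂ × ℂ) =>
      ∑ n ∈ Finset.range N, borelCoeff σ F g n p.1 u * (p.2 - u) ^ n / n.factorial)
      (fun p => borelFun σ F g p.1 p.2) atTop (U ×ˢ Metric.ball (u : ℂ) (1 / (8 * M))) := by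
  refine (tendstoUniformlyOn_tsum_nat (f := fun (n : ℕ) (p : ℂ × ℂ) =>
    borelCoeff σ F g n p.1 u * (p.2 - u) ^ n / n.factorial)
    ((summable_geometric_two).mul_left (2 * C * (M + M ^ 2 / (2 * σ)) * Real.exp (σ * u)))
    fun n p hp => ?_).congr_right ?_
  · exact hF.norm_borelTerm_le hσ hp.1 hu (by simpa [dist_eq_norm] using hp.2) n
  · intro p hp
    exact (hF.borelFun_eq hσ hp.1 hu (by simpa [dist_eq_norm] using hp.2)).symm

theorem differentiableOn_borelFun (hF : GevreyHalfPlane U σ₀ C M F g) {σ : ℝ} (hσ : σ₀ < σ) :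
    DifferentiableOn ℂ (fun p : ℂ × ℂ => borelFun σ F g p.1 p.2)
      (U ×ˢ halfLineTube (1 / (8 * M))) := by
  rintro ⟨x, ξ⟩ ⟨hx, u, hu, hξ⟩
  have hopen := hF.isOpen.prod (Metric.isOpen_ball (x := (u : ℂ)) (ε := 1 / (8 * M)))
  have hmem : (x, ξ) ∈ U ×ˢ Metric.ball (u : ℂ) (1 / (8 * M)) :=
    ⟨hx, by simpa [dist_eq_norm] using hξ⟩
  have hterm : ∀ n : ℕ, DifferentiableOn ℂ (fun p : ℂ × ℂ =>
      borelCoeff σ F g n p.1 u * (p.2 - u) ^ n / n.factorial)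
      (U ×ˢ Metric.ball (u : ℂ) (1 / (8 * M))) := fun n => by
    have h1 : DifferentiableOn ℂ (fun p : ℂ × ℂ => borelCoeff σ F g n p.1 u)
        (U ×ˢ Metric.ball (u : ℂ) (1 / (8 * M))) :=
      (hF.differentiableOn_borelCoeff hσ n u).comp (f := fun p : ℂ × ℂ => p.1)
        (by fun_prop) fun p hp => hp.1
    have h2 : DifferentiableOn ℂ (fun p : ℂ × ℂ => (p.2 - u) ^ n)
        (U ×ˢ Metric.ball (u : ℂ) (1 / (8 * M))) := by fun_prop
    simp_rw [div_eq_mul_inv]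
    exact (h1.mul h2).mul_const _
  have h := differentiableOn_prod_of_tendstoLocallyUniformlyOn hopen
    (Eventually.of_forall fun N => DifferentiableOn.fun_sum fun n _ => hterm n)
    (hF.tendstoUniformlyOn_borelFun hσ hu).tendstoLocallyUniformlyOn
  exact (h.differentiableAt (hopen.mem_nhds hmem)).differentiableWithinAt

theorem borelFun_ofReal (hF : GevreyHalfPlane U σ₀ C M F g) {σ : ℝ} (hσ : σ₀ < σ) {x : ℂ}
    (hx : x ∈ U) {u : ℝ} (hu : 0 ≤ u) : borelFun σ F g x u = borelCoeff σ F g 0 x u := by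
  have hM := hF.pos_rate
  rw [hF.borelFun_eq hσ hx hu (by rw [sub_self, norm_zero]; positivity), sub_self, taylorSum,
    tsum_eq_single 0 fun n hn => by rw [zero_pow hn, mul_zero, zero_div]]
  simp

theorem eq_add_shiftRem (x : ℂ) (s : ℂ) :
    F x s = g 0 x + (g 1 x * s⁻¹ + shiftRem F g 2 0 x s) := by
  simp [shiftRem, Finset.sum_range_succ]
  ring

theorem norm_laplaceIntegrand_le (hF : GevreyHalfPlane U σ₀ C M F g) {σ : ℝ} (hσ : σ₀ < σ) {x : ℂ}
    (hx : x ∈ U) {s : ℂ} (hs : σ + 1 ≤ s.re) {u : ℝ} (hu : 0 ≤ u) :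
    ‖Complex.exp (-u * s) * borelFun σ F g x u‖ ≤
      2 * C * (M + M ^ 2 / (2 * σ)) * Real.exp (-1 * u) := by
  have hM := hF.pos_rate
  have hC := hF.pos_const
  have hσ0 := hF.pos.trans hσ
  rw [hF.borelFun_ofReal hσ hx hu, norm_mul, Complex.norm_exp, ← Complex.ofReal_neg,
    Complex.re_ofReal_mul]
  have h1 := hF.norm_borelCoeff_le hσ 0 hx hu
  rw [pow_zero, mul_one, Nat.factorial_zero, Nat.cast_one, mul_one] at h1
  calc _ ≤ Real.exp (-u * s.re) * (2 * C * (M + M ^ 2 / (2 * σ)) * Real.exp (σ * u)) := by gcongr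
    _ = 2 * C * (M + M ^ 2 / (2 * σ)) * Real.exp (-u * s.re + σ * u) := by
        rw [Real.exp_add]; ring
    _ ≤ _ := by gcongr; nlinarith

/-- `F` is its leading term plus the Laplace transform of its Borel transform. -/
theorem laplace_borelFun (hF : GevreyHalfPlane U σ₀ C M F g) {σ : ℝ} (hσ : σ₀ < σ) {x : ℂ}
    (hx : x ∈ U) {s : ℂ} (hs : σ < s.re) :
    IntegrableOn (fun u : ℝ => Complex.exp (-u * s) * borelFun σ F g x u) (Ioi 0) ∧
    F x s = g 0 x + ∫ u in Ioi (0 : ℝ), Complex.exp (-u * s) * borelFun σ F g x u := by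
  have hσ0 := hF.pos.trans hσ
  have hQ := hF.quadDecay_two 0 hx
  have h1 : IntegrableOn (fun u : ℝ => Complex.exp (-s * u)) (Ioi 0) :=
    integrableOn_exp_mul_complex_Ioi (by simpa using hσ0.trans hs) 0
  have h2 := hQ.integrableOn_laplace hF.pos.le hσ hs
  have he : EqOn (fun u : ℝ => Complex.exp (-s * u) * g 1 x +
      Complex.exp (-u * s) * invLaplace σ u (shiftRem F g 2 0 x))
      (fun u : ℝ => Complex.exp (-u * s) * borelFun σ F g x u) (Ioi 0) := by
    intro u hu
    simp only
    rw [hF.borelFun_ofReal hσ hx (le_of_lt hu), borelCoeff, mul_add]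
    congr 3
    ring
  refine ⟨IntegrableOn.congr_fun ((h1.mul_const _).add h2) he measurableSet_Ioi, ?_⟩
  rw [← setIntegral_congr_fun measurableSet_Ioi he, integral_add (h1.mul_const _) h2,
    hQ.laplace_invLaplace hF.pos.le hσ hs, integral_mul_const,
    integral_exp_mul_complex_Ioi (by simpa using hσ0.trans hs), eq_add_shiftRem (F := F) (g := g)]
  congr 2
  have := ne_zero_of_lt_re hF.pos (hσ.trans hs)
  simp only [Complex.ofReal_zero, mul_zero, Complex.exp_zero]
  field_simp

/-- The integrals of the Laplace transform converge uniformly. -/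
theorem tendstoUniformlyOn_laplace (hF : GevreyHalfPlane U σ₀ C M F g) {σ : ℝ} (hσ : σ₀ < σ) :
    TendstoUniformlyOn (fun (R : ℝ) (p : ℂ × ℂ) =>
      ∫ u in (0 : ℝ)..R, Complex.exp (-u * p.2) * borelFun σ F g p.1 u)
      (fun p => ∫ u in Ioi (0 : ℝ), Complex.exp (-u * p.2) * borelFun σ F g p.1 u) atTop
      (U ×ˢ {s | σ + 1 ≤ s.re}) := by
  obtain ⟨b, hb⟩ : ∃ b : ℝ → ℝ, b = fun u => 2 * C * (M + M ^ 2 / (2 * σ)) * Real.exp (-1 * u) :=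
    ⟨_, rfl⟩
  have hbi : IntegrableOn b (Ioi 0) := hb ▸ (integrableOn_exp_mul_Ioi (by norm_num) 0).const_mul _
  have hlim : Tendsto (fun R : ℝ => (∫ u in Ioi 0, b u) - ∫ u in (0 : ℝ)..R, b u) atTop
      (𝓝 ((∫ u in Ioi 0, b u) - ∫ u in Ioi 0, b u)) :=
    tendsto_const_nhds.sub (intervalIntegral_tendsto_integral_Ioi 0 hbi tendsto_id)
  rw [sub_self] at hlim
  rw [Metric.tendstoUniformlyOn_iff]
  intro ε hε
  filter_upwards [hlim.eventually (gt_mem_nhds hε), eventually_ge_atTop 0] with R hR hR0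
  rintro ⟨x, s⟩ ⟨hx, hs⟩
  rw [dist_eq_norm]
  refine lt_of_le_of_lt ?_ hR
  rw [intervalIntegral.integral_of_le hR0, intervalIntegral.integral_of_le hR0]
  refine norm_setIntegral_sub_setIntegral_le Ioc_subset_Ioi_self measurableSet_Ioi measurableSet_Ioc
    (hF.laplace_borelFun hσ hx ?_).1 hbi fun u hu => ?_
  · have : σ + 1 ≤ s.re := hs
    simp only
    linarith
  · rw [hb]
    exact hF.norm_laplaceIntegrand_le hσ hx hs (le_of_lt hu)

/-- On the open half line the Borel transform is the inverse Laplace transform of `F - g 0`. -/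
theorem tendstoUniformlyOn_invLaplace (hF : GevreyHalfPlane U σ₀ C M F g) {σ : ℝ} (hσ : σ₀ < σ)
    {τ : ℝ} (hτ : σ₀ < τ) {u : ℝ} (hu : 0 < u) :
    TendstoUniformlyOn (fun (T : ℝ) (x : ℂ) => (2 * Real.pi : ℂ)⁻¹ * ∫ y : ℝ in (-T)..T,
      Complex.exp (u * (τ + y * Complex.I)) * (F x (τ + y * Complex.I) - g 0 x))
      (fun x => borelFun σ F g x u) atTop U := by
  have hτ0 := hF.pos.trans hτ
  have hC := hF.pos_const
  have hM := hF.pos_rate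
  have hre : ∀ y : ℝ, σ₀ < (τ + y * Complex.I : ℂ).re := fun y => by rwa [vertical_re]
  obtain ⟨b, hb⟩ : ∃ b : ℝ → ℝ, b = fun y => Real.exp (u * τ) * (C * M ^ (0 + 2) *
    (0 + 2).factorial) * (τ ^ 2 + y ^ 2)⁻¹ := ⟨_, rfl⟩
  have hbi : Integrable b := hb ▸ (integrable_inv_sq_add_sq hτ0).const_mul _
  have hlim : Tendsto (fun T : ℝ => ‖(2 * Real.pi : ℂ)⁻¹‖ * ((∫ y, b y) - ∫ y in (-T)..T, b y))
      atTop (𝓝 (‖(2 * Real.pi : ℂ)⁻¹‖ * ((∫ y, b y) - ∫ y, b y))) :=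
    (tendsto_const_nhds.sub
      (intervalIntegral_tendsto_integral hbi tendsto_neg_atTop_atBot tendsto_id)).const_mul _
  rw [sub_self, mul_zero] at hlim
  obtain ⟨E, hE⟩ : ∃ E : ℝ → ℂ, E = fun T => (2 * Real.pi : ℂ)⁻¹ * ∫ y : ℝ in (-T)..T,
      Complex.exp (u * (τ + y * Complex.I)) / (τ + y * Complex.I) := ⟨_, rfl⟩
  have hElim : Tendsto (fun T => C * M ^ 1 * Nat.factorial 1 * ‖1 - E T‖) atTop
      (𝓝 (C * M ^ 1 * Nat.factorial 1 * ‖(1 : ℂ) - 1‖)) := by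
    rw [hE]
    exact ((tendsto_integral_exp_div hτ0 hu).const_sub 1).norm.const_mul _
  rw [sub_self, norm_zero, mul_zero] at hElim
  have hsum := hElim.add hlim
  rw [add_zero] at hsum
  rw [Metric.tendstoUniformlyOn_iff]
  intro ε hε
  filter_upwards [hsum.eventually (gt_mem_nhds hε), eventually_ge_atTop 0] with T hT hT0 x hx
  have hQ := hF.quadDecay_two 0 hx
  rw [dist_eq_norm, hF.borelFun_ofReal hσ hx hu.le, borelCoeff, hQ.invLaplace_eq hF.pos.le hσ hτ]
  have hsplit : ∫ y : ℝ in (-T)..T,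
      Complex.exp (u * (τ + y * Complex.I)) * (F x (τ + y * Complex.I) - g 0 x) =
      g 1 x * (∫ y : ℝ in (-T)..T,
        Complex.exp (u * (τ + y * Complex.I)) / (τ + y * Complex.I)) +
      ∫ y : ℝ in (-T)..T, Complex.exp (u * (τ + y * Complex.I)) *
        shiftRem F g 2 0 x (τ + y * Complex.I) := by
    rw [← intervalIntegral.integral_const_mul, ← intervalIntegral.integral_add]
    · refine intervalIntegral.integral_congr fun y _ => ?_
      rw [eq_add_shiftRem (F := F) (g := g)]
      ring
    · refine Continuous.intervalIntegrable (Continuous.mul continuous_const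
        (Continuous.div (by fun_prop) (by fun_prop) fun y => ne_zero_of_lt_re hF.pos (hre y))) _ _
    · exact (hQ.continuous_integrand hτ u).intervalIntegrable _ _
  rw [hsplit, invLaplace, mul_add, mul_left_comm]
  refine lt_of_le_of_lt ?_ hT
  have hrew : ∀ p q r s w : ℂ, p + w * q - (p * r + w * s) = p * (1 - r) + w * (q - s) := by
    intros; ring
  rw [hE, zero_add, hrew]
  refine (norm_add_le _ _).trans (add_le_add ?_ ?_)
  · rw [norm_mul]
    gcongr
    exact hF.bound_coeff 1 x hx
  · rw [norm_mul]
    gcongr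
    have hle : -T ≤ T := by linarith
    rw [intervalIntegral.integral_of_le hle, intervalIntegral.integral_of_le hle,
      ← setIntegral_univ, ← setIntegral_univ (f := b)]
    refine norm_setIntegral_sub_setIntegral_le (subset_univ _) MeasurableSet.univ measurableSet_Ioc
      (hQ.integrable hF.pos.le hτ u).integrableOn hbi.integrableOn fun y _ => ?_
    rw [hb]
    exact hQ.norm_le hτ u y

end GevreyHalfPlane

/-! ### Borel summability from uniform Gevrey bounds on a Borel disc -/

theorem exp_neg_mul_exp (θ : ℝ) :
    Complex.exp (-(θ * Complex.I)) * Complex.exp (θ * Complex.I) = 1 := by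
  rw [← Complex.exp_add, neg_add_cancel, Complex.exp_zero]

theorem norm_exp_neg_mul_I (θ : ℝ) : ‖Complex.exp (-(θ * Complex.I))‖ = 1 := by
  rw [Complex.exp_neg, norm_inv, Complex.norm_exp_ofReal_mul_I, inv_one]

theorem mem_tube_iff {θ η : ℝ} {ξ : ℂ} :
    ξ ∈ tube θ η ↔ ξ * Complex.exp (-(θ * Complex.I)) ∈ halfLineTube η := by
  have key : ∀ u : ℝ, ‖ξ * Complex.exp (-(θ * Complex.I)) - u‖ =
      dist ξ (0 + (1 : ℝ) * u * Complex.exp (θ * Complex.I)) := fun u => by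
    have h : ξ * Complex.exp (-(θ * Complex.I)) - u =
        (ξ - (0 + (1 : ℝ) * u * Complex.exp (θ * Complex.I))) * Complex.exp (-(θ * Complex.I)) := by
      push_cast
      linear_combination (u : ℂ) * exp_neg_mul_exp θ
    rw [dist_eq_norm, h, norm_mul, norm_exp_neg_mul_I, mul_one]
  rw [tube, Metric.mem_thickening_iff]
  constructor
  · rintro ⟨z, ⟨u, hu, rfl⟩, hd⟩
    exact ⟨u, hu, by rwa [key]⟩
  · rintro ⟨u, hu, hd⟩
    exact ⟨_, ⟨u, hu, rfl⟩, by rwa [← key]⟩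

/-- A function with Gevrey bounds on a Borel disc, in the coordinate `s = e^{iθ} / ħ`. -/
theorem gevreyHalfPlane_of_hasGevreyBounds {θ d : ℝ} {U : Set ℂ} {f : ℂ → ℂ → ℂ}
    {fhat : ℕ → ℂ → ℂ} (hU : IsOpen U) (hd : 0 < d) (hf : HolomorphicOn₂ f U (borelDisc θ d))
    (hfhat : ∀ k, DifferentiableOn ℂ (fhat k) U)
    (hG : HasGevreyBounds (borelDisc θ d) U (fun _ => 1) f fhat) (hu : IsUniformlyGevrey U fhat) :
    ∃ C M : ℝ, GevreyHalfPlane U (1 / d) C M (fun x s => f x (Complex.exp (θ * Complex.I) / s))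
      fun k x => fhat k x * Complex.exp (θ * Complex.I) ^ k := by
  obtain ⟨C₁, hC₁, M₁, hM₁, h1⟩ := hG
  obtain ⟨C₂, hC₂, M₂, hM₂, h2⟩ := hu
  have hC : 0 < max C₁ C₂ := lt_max_of_lt_left hC₁
  have hM : 0 < max M₁ M₂ := lt_max_of_lt_left hM₁
  have hd' : 0 < 1 / d := by positivity
  refine ⟨max C₁ C₂, max M₁ M₂, hU, hd', hC, hM, ?_, fun k => (hfhat k).mul_const _, ?_, ?_⟩
  · refine hf.comp (f := fun p : ℂ × ℂ => (p.1, Complex.exp (θ * Complex.I) / p.2)) ?_ ?_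
    · simp_rw [div_eq_mul_inv]
      refine differentiableOn_fst.prodMk (DifferentiableOn.const_mul
        (differentiableOn_inv.comp differentiableOn_snd fun p hp => ?_) _)
      exact ne_zero_of_lt_re hd' hp.2
    · exact fun p hp => ⟨hp.1, div_mem_borelDisc_iff.2 hp.2⟩
  · intro n x hx s hs
    have h3 := h1 n x hx _ (div_mem_borelDisc_iff.2 hs)
    rw [one_mul, norm_div, Complex.norm_exp_ofReal_mul_I, one_div] at h3
    have e : remainder f fhat n x (Complex.exp (θ * Complex.I) / s) =
        f x (Complex.exp (θ * Complex.I) / s) - ∑ k ∈ Finset.range n,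
          fhat k x * Complex.exp (θ * Complex.I) ^ k * s⁻¹ ^ k := by
      rw [remainder]
      congr 1
      refine Finset.sum_congr rfl fun k _ => ?_
      rw [div_eq_mul_inv, mul_pow, mul_assoc]
    rw [← e]
    refine h3.trans ?_
    gcongr
    · exact le_max_left _ _
    · exact le_max_left _ _
  · intro k x hx
    rw [norm_mul, norm_pow, Complex.norm_exp_ofReal_mul_I, one_pow, mul_one]
    refine (h2 k x hx).trans ?_
    gcongr
    · exact le_max_right _ _
    · exact le_max_right _ _

/-- Nevanlinna's theorem: uniform Gevrey bounds on a Borel disc imply Borel summability and the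
representation as a Laplace transform, on every Borel disc of small enough diameter. -/
theorem exists_isBorelResummation {θ d : ℝ} {U : Set ℂ} {f : ℂ → ℂ → ℂ}
    {fhat : ℕ → ℂ → ℂ} (hU : IsOpen U) (hd : 0 < d) (hf : HolomorphicOn₂ f U (borelDisc θ d))
    (hfhat : ∀ k, DifferentiableOn ℂ (fhat k) U)
    (hG : HasGevreyBounds (borelDisc θ d) U (fun _ => 1) f fhat) (hu : IsUniformlyGevrey U fhat) :
    ∃ d₁ > 0, ∀ d₀, 0 < d₀ → d₀ ≤ d₁ → ∃ η > 0, ∃ φ : ℂ → ℂ → ℂ,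
      IsBorelResummation θ η U (borelDisc θ d₀) fhat φ f ∧
      ∀ δ ∈ Ioo 0 d₀, ∀ u : ℝ, 0 < u → TendstoUniformlyOn
        (fun (T : ℝ) (x : ℂ) => truncatedBorel θ δ T
          (fun h => f x h - fhat 0 x) (u * Complex.exp (θ * Complex.I)))
        (fun x => φ x (u * Complex.exp (θ * Complex.I))) atTop U := by
  obtain ⟨C, M, hF⟩ := gevreyHalfPlane_of_hasGevreyBounds hU hd hf hfhat hG hu
  obtain ⟨e, he⟩ : ∃ e, e = Complex.exp (θ * Complex.I) := ⟨_, rfl⟩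
  obtain ⟨e', he'⟩ : ∃ e', e' = Complex.exp (-(θ * Complex.I)) := ⟨_, rfl⟩
  have hee : e' * e = 1 := by rw [he, he', exp_neg_mul_exp]
  have hne' : ‖e'‖ = 1 := by rw [he', norm_exp_neg_mul_I]
  have hne : e ≠ 0 := by rw [he]; exact Complex.exp_ne_zero _
  rw [← he] at hF ⊢
  obtain ⟨F, hFdef⟩ : ∃ F : ℂ → ℂ → ℂ, F = fun x s => f x (e / s) := ⟨_, rfl⟩
  obtain ⟨g, hgdef⟩ : ∃ g : ℕ → ℂ → ℂ, g = fun k x => fhat k x * e ^ k := ⟨_, rfl⟩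
  rw [← hFdef, ← hgdef] at hF
  have hg0 : ∀ x, g 0 x = fhat 0 x := fun x => by rw [hgdef]; simp
  have hM := hF.pos_rate
  have hC := hF.pos_const
  obtain ⟨σ, hσdef⟩ : ∃ σ, σ = 1 / d + 1 := ⟨_, rfl⟩
  have hσ : 1 / d < σ := by rw [hσdef]; linarith
  have hσ0 := hF.pos.trans hσ
  refine ⟨1 / (σ + 1), by positivity, fun d₀ hd₀ hd₀' => ⟨1 / (8 * M), by positivity,
    fun x ξ => e' * borelFun σ F g x (ξ * e'), ?_, ?_⟩⟩
  · have hs : ∀ h ∈ borelDisc θ d₀, σ + 1 ≤ (e / h).re := fun h hh => by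
      have h1 : 1 / d₀ < (Complex.exp (θ * Complex.I) / h).re := hh
      rw [← he] at h1
      refine le_trans ?_ h1.le
      rw [le_div_iff₀ hd₀]
      rw [le_div_iff₀ (by positivity)] at hd₀'
      linarith
    have hlap : ∀ x h, laplaceIntegrand θ (fun ξ => e' * borelFun σ F g x (ξ * e')) h =
        fun u : ℝ => Complex.exp (-u * (e / h)) * borelFun σ F g x u := by
      intro x h
      ext u
      rw [laplaceIntegrand, ← he, mul_assoc (u : ℂ), mul_comm e e', hee, mul_one]
      rw [mul_assoc, mul_right_comm e', hee, one_mul]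
      congr 2
      ring
    have hFf : ∀ x, ∀ h ∈ borelDisc θ d₀, F x (e / h) = f x h := fun x h hh => by
      have := ne_zero_of_mem_borelDisc hd₀ hh
      rw [hFdef]
      simp only
      rw [div_div_cancel₀ hne]
    refine ⟨⟨?_, ?_, ?_⟩, ?_, ?_, ?_⟩
    · refine DifferentiableOn.const_mul ((hF.differentiableOn_borelFun hσ).comp
        (f := fun p : ℂ × ℂ => (p.1, p.2 * e')) (by fun_prop) ?_) _
      intro p hp
      refine ⟨hp.1, ?_⟩
      have := mem_tube_iff.1 hp.2
      rwa [← he'] at this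
    · refine ⟨1 / (8 * M), by positivity, le_rfl, ?_⟩
      have h1 := ((hF.tendstoUniformlyOn_borelFun hσ le_rfl).comp
        (fun p : ℂ × ℂ => (p.1, p.2 * e'))).mono (s' := U ×ˢ Metric.ball 0 (1 / (8 * M)))
        fun p hp => ⟨hp.1, by
          have := hp.2
          simpa [hne'] using this⟩
      refine ((uniformContinuous_const_smul e').comp_tendstoUniformlyOn h1).congr
        (Eventually.of_forall fun N p hp => ?_)
      simp only [Function.comp_apply, smul_eq_mul, Complex.ofReal_zero, sub_zero, Finset.mul_sum]
      refine Finset.sum_congr rfl fun n _ => ?_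
      have hpow : e' ^ (n + 1) * e ^ (n + 1) = 1 := by rw [← mul_pow, hee, one_pow]
      rw [hF.borelCoeff_zero hσ n hp.1, formalBorel, hgdef]
      simp only
      linear_combination (fhat (n + 1) p.1 * p.2 ^ n / n.factorial) * hpow
    · refine ⟨4 * C * (M + M ^ 2 / (2 * σ)), by positivity, σ, hσ0, fun x hx ξ hξ => ?_⟩
      rw [mem_tube_iff, ← he'] at hξ
      have := hF.norm_borelFun_le hσ hx hξ
      rw [norm_mul, hne', one_mul]
      rwa [norm_mul, hne', mul_one] at this
    · intro x hx h hh
      rw [hlap]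
      exact (hF.laplace_borelFun hσ hx (by linarith [hs h hh])).1
    · simp_rw [laplace, hlap]
      exact ((hF.tendstoUniformlyOn_laplace hσ).comp (fun p : ℂ × ℂ => (p.1, e / p.2))).mono
        fun p hp => ⟨hp.1, hs p.2 hp.2⟩
    · intro x hx h hh
      rw [laplace, hlap, ← hFf x h hh, ← hg0]
      exact (hF.laplace_borelFun hσ hx (by linarith [hs h hh])).2
  · intro δ hδ u hu
    have hδ0 := hδ.1
    have hd1 : δ < 1 / (σ + 1) := hδ.2.trans_le hd₀'
    have hδ1 : 1 / d < 1 / δ := by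
      rw [lt_div_iff₀ (by positivity)] at hd1
      rw [lt_div_iff₀ hδ0]
      rw [hσdef] at hd1
      linarith
    have h1 := hF.tendstoUniformlyOn_invLaplace hσ hδ1 hu
    have hval : ∀ x, (e' * borelFun σ F g x (u * e * e') : ℂ) = e' • borelFun σ F g x u := by
      intro x
      rw [mul_assoc, mul_comm e e', hee, mul_one, smul_eq_mul]
    simp_rw [hval]
    refine ((uniformContinuous_const_smul e').comp_tendstoUniformlyOn h1).congr
      (Eventually.of_forall fun T x hx => ?_)
    have hs0 : ∀ t : ℝ, (((1 / δ : ℝ) : ℂ) + t * Complex.I) ≠ 0 := fun t =>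
      ne_zero_of_lt_re hF.pos (by rwa [vertical_re])
    have hpath : borelPath θ δ = fun t : ℝ => e / (((1 / δ : ℝ) : ℂ) + t * Complex.I) := by
      ext t; rw [borelPath, he]
    have hder : ∀ t : ℝ, deriv (borelPath θ δ) t / borelPath θ δ t ^ 2 = -Complex.I * e' := by
      intro t
      have h2 : HasDerivAt (fun t : ℝ => (((1 / δ : ℝ) : ℂ) + t * Complex.I)) (1 * Complex.I) t :=
        ((Complex.ofRealCLM.hasDerivAt (x := t)).mul_const Complex.I).const_add _
      have h3 := (hasDerivAt_const t e).fun_div h2 (hs0 t)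
      have h4 := hs0 t
      rw [hpath, h3.deriv]
      rw [show e' = e⁻¹ from eq_inv_of_mul_eq_one_left hee]
      field_simp
      ring
    simp only [Function.comp_apply, smul_eq_mul]
    rw [truncatedBorel, intervalIntegral.integral_symm (-T) T]
    simp_rw [hder]
    have hint : ∀ t : ℝ, (f x (borelPath θ δ t) - fhat 0 x) *
        Complex.exp (u * e / borelPath θ δ t) * (-Complex.I * e') =
        (-Complex.I * e') * (Complex.exp (u * (((1 / δ : ℝ) : ℂ) + t * Complex.I)) *
          (F x (((1 / δ : ℝ) : ℂ) + t * Complex.I) - g 0 x)) := by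
      intro t
      rw [hpath, hg0, hFdef]
      simp only
      rw [mul_div_assoc, div_div_cancel₀ hne]
      ring
    simp_rw [hint]
    rw [intervalIntegral.integral_const_mul, mul_inv (2 * Real.pi : ℂ)]
    generalize (∫ t : ℝ in (-T)..T, Complex.exp (u * (((1 / δ : ℝ) : ℂ) + t * Complex.I)) *
      (F x (((1 / δ : ℝ) : ℂ) + t * Complex.I) - g 0 x)) = Q
    rw [Complex.inv_I]
    linear_combination (e' * (2 * Real.pi : ℂ)⁻¹ * Q) * Complex.I_sq

/-! ### A singularly perturbed Riccati equation on a domain invariant under positive translations -/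

/-- `Ω` is invariant under positive translations, and the positive function `w` grows at most
exponentially along them. -/
structure TranslationWeight (Ω : Set ℂ) (K : ℝ) (w : ℂ → ℝ) : Prop where
  isOpen : IsOpen Ω
  add_mem : ∀ ζ ∈ Ω, ∀ u : ℝ, 0 ≤ u → ζ + u ∈ Ω
  pos_const : 0 < K
  pos : ∀ ζ ∈ Ω, 0 < w ζ
  continuousOn : ContinuousOn w Ω
  growth : ∀ ζ ∈ Ω, ∀ u : ℝ, 0 ≤ u → w (ζ + u) ≤ Real.exp (K * u) * w ζ

/-- The Laplace integral of `G` along the positive translations. -/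
noncomputable def translationLaplace (G : ℂ × ℂ → ℂ) (P : ℂ × ℂ) : ℂ :=
  ∫ u in Ioi (0 : ℝ), Complex.exp (-(P.2 * u)) * G (P.1 + u, P.2)

namespace TranslationWeight

variable {Ω : Set ℂ} {K σ A : ℝ} {w : ℂ → ℝ} {G : ℂ × ℂ → ℂ}

theorem continuousOn_integrand (hw : TranslationWeight Ω K w)
    (hG : ContinuousOn G (Ω ×ˢ {s | σ < s.re})) {P : ℂ × ℂ} (hP : P ∈ Ω ×ˢ {s : ℂ | σ < s.re}) :
    ContinuousOn (fun u : ℝ => Complex.exp (-(P.2 * u)) * G (P.1 + u, P.2)) (Ici 0) :=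
  ContinuousOn.mul (by fun_prop) (hG.comp (f := fun u : ℝ => (P.1 + (u : ℂ), P.2)) (by fun_prop)
    fun u hu => ⟨hw.add_mem _ hP.1 u hu, hP.2⟩)

theorem norm_integrand_le (hw : TranslationWeight Ω K w) (hA : 0 ≤ A)
    (hb : ∀ P ∈ Ω ×ˢ {s : ℂ | σ < s.re}, ‖G P‖ ≤ A * w P.1) {P : ℂ × ℂ}
    (hP : P ∈ Ω ×ˢ {s : ℂ | σ < s.re}) {u : ℝ} (hu : 0 ≤ u) :
    ‖Complex.exp (-(P.2 * u)) * G (P.1 + u, P.2)‖ ≤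
      A * w P.1 * Real.exp (-(P.2.re - K) * u) := by
  have h1 : (P.1 + u, P.2) ∈ Ω ×ˢ {s : ℂ | σ < s.re} := ⟨hw.add_mem _ hP.1 u hu, hP.2⟩
  rw [norm_mul, Complex.norm_exp]
  calc _ ≤ Real.exp (-(P.2 * u)).re * (A * (Real.exp (K * u) * w P.1)) := by
        gcongr
        exact (hb _ h1).trans (mul_le_mul_of_nonneg_left (hw.growth _ hP.1 u hu) hA)
    _ = A * w P.1 * (Real.exp (-(P.2 * u)).re * Real.exp (K * u)) := by ring
    _ = _ := by
        rw [← Real.exp_add, Complex.neg_re, Complex.re_mul_ofReal]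
        congr 2
        ring

theorem integrableOn_integrand (hw : TranslationWeight Ω K w) (hA : 0 ≤ A) (hσ : K < σ)
    (hG : ContinuousOn G (Ω ×ˢ {s | σ < s.re}))
    (hb : ∀ P ∈ Ω ×ˢ {s : ℂ | σ < s.re}, ‖G P‖ ≤ A * w P.1) {P : ℂ × ℂ}
    (hP : P ∈ Ω ×ˢ {s : ℂ | σ < s.re}) :
    IntegrableOn (fun u : ℝ => Complex.exp (-(P.2 * u)) * G (P.1 + u, P.2)) (Ioi 0) := by
  have hs : σ < P.2.re := hP.2
  exact ((integrableOn_exp_mul_Ioi (a := -(P.2.re - K)) (by linarith) 0).const_mul _).mono'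
    (((hw.continuousOn_integrand hG hP).mono Ioi_subset_Ici_self).aestronglyMeasurable
      measurableSet_Ioi)
    (ae_restrict_of_forall_mem measurableSet_Ioi fun u hu => hw.norm_integrand_le hA hb hP
      (le_of_lt hu))

/-- The Laplace integral gains the factor `(σ - K)⁻¹`. -/
theorem norm_translationLaplace_le (hw : TranslationWeight Ω K w) (hA : 0 ≤ A) (hσ : K < σ)
    (hb : ∀ P ∈ Ω ×ˢ {s : ℂ | σ < s.re}, ‖G P‖ ≤ A * w P.1) {P : ℂ × ℂ}
    (hP : P ∈ Ω ×ˢ {s : ℂ | σ < s.re}) :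
    ‖translationLaplace G P‖ ≤ A / (σ - K) * w P.1 := by
  have hs : σ < P.2.re := hP.2
  have hwP := hw.pos _ hP.1
  have h1 : IntegrableOn (fun u : ℝ => Real.exp (-(P.2.re - K) * u)) (Ioi 0) :=
    integrableOn_exp_mul_Ioi (by linarith) 0
  refine (norm_integral_le_of_norm_le (h1.const_mul (A * w P.1))
    (ae_restrict_of_forall_mem measurableSet_Ioi fun u hu => hw.norm_integrand_le hA hb hP
      (le_of_lt hu))).trans ?_
  rw [integral_const_mul, integral_exp_mul_Ioi (by linarith)]
  simp only [mul_zero, Real.exp_zero, neg_div_neg_eq]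
  rw [mul_one_div, div_mul_eq_mul_div]
  have : 0 < σ - K := by linarith
  gcongr

theorem differentiableOn_translationLaplace (hw : TranslationWeight Ω K w) (hA : 0 ≤ A) (hσ : K < σ)
    (hG : DifferentiableOn ℂ G (Ω ×ˢ {s | σ < s.re}))
    (hb : ∀ P ∈ Ω ×ˢ {s : ℂ | σ < s.re}, ‖G P‖ ≤ A * w P.1) :
    DifferentiableOn ℂ (translationLaplace G) (Ω ×ˢ {s | σ < s.re}) := by
  have hopen : IsOpen (Ω ×ˢ {s : ℂ | σ < s.re}) :=
    hw.isOpen.prod (isOpen_lt continuous_const Complex.continuous_re)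
  refine differentiableOn_prod_integral_of_dominated hopen
    (fun P hP => ((hw.continuousOn_integrand hG.continuousOn hP).mono
      Ioi_subset_Ici_self).aestronglyMeasurable measurableSet_Ioi)
    (ae_restrict_of_forall_mem measurableSet_Ioi fun u hu => ?_) fun P₀ hP₀ => ?_
  · refine DifferentiableOn.mul (by fun_prop) (hG.comp
      (f := fun P : ℂ × ℂ => (P.1 + (u : ℂ), P.2)) (by fun_prop)
      fun P hP => ⟨hw.add_mem _ hP.1 u (le_of_lt hu), hP.2⟩)
  · refine ⟨{P | P ∈ Ω ×ˢ {s : ℂ | σ < s.re} ∧ w P.1 < w P₀.1 + 1}, ?_,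
      fun u => A * (w P₀.1 + 1) * Real.exp (-(σ - K) * u),
      (integrableOn_exp_mul_Ioi (a := -(σ - K)) (by linarith) 0).const_mul _,
      ae_restrict_of_forall_mem measurableSet_Ioi fun u hu P hP => ?_⟩
    · refine inter_mem (hopen.mem_nhds hP₀) ?_
      have hc : ContinuousAt (fun P : ℂ × ℂ => w P.1) P₀ :=
        ContinuousAt.comp (hw.continuousOn.continuousAt (hw.isOpen.mem_nhds hP₀.1)) continuousAt_fst
      exact hc.eventually (gt_mem_nhds (lt_add_one _))
    · have hs : σ < P.2.re := hP.1.2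
      have hu' : (0 : ℝ) < u := hu
      refine (hw.norm_integrand_le hA hb hP.1 hu'.le).trans ?_
      have h2 : w P.1 ≤ w P₀.1 + 1 := le_of_lt hP.2
      have h3 := hw.pos _ hP.1.1
      have h4 : -(P.2.re - K) * u ≤ -(σ - K) * u := by nlinarith
      exact mul_le_mul (mul_le_mul_of_nonneg_left h2 hA) (Real.exp_le_exp.2 h4) (Real.exp_nonneg _)
        (mul_nonneg hA (h3.le.trans h2))

/-- The Laplace integral solves the linear equation `∂Z = s Z - G`. -/
theorem hasDerivAt_translationLaplace (hw : TranslationWeight Ω K w) (hA : 0 ≤ A) (hσ : K < σ)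
    (hG : DifferentiableOn ℂ G (Ω ×ˢ {s | σ < s.re}))
    (hb : ∀ P ∈ Ω ×ˢ {s : ℂ | σ < s.re}, ‖G P‖ ≤ A * w P.1) {ζ s : ℂ} (hζ : ζ ∈ Ω)
    (hs : σ < s.re) :
    HasDerivAt (fun ζ => translationLaplace G (ζ, s)) (s * translationLaplace G (ζ, s) - G (ζ, s))
      ζ := by
  have hdiff : DifferentiableAt ℂ (fun ζ => translationLaplace G (ζ, s)) ζ :=
    (((hw.differentiableOn_translationLaplace hA hσ hG hb).comp
      (f := fun ζ : ℂ => (ζ, s)) (s := Ω) (by fun_prop) fun z hz => ⟨hz, hs⟩).differentiableAt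
        (hw.isOpen.mem_nhds hζ))
  obtain ⟨E, hE⟩ : ∃ E : ℝ → ℂ, E = fun v : ℝ => Complex.exp (-(s * v)) * G (ζ + v, s) := ⟨_, rfl⟩
  have hP : (ζ, s) ∈ Ω ×ˢ {s : ℂ | σ < s.re} := ⟨hζ, hs⟩
  have hEc : ContinuousOn E (Ici 0) := by
    have h := hw.continuousOn_integrand hG.continuousOn hP
    rw [hE]; exact h
  have hEi : IntegrableOn E (Ioi 0) := by
    have h := hw.integrableOn_integrand hA hσ hG.continuousOn hb hP
    rw [hE]; exact h
  -- shifting the variable of integration reduces the derivative to that of a primitive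
  have hshift : ∀ t : ℝ, 0 ≤ t → translationLaplace G (ζ + t, s) =
      Complex.exp (s * t) * (translationLaplace G (ζ, s) - ∫ v in (0 : ℝ)..t, E v) := by
    intro t ht
    have h1 : translationLaplace G (ζ, s) = ∫ v in Ioi 0, E v := by rw [hE]; rfl
    rw [h1, ← intervalIntegral.integral_Ioi_sub_Ioi hEi ht, sub_sub_cancel]
    have h2 := (measurePreserving_add_right volume t).setIntegral_preimage_emb
      (MeasurableEquiv.addRight t).measurableEmbedding E (Ioi t)
    rw [show (fun x : ℝ => x + t) ⁻¹' Ioi t = Ioi 0 by ext; simp] at h2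
    rw [← h2, ← integral_const_mul, translationLaplace]
    refine setIntegral_congr_fun measurableSet_Ioi fun u _ => ?_
    rw [hE]
    simp only
    rw [← mul_assoc, ← Complex.exp_add]
    push_cast
    rw [add_assoc, add_comm (t : ℂ) u]
    congr 2
    ring
  have h3 : HasDerivWithinAt (fun t : ℝ => ∫ v in (0 : ℝ)..t, E v) (E 0) (Ici 0) 0 :=
    intervalIntegral.integral_hasDerivWithinAt_right (by simp)
      ((hEc.mono Ioi_subset_Ici_self).stronglyMeasurableAtFilter_nhdsWithin measurableSet_Ioi 0)
      ((hEc 0 self_mem_Ici).mono Ioi_subset_Ici_self)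
  have h4 : HasDerivAt (fun t : ℝ => Complex.exp (s * t)) (Complex.exp (s * (0 : ℝ)) * (s * 1)) 0 :=
    ((Complex.ofRealCLM.hasDerivAt (x := (0 : ℝ))).const_mul s).cexp
  have h5 := (h4.hasDerivWithinAt (s := Ici 0)).mul (h3.const_sub (translationLaplace G (ζ, s)))
  have h6 : HasDerivWithinAt (fun t : ℝ => translationLaplace G (ζ + t, s))
      (s * translationLaplace G (ζ, s) - G (ζ, s)) (Ici 0) 0 := by
    refine (h5.congr (fun t ht => hshift t ht) (hshift 0 le_rfl)).congr_deriv ?_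
    rw [hE]
    simp
    ring
  have h7 : HasDerivAt (fun t : ℝ => ζ + (t : ℂ)) 1 0 :=
    (Complex.ofRealCLM.hasDerivAt (x := (0 : ℝ))).const_add ζ
  have h8 : HasDerivWithinAt (fun t : ℝ => translationLaplace G (ζ + t, s))
      (deriv (fun ζ => translationLaplace G (ζ, s)) ζ * 1) (Ici 0) 0 := by
    have h9 : HasDerivAt (fun ζ => translationLaplace G (ζ, s))
        (deriv (fun ζ => translationLaplace G (ζ, s)) ζ) (ζ + (0 : ℝ)) := by
      simpa using hdiff.hasDerivAt
    exact (h9.comp (0 : ℝ) h7).hasDerivWithinAt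
  have h10 := (uniqueDiffWithinAt_Ici (0 : ℝ)).eq_deriv _ h8 h6
  rw [mul_one] at h10
  rw [← h10]
  exact hdiff.hasDerivAt

/-- The equation `∂Y = s Y + p + q Y + r Y²` has a holomorphic solution that is small with respect
to the weight, for `Re s` large: a fixed point of a contraction. -/
theorem exists_riccati_solution (hw : TranslationWeight Ω K w) {p q r : ℂ × ℂ → ℂ}
    {ε : ℝ} (hε : 0 < ε) (hε' : ε ≤ 1 / 2) (hσ : K + 3 * K / ε ≤ σ)
    (hp : DifferentiableOn ℂ p (Ω ×ˢ {s | σ < s.re}))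
    (hq : DifferentiableOn ℂ q (Ω ×ˢ {s | σ < s.re}))
    (hr : DifferentiableOn ℂ r (Ω ×ˢ {s | σ < s.re}))
    (hpb : ∀ P ∈ Ω ×ˢ {s : ℂ | σ < s.re}, ‖p P‖ ≤ K * w P.1)
    (hqb : ∀ P ∈ Ω ×ˢ {s : ℂ | σ < s.re}, ‖q P‖ ≤ K)
    (hrb : ∀ P ∈ Ω ×ˢ {s : ℂ | σ < s.re}, ‖r P‖ * w P.1 ≤ K) :
    ∃ Y : ℂ × ℂ → ℂ, DifferentiableOn ℂ Y (Ω ×ˢ {s | σ < s.re}) ∧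
      (∀ P ∈ Ω ×ˢ {s : ℂ | σ < s.re}, ‖Y P‖ ≤ ε * w P.1) ∧
      ∀ ζ ∈ Ω, ∀ s : ℂ, σ < s.re → HasDerivAt (fun ζ => Y (ζ, s))
        (s * Y (ζ, s) + (p (ζ, s) + q (ζ, s) * Y (ζ, s) + r (ζ, s) * Y (ζ, s) ^ 2)) ζ := by
  have hK := hw.pos_const
  have hσK : K < σ := lt_of_lt_of_le (by linarith [show 0 < 3 * K / ε by positivity]) hσ
  have hfac : 3 * K / (σ - K) ≤ ε := by
    rw [div_le_iff₀ (by linarith)]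
    have h1 : 3 * K / ε ≤ σ - K := by linarith
    rw [div_le_iff₀ hε] at h1
    linarith
  obtain ⟨D, hD⟩ : ∃ D, D = Ω ×ˢ {s : ℂ | σ < s.re} := ⟨_, rfl⟩
  have hDopen : IsOpen D :=
    hD ▸ hw.isOpen.prod (isOpen_lt continuous_const Complex.continuous_re)
  rw [← hD] at hp hq hr hpb hqb hrb ⊢
  have hwD : ∀ P ∈ D, 0 < w P.1 := fun P hP => by rw [hD] at hP; exact hw.pos _ hP.1
  obtain ⟨N, hN⟩ : ∃ N : (ℂ × ℂ → ℂ) → ℂ × ℂ → ℂ, N = fun Y P => p P + q P * Y P + r P * Y P ^ 2 :=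
    ⟨_, rfl⟩
  have hNd : ∀ Y, DifferentiableOn ℂ Y D → DifferentiableOn ℂ (N Y) D := fun Y hY => by
    rw [hN]; exact (hp.add (hq.mul hY)).add (hr.mul (hY.pow 2))
  have hNb : ∀ Y, (∀ P ∈ D, ‖Y P‖ ≤ w P.1) → ∀ P ∈ D, ‖N Y P‖ ≤ 3 * K * w P.1 := by
    intro Y hY P hP
    have h0 := hwD P hP
    have h1 : ‖q P‖ * ‖Y P‖ ≤ K * w P.1 := mul_le_mul (hqb P hP) (hY P hP) (norm_nonneg _) hK.le
    have h2 : ‖r P‖ * ‖Y P‖ ^ 2 ≤ K * w P.1 := by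
      calc _ ≤ ‖r P‖ * w P.1 ^ 2 := by gcongr; exact hY P hP
        _ = (‖r P‖ * w P.1) * w P.1 := by ring
        _ ≤ _ := by gcongr; exact hrb P hP
    rw [hN]
    refine (norm_add₃_le).trans ?_
    rw [norm_mul, norm_mul, norm_pow]
    linarith [hpb P hP]
  have hNdiff : ∀ Y Z, (∀ P ∈ D, ‖Y P‖ ≤ w P.1) → (∀ P ∈ D, ‖Z P‖ ≤ w P.1) → ∀ P ∈ D,
      ‖N Y P - N Z P‖ ≤ 3 * K * ‖Y P - Z P‖ := by
    intro Y Z hY hZ P hP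
    have h0 := hwD P hP
    have e : N Y P - N Z P = (q P + r P * (Y P + Z P)) * (Y P - Z P) := by rw [hN]; ring
    rw [e, norm_mul]
    gcongr
    refine (norm_add_le _ _).trans ?_
    rw [norm_mul]
    have h1 : ‖r P‖ * ‖Y P + Z P‖ ≤ 2 * K := by
      calc _ ≤ ‖r P‖ * (w P.1 + w P.1) := by
            gcongr; exact (norm_add_le _ _).trans (add_le_add (hY P hP) (hZ P hP))
        _ = 2 * (‖r P‖ * w P.1) := by ring
        _ ≤ _ := by gcongr; exact hrb P hP
    linarith [hqb P hP]
  obtain ⟨T, hT⟩ : ∃ T : (ℂ × ℂ → ℂ) → ℂ × ℂ → ℂ, T = fun Y P => -translationLaplace (N Y) P :=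
    ⟨_, rfl⟩
  have hTd : ∀ Y, DifferentiableOn ℂ Y D → (∀ P ∈ D, ‖Y P‖ ≤ w P.1) →
      DifferentiableOn ℂ (T Y) D := by
    intro Y hY hYb
    have h1 := hNd Y hY
    have h2 := hNb Y hYb
    rw [hD] at h1 h2 ⊢
    rw [hT]
    exact (hw.differentiableOn_translationLaplace (by positivity) hσK h1 h2).neg
  have hTb : ∀ Y, (∀ P ∈ D, ‖Y P‖ ≤ w P.1) → ∀ P ∈ D, ‖T Y P‖ ≤ ε * w P.1 := by
    intro Y hYb P hP
    have h0 := hwD P hP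
    have h2 := hNb Y hYb
    rw [hD] at hP h2
    rw [hT]
    simp only [norm_neg]
    refine (hw.norm_translationLaplace_le (by positivity) hσK h2 hP).trans ?_
    gcongr
  have hTdiff : ∀ Y Z, DifferentiableOn ℂ Y D → DifferentiableOn ℂ Z D →
      (∀ P ∈ D, ‖Y P‖ ≤ w P.1) → (∀ P ∈ D, ‖Z P‖ ≤ w P.1) → ∀ a, 0 ≤ a →
      (∀ P ∈ D, ‖Y P - Z P‖ ≤ a * w P.1) → ∀ P ∈ D, ‖T Y P - T Z P‖ ≤ ε * a * w P.1 := by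
    intro Y Z hYd hZd hY hZ a ha hYZ P hP
    have h0 := hwD P hP
    have h1 := hNd Y hYd
    have h1' := hNd Z hZd
    have h2 := hNb Y hY
    have h2' := hNb Z hZ
    have h3 : ∀ Q ∈ D, ‖N Y Q - N Z Q‖ ≤ 3 * K * a * w Q.1 := fun Q hQ => by
      refine (hNdiff Y Z hY hZ Q hQ).trans ?_
      rw [mul_assoc (3 * K)]
      gcongr
      exact hYZ Q hQ
    rw [hD] at h1 h1' h2 h2' h3 hP
    have h4 : translationLaplace (N Y) P - translationLaplace (N Z) P =
        translationLaplace (fun Q => N Y Q - N Z Q) P := by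
      rw [translationLaplace, translationLaplace, ← integral_sub
        (hw.integrableOn_integrand (by positivity) hσK h1.continuousOn h2 hP)
        (hw.integrableOn_integrand (by positivity) hσK h1'.continuousOn h2' hP)]
      simp only [translationLaplace, mul_sub]
    rw [hT]
    simp only
    rw [neg_sub_neg, ← norm_neg, neg_sub, h4]
    refine (hw.norm_translationLaplace_le (by positivity) hσK h3 hP).trans ?_
    rw [mul_div_right_comm]
    gcongr
  -- the Picard iterates
  obtain ⟨y, hy0, hysucc⟩ : ∃ y : ℕ → ℂ × ℂ → ℂ, y 0 = (fun _ => 0) ∧ ∀ n, y (n + 1) = T (y n) :=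
    ⟨fun n => T^[n] fun _ => 0, rfl, fun n => Function.iterate_succ_apply' _ _ _⟩
  have hyb : ∀ n, DifferentiableOn ℂ (y n) D ∧ ∀ P ∈ D, ‖y n P‖ ≤ w P.1 := by
    intro n
    induction n with
    | zero =>
      rw [hy0]
      exact ⟨differentiableOn_const _, fun P hP => by rw [norm_zero]; exact (hwD P hP).le⟩
    | succ n ih =>
      rw [hysucc]
      refine ⟨hTd _ ih.1 ih.2, fun P hP => (hTb _ ih.2 P hP).trans ?_⟩
      nlinarith [hwD P hP]
  have hydiff : ∀ n, ∀ P ∈ D, ‖y (n + 1) P - y n P‖ ≤ ε ^ n * w P.1 := by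
    intro n
    induction n with
    | zero =>
      intro P hP
      rw [hy0, sub_zero, pow_zero, one_mul]
      exact (hyb 1).2 P hP
    | succ n ih =>
      intro P hP
      rw [hysucc (n + 1), hysucc n, pow_succ']
      rw [hysucc n] at ih
      have h1 := hyb (n + 1)
      rw [hysucc n] at h1
      exact hTdiff _ _ h1.1 (hyb n).1 h1.2 (hyb n).2 _ (by positivity) ih P hP
  have hε1 : ε < 1 := by linarith
  obtain ⟨Y, hYdef⟩ : ∃ Y : ℂ × ℂ → ℂ, Y = fun P => limUnder atTop fun n => y n P := ⟨_, rfl⟩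
  have hlim : ∀ P ∈ D, Tendsto (fun n => y n P) atTop (𝓝 (Y P)) := by
    intro P hP
    rw [hYdef]
    refine (cauchySeq_of_le_geometric ε (w P.1) hε1 fun n => ?_).tendsto_limUnder
    rw [dist_comm, dist_eq_norm, mul_comm]
    exact hydiff n P hP
  have hrate : ∀ n, ∀ P ∈ D, ‖y n P - Y P‖ ≤ ε ^ n * (2 * w P.1) := by
    intro n P hP
    have h1 := dist_le_of_le_geometric_of_tendsto ε (w P.1) hε1 (f := fun n => y n P)
      (fun n => by rw [dist_comm, dist_eq_norm, mul_comm]; exact hydiff n P hP) (hlim P hP) n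
    rw [dist_eq_norm] at h1
    refine h1.trans ?_
    have h0 := hwD P hP
    rw [div_le_iff₀ (by linarith)]
    have : 0 < w P.1 * ε ^ n := by positivity
    nlinarith
  have hloc : TendstoLocallyUniformlyOn y Y atTop D := by
    rw [Metric.tendstoLocallyUniformlyOn_iff]
    intro δ hδ P₀ hP₀
    have hc : ContinuousAt (fun P : ℂ × ℂ => w P.1) P₀ := by
      rw [hD] at hP₀
      exact ContinuousAt.comp (hw.continuousOn.continuousAt (hw.isOpen.mem_nhds hP₀.1))
        continuousAt_fst
    refine ⟨D ∩ {P | w P.1 < w P₀.1 + 1}, inter_mem self_mem_nhdsWithin (mem_nhdsWithin_of_mem_nhds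
      (hc.eventually (gt_mem_nhds (lt_add_one _)))), ?_⟩
    have h1 : Tendsto (fun n : ℕ => ε ^ n * (2 * (w P₀.1 + 1))) atTop
        (𝓝 (0 * (2 * (w P₀.1 + 1)))) :=
      (tendsto_pow_atTop_nhds_zero_of_lt_one hε.le hε1).mul_const _
    rw [zero_mul] at h1
    filter_upwards [h1.eventually (gt_mem_nhds hδ)] with n hn P hP
    rw [dist_comm, dist_eq_norm]
    refine ((hrate n P hP.1).trans ?_).trans_lt hn
    have := hP.2
    have h0 := hwD P hP.1
    gcongr
    exact le_of_lt this
  have hYd : DifferentiableOn ℂ Y D := differentiableOn_prod_of_tendstoLocallyUniformlyOn hDopen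
    (Eventually.of_forall fun n => (hyb n).1) hloc
  have hYw : ∀ P ∈ D, ‖Y P‖ ≤ w P.1 := fun P hP =>
    le_of_tendsto (hlim P hP).norm (Eventually.of_forall fun n => (hyb n).2 P hP)
  have hfix : ∀ P ∈ D, Y P = T Y P := by
    intro P hP
    have h1 : Tendsto (fun n => y (n + 1) P) atTop (𝓝 (T Y P)) := by
      rw [tendsto_iff_norm_sub_tendsto_zero]
      have h2 : Tendsto (fun n : ℕ => ε * (ε ^ n * 2) * w P.1) atTop (𝓝 (ε * (0 * 2) * w P.1)) :=
        (((tendsto_pow_atTop_nhds_zero_of_lt_one hε.le hε1).mul_const _).const_mul _).mul_const _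
      rw [zero_mul, mul_zero, zero_mul] at h2
      refine squeeze_zero (fun n => norm_nonneg _) (fun n => ?_) h2
      rw [hysucc]
      exact hTdiff _ _ (hyb n).1 hYd (hyb n).2 hYw _ (by positivity)
        (fun Q hQ => (hrate n Q hQ).trans_eq (by ring)) P hP
    exact tendsto_nhds_unique ((hlim P hP).comp (tendsto_add_atTop_nat 1)) h1
  refine ⟨Y, hYd, fun P hP => ?_, fun ζ hζ s hs => ?_⟩
  · rw [hfix P hP]
    exact hTb Y hYw P hP
  · have h1 := hNd Y hYd
    have h2 := hNb Y hYw
    rw [hD] at h1 h2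
    have h3 := (hw.hasDerivAt_translationLaplace (by positivity) hσK h1 h2 hζ hs).neg
    have h4 : (fun ζ => Y (ζ, s)) =ᶠ[𝓝 ζ] fun ζ => -translationLaplace (N Y) (ζ, s) := by
      filter_upwards [hw.isOpen.mem_nhds hζ] with z hz
      rw [hfix (z, s) (by rw [hD]; exact ⟨hz, hs⟩), hT]
    refine (h3.congr_of_eventuallyEq h4).congr_deriv ?_
    have h5 : Y (ζ, s) = -translationLaplace (N Y) (ζ, s) := h4.self_of_nhds
    have h6 : N Y (ζ, s) = p (ζ, s) + q (ζ, s) * Y (ζ, s) + r (ζ, s) * Y (ζ, s) ^ 2 := by rw [hN]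
    rw [← h6, h5]
    ring

end TranslationWeight

/-! ### The transformation to standard form: pointwise estimates

At a point, let `A f² + B f + C` be the leading-order right-hand side, normalised to discriminant
`1`, and `φ` the root with `2 A φ + B = α`. The substitution `f = φ + y / (1 - κ y)`, with
`κ = α A`, sends `y = 0` and `y = ∞` to the two roots. -/

/-- Values and derivatives at a point of the leading-order coefficients and of the chosen root,
with bounds; there is no bound for `φ`. -/
structure RootJet (K : ℝ) (α A B C φ A' B' C' φ' : ℂ) : Prop where
  one_le : 1 ≤ K
  sq_eq : α ^ 2 = 1
  root : A * φ ^ 2 + B * φ + C = 0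
  label : 2 * A * φ + B = α
  deriv_disc : B * B' = 2 * (A' * C + A * C')
  deriv_root : α * φ' = -(A' * φ ^ 2 + B' * φ + C')
  norm_A : ‖A‖ ≤ K
  norm_B : ‖B‖ ≤ K
  norm_C : ‖C‖ ≤ K
  norm_A' : ‖A'‖ ≤ K
  norm_B' : ‖B'‖ ≤ K
  norm_C' : ‖C'‖ ≤ K

namespace RootJet

variable {K : ℝ} {α A B C φ A' B' C' φ' : ℂ}

theorem norm_alpha (J : RootJet K α A B C φ A' B' C' φ') : ‖α‖ = 1 := by
  have h := congrArg norm J.sq_eq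
  rw [norm_pow, norm_one] at h
  exact (pow_eq_one_iff_of_nonneg (norm_nonneg _) two_ne_zero).1 h

theorem norm_kappa (J : RootJet K α A B C φ A' B' C' φ') : ‖α * A‖ ≤ K := by
  rw [norm_mul, J.norm_alpha, one_mul]; exact J.norm_A

theorem one_sub_eq (J : RootJet K α A B C φ A' B' C' φ') :
    1 - α * A * φ = (1 + α * B) / 2 := by
  linear_combination (-α / 2) * J.label - 1 / 2 * J.sq_eq

theorem kappa_mul_eq (J : RootJet K α A B C φ A' B' C' φ') :
    α * A * φ = (1 - α * B) / 2 := by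
  linear_combination (α / 2) * J.label + 1 / 2 * J.sq_eq

theorem one_sub_mul_eq (J : RootJet K α A B C φ A' B' C' φ') :
    (1 - α * A * φ) * φ = -(α * C) := by
  linear_combination (-α * φ) * J.label + α * J.root - φ * J.sq_eq

theorem norm_alpha_mul_B (J : RootJet K α A B C φ A' B' C' φ') : ‖α * B‖ ≤ K := by
  rw [norm_mul, J.norm_alpha, one_mul]; exact J.norm_B

theorem norm_one_sub (J : RootJet K α A B C φ A' B' C' φ') : ‖1 - α * A * φ‖ ≤ K := by
  rw [J.one_sub_eq, norm_div, Complex.norm_ofNat, div_le_iff₀ two_pos]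
  have := norm_add_le 1 (α * B)
  rw [norm_one] at this
  linarith [J.norm_alpha_mul_B, J.one_le]

theorem norm_kappa_mul (J : RootJet K α A B C φ A' B' C' φ') : ‖α * A * φ‖ ≤ K := by
  rw [J.kappa_mul_eq, norm_div, Complex.norm_ofNat, div_le_iff₀ two_pos]
  have := norm_sub_le 1 (α * B)
  rw [norm_one] at this
  linarith [J.norm_alpha_mul_B, J.one_le]

theorem norm_one_sub_mul (J : RootJet K α A B C φ A' B' C' φ') :
    ‖(1 - α * A * φ) * φ‖ ≤ K := by
  rw [J.one_sub_mul_eq, norm_neg, norm_mul, J.norm_alpha, one_mul]; exact J.norm_C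

/-- A quadratic polynomial with bounded coefficients, relative to the weight `1 + |φ|²`. -/
theorem norm_quadratic_le {a b c : ℂ} (ha : ‖a‖ ≤ K) (hb : ‖b‖ ≤ K) (hc : ‖c‖ ≤ K) (φ : ℂ) :
    ‖a * φ ^ 2 + b * φ + c‖ ≤ 3 * K * (1 + ‖φ‖ ^ 2) := by
  have hK := (norm_nonneg a).trans ha
  refine norm_add₃_le.trans ?_
  rw [norm_mul, norm_mul, norm_pow]
  have h1 : ‖a‖ * ‖φ‖ ^ 2 ≤ K * ‖φ‖ ^ 2 := by gcongr
  have h2 : ‖b‖ * ‖φ‖ ≤ K * ‖φ‖ := by gcongr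
  have h3 : K * ‖φ‖ ≤ K * (1 + ‖φ‖ ^ 2) := by
    gcongr; nlinarith [sq_nonneg (‖φ‖ - 1)]
  nlinarith [mul_nonneg hK (sq_nonneg ‖φ‖)]

theorem norm_deriv_root (J : RootJet K α A B C φ A' B' C' φ') :
    ‖φ'‖ ≤ 3 * K * (1 + ‖φ‖ ^ 2) := by
  have h := congrArg norm J.deriv_root
  rw [norm_mul, J.norm_alpha, one_mul, norm_neg] at h
  rw [h]
  exact norm_quadratic_le J.norm_A' J.norm_B' J.norm_C' φ

/-- Both `1 - κ φ` and `κ` are `O ((1 + |φ|²) ^ (-1 / 2))`, since their products with `φ` are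
bounded. -/
theorem norm_reduced_le (J : RootJet K α A B C φ A' B' C' φ') {a b c : ℂ} (ha : ‖a‖ ≤ K)
    (hb : ‖b‖ ≤ K) (hc : ‖c‖ ≤ K) :
    ‖a * (1 - α * A * φ) ^ 2 - b * (1 - α * A * φ) * (α * A) + c * (α * A) ^ 2‖ * (1 + ‖φ‖ ^ 2) ≤
      6 * K ^ 3 := by
  have hK : 0 ≤ K := zero_le_one.trans J.one_le
  obtain ⟨m, hm⟩ : ∃ m, m = 1 - α * A * φ := ⟨_, rfl⟩
  obtain ⟨k, hk⟩ : ∃ k, k = α * A := ⟨_, rfl⟩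
  have h1 : ‖m‖ ≤ K := hm ▸ J.norm_one_sub
  have h2 : ‖k‖ ≤ K := hk ▸ J.norm_kappa
  have h3 : ‖m‖ * ‖φ‖ ≤ K := by rw [← norm_mul, hm]; exact J.norm_one_sub_mul
  have h4 : ‖k‖ * ‖φ‖ ≤ K := by rw [← norm_mul, hk]; exact J.norm_kappa_mul
  rw [← hm, ← hk]
  have h5 : ‖a * m ^ 2 - b * m * k + c * k ^ 2‖ ≤ K * ‖m‖ ^ 2 + K * (‖m‖ * ‖k‖) + K * ‖k‖ ^ 2 := by
    refine (norm_add_le _ _).trans (add_le_add ((norm_sub_le _ _).trans (add_le_add ?_ ?_)) ?_)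
    · rw [norm_mul, norm_pow]; gcongr
    · rw [norm_mul, norm_mul, mul_assoc]; gcongr
    · rw [norm_mul, norm_pow]; gcongr
  have e1 : ‖m‖ ^ 2 * (1 + ‖φ‖ ^ 2) ≤ 2 * K ^ 2 := by
    calc _ = ‖m‖ ^ 2 + (‖m‖ * ‖φ‖) ^ 2 := by ring
      _ ≤ K ^ 2 + K ^ 2 := by gcongr
      _ = _ := by ring
  have e2 : ‖k‖ ^ 2 * (1 + ‖φ‖ ^ 2) ≤ 2 * K ^ 2 := by
    calc _ = ‖k‖ ^ 2 + (‖k‖ * ‖φ‖) ^ 2 := by ring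
      _ ≤ K ^ 2 + K ^ 2 := by gcongr
      _ = _ := by ring
  have e3 : ‖m‖ * ‖k‖ * (1 + ‖φ‖ ^ 2) ≤ 2 * K ^ 2 := by
    calc _ = ‖m‖ * ‖k‖ + (‖m‖ * ‖φ‖) * (‖k‖ * ‖φ‖) := by ring
      _ ≤ K * K + K * K := by gcongr
      _ = _ := by ring
  calc _ ≤ (K * ‖m‖ ^ 2 + K * (‖m‖ * ‖k‖) + K * ‖k‖ ^ 2) * (1 + ‖φ‖ ^ 2) := by gcongr
    _ = K * (‖m‖ ^ 2 * (1 + ‖φ‖ ^ 2)) + K * (‖m‖ * ‖k‖ * (1 + ‖φ‖ ^ 2)) +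
        K * (‖k‖ ^ 2 * (1 + ‖φ‖ ^ 2)) := by ring
    _ ≤ K * (2 * K ^ 2) + K * (2 * K ^ 2) + K * (2 * K ^ 2) := by gcongr
    _ = _ := by ring

/-- The derivatives in the quadratic term of the transformed equation combine to the expression
estimated in `norm_reduced_le`. -/
theorem deriv_kappa_eq (J : RootJet K α A B C φ A' B' C' φ') :
    (α * A) ^ 2 * φ' + α * A' = α * A' * (1 - α * A * φ) ^ 2 -
      α * B' * (1 - α * A * φ) * (α * A) + α * C' * (α * A) ^ 2 := by
  linear_combination (α * A ^ 2) * J.deriv_root -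
    (α * A ^ 2 * (A' * φ ^ 2 + B' * φ + C')) * J.sq_eq -
    (α * (2 * A * A' * φ + A * B')) * J.label + (2 * α * A * A') * J.root +
    (α * A) * J.deriv_disc

/-- The logarithmic derivative of the weight is bounded. -/
theorem norm_logDeriv_le (J : RootJet K α A B C φ A' B' C' φ') :
    ‖φ'‖ * ‖starRingEnd ℂ φ * (1 - α * A * φ) - α * A‖ ≤ 6 * K ^ 2 * (1 + ‖φ‖ ^ 2) := by
  have hK : 0 ≤ K := zero_le_one.trans J.one_le
  have h1 : ‖starRingEnd ℂ φ * (1 - α * A * φ) - α * A‖ ≤ 2 * K := by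
    refine (norm_sub_le _ _).trans ?_
    have h2 := J.norm_one_sub_mul
    rw [norm_mul, mul_comm] at h2
    rw [norm_mul, RCLike.norm_conj]
    linarith [J.norm_kappa]
  calc _ ≤ (3 * K * (1 + ‖φ‖ ^ 2)) * (2 * K) := by
        gcongr; exact J.norm_deriv_root
    _ = _ := by ring

/-- The inhomogeneous term of the transformed equation is bounded by the weight `1 + |φ|²`. -/
theorem norm_constant_le (J : RootJet K α A B C φ A' B' C' φ') {a b c : ℂ} (ha : ‖a‖ ≤ K)
    (hb : ‖b‖ ≤ K) (hc : ‖c‖ ≤ K) :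
    ‖a * φ ^ 2 + b * φ + c - φ'‖ ≤ 12 * K ^ 3 * (1 + ‖φ‖ ^ 2) := by
  have h1 := J.one_le
  calc _ ≤ 3 * K * (1 + ‖φ‖ ^ 2) + 3 * K * (1 + ‖φ‖ ^ 2) :=
        (norm_sub_le _ _).trans (add_le_add (norm_quadratic_le ha hb hc φ) J.norm_deriv_root)
    _ = 6 * K * (1 + ‖φ‖ ^ 2) := by ring
    _ ≤ _ := by
        gcongr
        · norm_num
        · exact le_self_pow₀ h1 three_ne_zero

/-- The linear term of the transformed equation is bounded, apart from the summand `2 κ φ'` that the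
gauge factor removes. -/
theorem norm_linear_le (J : RootJet K α A B C φ A' B' C' φ') {a b c : ℂ} (ha : ‖a‖ ≤ K)
    (hb : ‖b‖ ≤ K) (hc : ‖c‖ ≤ K) :
    ‖2 * a * ((1 - α * A * φ) * φ) + b * ((1 - α * A * φ) - α * A * φ) - 2 * c * (α * A)‖ ≤
      12 * K ^ 3 := by
  have h1 := J.one_le
  have hK : 0 ≤ K := zero_le_one.trans J.one_le
  have e1 : ‖2 * a * ((1 - α * A * φ) * φ)‖ ≤ 2 * K * K := by
    rw [norm_mul, norm_mul, Complex.norm_ofNat]; gcongr; exact J.norm_one_sub_mul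
  have e2 : ‖b * ((1 - α * A * φ) - α * A * φ)‖ ≤ K * (K + K) := by
    rw [norm_mul]; gcongr
    exact (norm_sub_le _ _).trans (add_le_add J.norm_one_sub J.norm_kappa_mul)
  have e3 : ‖2 * c * (α * A)‖ ≤ 2 * K * K := by
    rw [norm_mul, norm_mul, Complex.norm_ofNat]; gcongr; exact J.norm_kappa
  refine (norm_sub_le _ _).trans ((add_le_add ((norm_add_le _ _).trans (add_le_add e1 e2)) e3).trans
    ?_)
  nlinarith [mul_nonneg hK hK, mul_nonneg (mul_nonneg hK hK) (sub_nonneg.2 h1)]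

/-- The quadratic term of the transformed equation is bounded by the inverse of the weight. -/
theorem norm_quadraticTerm_le (J : RootJet K α A B C φ A' B' C' φ') {a b c : ℂ} (ha : ‖a‖ ≤ K)
    (hb : ‖b‖ ≤ K) (hc : ‖c‖ ≤ K) :
    ‖a * (1 - α * A * φ) ^ 2 - b * (1 - α * A * φ) * (α * A) + c * (α * A) ^ 2 -
      ((α * A) ^ 2 * φ' + α * A')‖ * (1 + ‖φ‖ ^ 2) ≤ 12 * K ^ 3 := by
  have h : ∀ x, ‖α * x‖ = ‖x‖ := fun x => by rw [norm_mul, J.norm_alpha, one_mul]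
  have h1 := J.norm_reduced_le ha hb hc
  have h2 := J.norm_reduced_le (a := α * A') (b := α * B') (c := α * C')
    (by rw [h]; exact J.norm_A') (by rw [h]; exact J.norm_B') (by rw [h]; exact J.norm_C')
  rw [← J.deriv_kappa_eq] at h2
  calc _ ≤ (‖_‖ + ‖_‖) * (1 + ‖φ‖ ^ 2) := by gcongr; exact norm_sub_le _ _
    _ ≤ _ := by rw [add_mul]; linarith

end RootJet

/-! ### Halfstrips -/

theorem isOpen_halfstrip {θ α : ℝ} {z₁ : ℂ} {r : ℝ} : IsOpen (halfstrip θ α z₁ r) :=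
  Metric.isOpen_thickening

theorem convex_ray {θ α : ℝ} {z₁ : ℂ} : Convex ℝ (ray θ α z₁) := by
  rintro _ ⟨t, ht, rfl⟩ _ ⟨t', ht', rfl⟩ a b ha hb hab
  refine ⟨a * t + b * t', by positivity, ?_⟩
  have h : (a : ℂ) + b = 1 := by exact_mod_cast hab
  rw [Complex.real_smul, Complex.real_smul]
  push_cast
  linear_combination z₁ * h

theorem convex_halfstrip {θ α : ℝ} {z₁ : ℂ} {r : ℝ} : Convex ℝ (halfstrip θ α z₁ r) :=
  convex_ray.thickening r

theorem halfstrip_add_mem {θ α : ℝ} {z₁ : ℂ} {r : ℝ} {z : ℂ} (hz : z ∈ halfstrip θ α z₁ r) {u : ℝ}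
    (hu : 0 ≤ u) : z + α * Complex.exp (θ * Complex.I) * u ∈ halfstrip θ α z₁ r := by
  rw [halfstrip, Metric.mem_thickening_iff] at hz ⊢
  obtain ⟨_, ⟨t, ht, rfl⟩, hd⟩ := hz
  refine ⟨_, ⟨t + u, by positivity, rfl⟩, ?_⟩
  rw [dist_eq_norm] at hd ⊢
  convert hd using 2
  push_cast
  ring

theorem ball_subset_halfstrip {θ α : ℝ} {z₁ : ℂ} {r r' : ℝ} {z : ℂ}
    (hz : z ∈ halfstrip θ α z₁ r') : Metric.ball z (r - r') ⊆ halfstrip θ α z₁ r := by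
  intro x hx
  rw [halfstrip, Metric.mem_thickening_iff] at hz ⊢
  obtain ⟨y, hy, hd⟩ := hz
  have h1 := Metric.mem_ball.1 hx
  exact ⟨y, hy, by linarith [dist_triangle x z y]⟩

/-- A compact subset of an open thickening lies in a smaller thickening of the same set. -/
theorem exists_lt_subset_thickening {E K : Set ℂ} {r : ℝ} (hr : 0 < r) (hE : E.Nonempty)
    (hK : IsCompact K) (hKE : K ⊆ Metric.thickening r E) :
    ∃ r', 0 < r' ∧ r' < r ∧ K ⊆ Metric.thickening r' E := by
  have key : ∀ {ρ : ℝ} {x : ℂ}, x ∈ Metric.thickening ρ E ↔ Metric.infDist x E < ρ := by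
    intro ρ x
    rw [Metric.mem_thickening_iff, Metric.infDist_lt_iff hE]
  rcases K.eq_empty_or_nonempty with rfl | hne
  · exact ⟨r / 2, by positivity, by linarith, empty_subset _⟩
  · obtain ⟨x, hx, hmax⟩ := hK.exists_isMaxOn hne (Metric.continuous_infDist_pt E).continuousOn
    have h1 := key.1 (hKE hx)
    have h0 : 0 ≤ Metric.infDist x E := Metric.infDist_nonneg
    refine ⟨(Metric.infDist x E + r) / 2, by linarith, by linarith, fun y hy => key.2 ?_⟩
    have : Metric.infDist y E ≤ Metric.infDist x E := hmax hy
    linarith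

/-! ### The leading-order data on a halfstrip -/

/-- The normalised leading-order coefficients on a domain `H` with bounds, and the root labelled
by `α`. The root itself need not be bounded. -/
structure LeadingData (H : Set ℂ) (K : ℝ) (α : ℂ) (A B C φ : ℂ → ℂ) : Prop where
  isOpen : IsOpen H
  sq_eq : α ^ 2 = 1
  diff_A : DifferentiableOn ℂ A H
  diff_B : DifferentiableOn ℂ B H
  diff_C : DifferentiableOn ℂ C H
  diff_root : DifferentiableOn ℂ φ H
  root : ∀ z ∈ H, A z * φ z ^ 2 + B z * φ z + C z = 0
  label : ∀ z ∈ H, 2 * A z * φ z + B z = α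
  norm_A : ∀ z ∈ H, ‖A z‖ ≤ K
  norm_B : ∀ z ∈ H, ‖B z‖ ≤ K
  norm_C : ∀ z ∈ H, ‖C z‖ ≤ K

theorem LeadingData.rootJet {H : Set ℂ} {K : ℝ} {α : ℂ} {A B C φ : ℂ → ℂ}
    (hL : LeadingData H K α A B C φ) {ρ : ℝ} (hρ : 0 < ρ) {z : ℂ} (hz : Metric.ball z ρ ⊆ H)
    {K' : ℝ} (h1 : 1 ≤ K') (h2 : K ≤ K') (h3 : K / ρ ≤ K') :
    RootJet K' α (A z) (B z) (C z) (φ z) (deriv A z) (deriv B z) (deriv C z) (deriv φ z) := by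
  have hzH : z ∈ H := hz (Metric.mem_ball_self hρ)
  have hn := hL.isOpen.mem_nhds hzH
  have dA := (hL.diff_A.differentiableAt hn).hasDerivAt
  have dB := (hL.diff_B.differentiableAt hn).hasDerivAt
  have dC := (hL.diff_C.differentiableAt hn).hasDerivAt
  have dφ := (hL.diff_root.differentiableAt hn).hasDerivAt
  have hb : ∀ f : ℂ → ℂ, DifferentiableOn ℂ f H → (∀ z ∈ H, ‖f z‖ ≤ K) → ‖deriv f z‖ ≤ K' :=
    fun f hf hfb => (norm_deriv_le_of_ball hρ (hf.mono hz) fun w hw => hfb w (hz hw)).trans h3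
  refine ⟨h1, hL.sq_eq, hL.root z hzH, hL.label z hzH, ?_, ?_, (hL.norm_A z hzH).trans h2,
    (hL.norm_B z hzH).trans h2, (hL.norm_C z hzH).trans h2, hb A hL.diff_A hL.norm_A,
    hb B hL.diff_B hL.norm_B, hb C hL.diff_C hL.norm_C⟩
  · have h4 : HasDerivAt (fun z => B z ^ 2 - 4 * (A z * C z)) 0 z := by
      refine (hasDerivAt_const z (1 : ℂ)).congr_of_eventuallyEq ?_
      filter_upwards [hn] with x hx
      have e1 := hL.root x hx
      have e2 := hL.label x hx
      linear_combination (2 * A x * φ x + B x + α) * e2 - (4 * A x) * e1 + hL.sq_eq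
    have h5 := h4.unique ((dB.pow 2).sub ((dA.mul dC).const_mul 4))
    simp only [Nat.cast_ofNat, Nat.add_one_sub_one, pow_one] at h5
    linear_combination -(1 / 2) * h5
  · have h4 : HasDerivAt (fun z => A z * φ z ^ 2 + B z * φ z + C z) 0 z := by
      refine (hasDerivAt_const z (0 : ℂ)).congr_of_eventuallyEq ?_
      filter_upwards [hn] with x hx using hL.root x hx
    have h5 := h4.unique (((dA.mul (dφ.pow 2)).add (dB.mul dφ)).add dC)
    simp only [Nat.cast_ofNat, Nat.add_one_sub_one, pow_one, Pi.pow_apply] at h5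
    linear_combination -(deriv φ z) * hL.label z hzH - h5

/-- The gauge factor and its weight: with `g' = 2 κ φ'`, the function
`(1 + |φ|²) exp (-Re g)` grows at most exponentially along the strip. -/
theorem LeadingData.translationWeight {θ α r r' K K' : ℝ} {z₁ : ℂ} {A B C φ g : ℂ → ℂ}
    (hL : LeadingData (halfstrip θ α z₁ r) K α A B C φ) (hr : r' < r)
    (h1 : 1 ≤ K') (h2 : K ≤ K') (h3 : K / (r - r') ≤ K') {τ : ℂ}
    (hτ : τ = α * Complex.exp (θ * Complex.I))
    (hg : ∀ z ∈ halfstrip θ α z₁ r', HasDerivAt g (2 * (α * A z) * deriv φ z) z) :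
    TranslationWeight {ζ | τ * ζ ∈ halfstrip θ α z₁ r'} (12 * K' ^ 3)
      (fun ζ => (1 + ‖φ (τ * ζ)‖ ^ 2) * Real.exp (-(g (τ * ζ)).re)) := by
  have hρ : 0 < r - r' := by linarith
  have hJ : ∀ z ∈ halfstrip θ α z₁ r', RootJet K' α (A z) (B z) (C z) (φ z) (deriv A z) (deriv B z)
      (deriv C z) (deriv φ z) := fun z hz =>
    hL.rootJet hρ (ball_subset_halfstrip hz) h1 h2 h3
  have hsub : ∀ z ∈ halfstrip θ α z₁ r', z ∈ halfstrip θ α z₁ r := fun z hz =>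
    ball_subset_halfstrip hz (Metric.mem_ball_self hρ)
  have hopen : IsOpen {ζ | τ * ζ ∈ halfstrip θ α z₁ r'} :=
    isOpen_halfstrip.preimage (by fun_prop)
  have hadd : ∀ ζ ∈ {ζ | τ * ζ ∈ halfstrip θ α z₁ r'}, ∀ u : ℝ, 0 ≤ u →
      ζ + u ∈ {ζ | τ * ζ ∈ halfstrip θ α z₁ r'} := by
    intro ζ hζ u hu
    have := halfstrip_add_mem hζ hu
    rw [← hτ, ← mul_add] at this
    exact this
  have hτn : ‖τ‖ ≤ 1 := by
    rw [hτ, norm_mul, Complex.norm_exp_ofReal_mul_I, mul_one]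
    have := congrArg norm hL.sq_eq
    rw [norm_pow, norm_one] at this
    exact ((pow_eq_one_iff_of_nonneg (norm_nonneg _) two_ne_zero).1 this).le
  refine ⟨hopen, hadd, by positivity, fun ζ _ => by positivity, ?_, ?_⟩
  · have c1 : ContinuousOn (fun ζ => φ (τ * ζ)) {ζ | τ * ζ ∈ halfstrip θ α z₁ r'} :=
      hL.diff_root.continuousOn.comp (f := fun ζ => τ * ζ) (by fun_prop) fun ζ hζ => hsub _ hζ
    have c2 : ContinuousOn (fun ζ => g (τ * ζ)) {ζ | τ * ζ ∈ halfstrip θ α z₁ r'} :=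
      ContinuousOn.comp (t := halfstrip θ α z₁ r') (f := fun ζ => τ * ζ)
        (fun z hz => (hg z hz).continuousAt.continuousWithinAt) (by fun_prop) fun ζ hζ => hζ
    exact (continuousOn_const.add (c1.norm.pow 2)).mul
      (Real.continuous_exp.comp_continuousOn (Complex.continuous_re.comp_continuousOn c2).neg)
  · intro ζ hζ u hu
    -- mean value inequality for the logarithm of the weight
    obtain ⟨l, hl⟩ : ∃ l : ℝ → ℝ, l = fun t : ℝ =>
        Real.log (1 + ‖φ (τ * (ζ + t))‖ ^ 2) - (g (τ * (ζ + t))).re := ⟨_, rfl⟩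
    have hexp : ∀ t : ℝ, Real.exp (l t) =
        (1 + ‖φ (τ * (ζ + t))‖ ^ 2) * Real.exp (-(g (τ * (ζ + t))).re) := fun t => by
      rw [hl]
      simp only
      rw [sub_eq_add_neg, Real.exp_add, Real.exp_log (by positivity)]
    have hder : ∀ t : ℝ, 0 ≤ t → ∃ l', HasDerivAt l l' t ∧ ‖l'‖ ≤ 12 * K' ^ 3 := by
      intro t ht
      have hz := hadd ζ hζ t ht
      obtain ⟨z, hzdef⟩ : ∃ z, z = τ * (ζ + t) := ⟨_, rfl⟩
      have hz' : z ∈ halfstrip θ α z₁ r' := by rw [hzdef]; exact hz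
      have J := hJ z hz'
      have hline : HasDerivAt (fun t : ℝ => τ * (ζ + t)) (τ * 1) t :=
        ((Complex.ofRealCLM.hasDerivAt (x := t)).const_add ζ).const_mul τ
      have hφd : HasDerivAt φ (deriv φ z) (τ * (ζ + t)) := by
        rw [← hzdef]
        exact (hL.diff_root.differentiableAt (hL.isOpen.mem_nhds (hsub z hz'))).hasDerivAt
      have hgd : HasDerivAt g (2 * (α * A z) * deriv φ z) (τ * (ζ + t)) := by
        rw [← hzdef]; exact hg z hz'
      have hφt := hφd.comp t hline
      have hgt := hgd.comp t hline
      have hpos : 0 < 1 + ‖φ z‖ ^ 2 := by positivity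
      have hre : HasDerivAt (fun t : ℝ => (g (τ * (ζ + t))).re)
          (2 * (α * A z) * deriv φ z * (τ * 1)).re t :=
        Complex.reCLM.hasFDerivAt.comp_hasDerivAt t hgt
      have hlog := ((hφt.norm_sq).const_add 1).log (by
        simp only [Function.comp_apply]; positivity)
      refine ⟨_, by rw [hl]; exact hlog.sub hre, ?_⟩
      simp only [Function.comp_apply]
      rw [← hzdef, mul_one]
      have e : 2 * inner ℝ (φ z) (deriv φ z * τ) / (1 + ‖φ z‖ ^ 2) -
          (2 * (α * A z) * deriv φ z * τ).re = (2 * (deriv φ z * τ *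
            (starRingEnd ℂ (φ z) * (1 - α * A z * φ z) - α * A z))).re / (1 + ‖φ z‖ ^ 2) := by
        have hc : starRingEnd ℂ (φ z) * φ z = ((‖φ z‖ ^ 2 : ℝ) : ℂ) := by
          rw [mul_comm, Complex.mul_conj, Complex.normSq_eq_norm_sq]
        have e1 : 2 * (deriv φ z * τ * (starRingEnd ℂ (φ z) * (1 - α * A z * φ z) - α * A z)) =
            2 * (deriv φ z * τ * starRingEnd ℂ (φ z)) -
            ((1 + ‖φ z‖ ^ 2 : ℝ) : ℂ) * (2 * (α * A z) * deriv φ z * τ) := by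
          push_cast at hc ⊢
          linear_combination (-2 * deriv φ z * τ * α * A z) * hc
        rw [e1, Complex.sub_re, Complex.re_ofReal_mul, sub_div, mul_div_cancel_left₀ _ hpos.ne']
        congr 2
        rw [Complex.inner]
        simp
      rw [e, norm_div, Real.norm_of_nonneg hpos.le, div_le_iff₀ hpos]
      refine (Complex.abs_re_le_norm _).trans ?_
      rw [norm_mul, norm_mul, norm_mul, Complex.norm_ofNat]
      have h4 := J.norm_logDeriv_le
      have h5 : K' ^ 2 ≤ K' ^ 3 := pow_le_pow_right₀ h1 (by norm_num)
      calc _ ≤ 2 * (‖deriv φ z‖ * 1 * ‖starRingEnd ℂ (φ z) * (1 - α * A z * φ z) - α * A z‖) := by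
            gcongr
        _ ≤ 2 * (6 * K' ^ 2 * (1 + ‖φ z‖ ^ 2)) := by rw [mul_one]; gcongr
        _ ≤ 2 * (6 * K' ^ 3 * (1 + ‖φ z‖ ^ 2)) := by gcongr
        _ = _ := by ring
    have hmv : ‖l u - l 0‖ ≤ 12 * K' ^ 3 * ‖u - 0‖ := by
      choose! l' hl' using hder
      exact (convex_Ici (0 : ℝ)).norm_image_sub_le_of_norm_hasDerivWithin_le (f' := l')
        (fun t ht => (hl' t ht).1.hasDerivWithinAt) (fun t ht => (hl' t ht).2) self_mem_Ici hu
    rw [sub_zero, Real.norm_eq_abs, Real.norm_of_nonneg hu] at hmv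
    have h6 : l u ≤ 12 * K' ^ 3 * u + l 0 := by linarith [le_abs_self (l u - l 0)]
    have h7 := Real.exp_le_exp.2 h6
    rw [Real.exp_add, hexp, hexp] at h7
    simpa using h7

/-! ### Exact solutions on a halfstrip -/

/-- The substitution `f = φ + y / (1 - κ y)` transforms the equation for `f`
into the one for `y`. -/
theorem riccati_transform {α A B C φ A' φ' a b c h y y' : ℂ} (hα : α ^ 2 = 1)
    (hroot : A * φ ^ 2 + B * φ + C = 0) (hlabel : 2 * A * φ + B = α) (hh : h ≠ 0)
    (hy : 1 - α * A * y ≠ 0)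
    (hy' : y' = α * h⁻¹ * y + ((a * φ ^ 2 + b * φ + c - φ') +
      ((2 * a * ((1 - α * A * φ) * φ) + b * ((1 - α * A * φ) - α * A * φ) - 2 * c * (α * A)) +
        2 * (α * A) * φ') * y +
      (a * (1 - α * A * φ) ^ 2 - b * (1 - α * A * φ) * (α * A) + c * (α * A) ^ 2 -
        ((α * A) ^ 2 * φ' + α * A')) * y ^ 2)) :
    φ' + (y' * (1 - α * A * y) - y * (-(α * A' * y + α * A * y'))) / (1 - α * A * y) ^ 2 =
      h⁻¹ * ((A + h * a) * (φ + y / (1 - α * A * y)) ^ 2 +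
        (B + h * b) * (φ + y / (1 - α * A * y)) + (C + h * c)) := by
  obtain ⟨D, hD⟩ : ∃ D, D = 1 - α * A * y := ⟨_, rfl⟩
  have e1 : y' * D - y * (-(α * A' * y + α * A * y')) = y' + α * A' * y ^ 2 := by
    rw [hD]; ring
  rw [← hD] at hy ⊢
  rw [e1]
  have e2 : φ + y / D = (φ + (1 - α * A * φ) * y) / D := by
    field_simp; rw [hD]; ring
  rw [e2]
  have key : h * (φ' * D ^ 2 + y' + α * A' * y ^ 2) =
      (A + h * a) * (φ + (1 - α * A * φ) * y) ^ 2 + (B + h * b) * (φ + (1 - α * A * φ) * y) * D +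
        (C + h * c) * D ^ 2 := by
    have e3 : A * (φ + (1 - α * A * φ) * y) ^ 2 + B * (φ + (1 - α * A * φ) * y) * D + C * D ^ 2 =
        α * y := by
      have e4 : φ + (1 - α * A * φ) * y = φ * D + y := by rw [hD]; ring
      rw [e4]
      have e5 : A * (φ * D + y) ^ 2 + B * (φ * D + y) * D + C * D ^ 2 =
          (A * φ ^ 2 + B * φ + C) * D ^ 2 + (2 * A * φ + B) * D * y + A * y ^ 2 := by ring
      rw [e5, hroot, hlabel, hD]
      linear_combination (-A * y ^ 2) * hα
    have e6 : h * y' = α * y + h * ((a * φ ^ 2 + b * φ + c - φ') +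
      ((2 * a * ((1 - α * A * φ) * φ) + b * ((1 - α * A * φ) - α * A * φ) - 2 * c * (α * A)) +
        2 * (α * A) * φ') * y +
      (a * (1 - α * A * φ) ^ 2 - b * (1 - α * A * φ) * (α * A) + c * (α * A) ^ 2 -
        ((α * A) ^ 2 * φ' + α * A')) * y ^ 2) := by
      rw [hy']; field_simp
    have e7 : (A + h * a) * (φ + (1 - α * A * φ) * y) ^ 2 +
        (B + h * b) * (φ + (1 - α * A * φ) * y) * D + (C + h * c) * D ^ 2 =
        (A * (φ + (1 - α * A * φ) * y) ^ 2 + B * (φ + (1 - α * A * φ) * y) * D + C * D ^ 2) +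
        h * (a * (φ + (1 - α * A * φ) * y) ^ 2 + b * (φ + (1 - α * A * φ) * y) * D +
          c * D ^ 2) := by
      ring
    rw [e7, e3, mul_add, mul_add, e6, hD]
    ring
  field_simp
  linear_combination key

/-- For bounded normalised coefficients on a halfstrip, the equation has a holomorphic solution
close to the leading-order root, near any compact subset, on a Borel disc. -/
theorem exists_exactSolution_halfstrip {θ α r d K : ℝ} {z₁ : ℂ} {A B C : ℂ → ℂ → ℂ}
    {A₀ B₀ C₀ φ : ℂ → ℂ} (hα : α = 1 ∨ α = -1) (hr : 0 < r) (hd : 0 < d)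
    (hL : LeadingData (halfstrip θ α z₁ r) K α A₀ B₀ C₀ φ)
    (hA : HolomorphicOn₂ A (halfstrip θ α z₁ r) (borelDisc θ d))
    (hB : HolomorphicOn₂ B (halfstrip θ α z₁ r) (borelDisc θ d))
    (hC : HolomorphicOn₂ C (halfstrip θ α z₁ r) (borelDisc θ d))
    (hA₁ : ∀ z ∈ halfstrip θ α z₁ r, ∀ h ∈ borelDisc θ d, ‖A z h - A₀ z‖ ≤ K * ‖h‖)
    (hB₁ : ∀ z ∈ halfstrip θ α z₁ r, ∀ h ∈ borelDisc θ d, ‖B z h - B₀ z‖ ≤ K * ‖h‖)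
    (hC₁ : ∀ z ∈ halfstrip θ α z₁ r, ∀ h ∈ borelDisc θ d, ‖C z h - C₀ z‖ ≤ K * ‖h‖)
    {Q : Set ℂ} (hQ : IsCompact Q) (hQsub : Q ⊆ halfstrip θ α z₁ r) :
    ∃ V, IsOpen V ∧ Q ⊆ V ∧ V ⊆ halfstrip θ α z₁ r ∧ ∃ d₀ > 0, d₀ ≤ d ∧ ∃ F : ℂ → ℂ → ℂ,
      HolomorphicOn₂ F V (borelDisc θ d₀) ∧
      ∀ z ∈ V, ∀ h ∈ borelDisc θ d₀,
        HasDerivAt (fun z => F z h) (h⁻¹ * (A z h * F z h ^ 2 + B z h * F z h + C z h)) z ∧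
        ‖A₀ z * (F z h - φ z)‖ ≤ 1 / 2 ∧ ‖F z h - φ z‖ ≤ 1 := by
  have hray : (ray θ α z₁).Nonempty := ⟨_, 0, le_rfl, rfl⟩
  obtain ⟨r', hr'0, hr', hQ'⟩ := exists_lt_subset_thickening hr hray hQ hQsub
  obtain ⟨H', hH'⟩ : ∃ H', H' = halfstrip θ α z₁ r' := ⟨_, rfl⟩
  have hρ : 0 < r - r' := by linarith
  have hH'sub : H' ⊆ halfstrip θ α z₁ r := fun z hz =>
    ball_subset_halfstrip (hH' ▸ hz) (Metric.mem_ball_self hρ)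
  have hH'open : IsOpen H' := hH' ▸ isOpen_halfstrip
  obtain ⟨K', hK'⟩ : ∃ K', K' = max 1 (max K (K / (r - r'))) := ⟨_, rfl⟩
  have h1 : 1 ≤ K' := hK' ▸ le_max_left _ _
  have h2 : K ≤ K' := hK' ▸ (le_max_left _ _).trans (le_max_right _ _)
  have h3 : K / (r - r') ≤ K' := hK' ▸ (le_max_right _ _).trans (le_max_right _ _)
  have hJ : ∀ z ∈ H', RootJet K' α (A₀ z) (B₀ z) (C₀ z) (φ z) (deriv A₀ z) (deriv B₀ z)
      (deriv C₀ z) (deriv φ z) := fun z hz =>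
    hL.rootJet hρ (ball_subset_halfstrip (hH' ▸ hz)) h1 h2 h3
  have hφ' : DifferentiableOn ℂ (deriv φ) H' :=
    (hL.diff_root.deriv isOpen_halfstrip).mono hH'sub
  have hA₀' : DifferentiableOn ℂ (deriv A₀) H' := (hL.diff_A.deriv isOpen_halfstrip).mono hH'sub
  have hA₀ := hL.diff_A.mono hH'sub
  have hB₀ := hL.diff_B.mono hH'sub
  have hC₀ := hL.diff_C.mono hH'sub
  have hφ := hL.diff_root.mono hH'sub
  -- the exponent of the gauge factor
  obtain ⟨g, hg⟩ := exists_primitive_of_convex (g := fun z => 2 * (α * A₀ z) * deriv φ z) hH'open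
    (hH' ▸ convex_halfstrip) (((hA₀.const_mul _).const_mul _).mul hφ')
  have hgd : DifferentiableOn ℂ g H' := fun z hz =>
    (hg z hz).differentiableAt.differentiableWithinAt
  obtain ⟨E, hE⟩ : ∃ E, E = Complex.exp (θ * Complex.I) := ⟨_, rfl⟩
  have hEn : ‖E‖ = 1 := by rw [hE, Complex.norm_exp_ofReal_mul_I]
  have hE0 : E ≠ 0 := by rw [hE]; exact Complex.exp_ne_zero _
  have hαC : (α : ℂ) ^ 2 = 1 := hL.sq_eq
  have hαn : ‖(α : ℂ)‖ = 1 := by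
    rcases hα with rfl | rfl <;> simp
  -- in the coordinate `ζ = z / τ` the strip is invariant under positive translations
  obtain ⟨τ, hτ⟩ : ∃ τ, τ = α * E := ⟨_, rfl⟩
  have hτn : ‖τ‖ = 1 := by rw [hτ, norm_mul, hαn, hEn, one_mul]
  have hτ0 : τ ≠ 0 := by rw [← norm_pos_iff, hτn]; exact one_pos
  have hw := hL.translationWeight hr' h1 h2 h3 (τ := τ) (by rw [hτ, hE]) (hH' ▸ hg)
  rw [← hH'] at hw
  obtain ⟨Ω, hΩ⟩ : ∃ Ω, Ω = {ζ | τ * ζ ∈ H'} := ⟨_, rfl⟩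
  rw [← hΩ] at hw
  have hΩmem : ∀ {ζ}, ζ ∈ Ω → τ * ζ ∈ H' := fun {ζ} h => by rw [hΩ] at h; exact h
  -- bounds on a compact neighbourhood of `Q`, which determine the smallness of the solution
  obtain ⟨δ, hδ, hδsub⟩ := hQ.exists_cthickening_subset_open hH'open (hH' ▸ hQ')
  obtain ⟨v₀, hv₀⟩ := (hQ.cthickening (r := δ)).exists_bound_of_continuousOn
    (hφ.continuousOn.mono hδsub)
  obtain ⟨v, hv⟩ : ∃ v, v = 1 + v₀ ^ 2 := ⟨_, rfl⟩
  have hv1 : 1 ≤ v := by rw [hv]; nlinarith [sq_nonneg v₀]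
  obtain ⟨ε, hε⟩ : ∃ ε, ε = 1 / (4 * K' * v) := ⟨_, rfl⟩
  have hε0 : 0 < ε := by rw [hε]; positivity
  -- so that `|κ y| ≤ 1 / 4`, which keeps `1 - κ y` away from zero
  have hεv : K' * (ε * v) = 1 / 4 := by rw [hε]; field_simp
  have hε2 : ε ≤ 1 / 2 := by
    have : ε ≤ K' * (ε * v) := by
      have h5 : ε * 1 ≤ ε * v := by gcongr
      nlinarith
    linarith
  obtain ⟨σ, hσ⟩ : ∃ σ, σ = max (1 / d) (12 * K' ^ 3 + 3 * (12 * K' ^ 3) / ε) := ⟨_, rfl⟩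
  have hσd : 1 / d ≤ σ := hσ ▸ le_max_left _ _
  have hσ0 : 0 < σ := lt_of_lt_of_le (by positivity) hσd
  obtain ⟨D, hD⟩ : ∃ D, D = Ω ×ˢ {s : ℂ | σ < s.re} := ⟨_, rfl⟩
  have hs0 : ∀ P ∈ D, P.2 ≠ 0 := fun P hP => by
    rw [hD] at hP; exact ne_zero_of_lt_re hσ0 hP.2
  have hmem1 : ∀ P ∈ D, τ * P.1 ∈ H' := fun P hP => by rw [hD] at hP; exact hΩmem hP.1
  have hmem2 : ∀ P ∈ D, E * P.2⁻¹ ∈ borelDisc θ d := fun P hP => by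
    rw [hD] at hP
    rw [← div_eq_mul_inv, hE, div_mem_borelDisc_iff]
    exact hσd.trans_lt hP.2
  have hpull : ∀ f : ℂ → ℂ, DifferentiableOn ℂ f H' →
      DifferentiableOn ℂ (fun P : ℂ × ℂ => f (τ * P.1)) D := fun f hf =>
    hf.comp (f := fun P : ℂ × ℂ => τ * P.1) (by fun_prop) hmem1
  have hpull₂ : ∀ (f : ℂ → ℂ → ℂ) (f₀ : ℂ → ℂ),
      HolomorphicOn₂ f (halfstrip θ α z₁ r) (borelDisc θ d) → DifferentiableOn ℂ f₀ H' →
      DifferentiableOn ℂ (fun P : ℂ × ℂ =>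
        (f (τ * P.1) (E * P.2⁻¹) - f₀ (τ * P.1)) * (P.2 * E⁻¹)) D := by
    intro f f₀ hf hf₀
    refine DifferentiableOn.mul (DifferentiableOn.sub (hf.comp
      (f := fun P : ℂ × ℂ => (τ * P.1, E * P.2⁻¹)) ?_ ?_) (hpull f₀ hf₀)) (by fun_prop)
    · exact DifferentiableOn.prodMk (by fun_prop) (DifferentiableOn.const_mul
        (differentiableOn_inv.comp differentiableOn_snd fun P hP => hs0 P hP) _)
    · exact fun P hP => ⟨hH'sub (hmem1 P hP), hmem2 P hP⟩
  have hbd₂ : ∀ (f : ℂ → ℂ → ℂ) (f₀ : ℂ → ℂ),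
      (∀ z ∈ halfstrip θ α z₁ r, ∀ h ∈ borelDisc θ d, ‖f z h - f₀ z‖ ≤ K * ‖h‖) →
      ∀ P ∈ D, ‖(f (τ * P.1) (E * P.2⁻¹) - f₀ (τ * P.1)) * (P.2 * E⁻¹)‖ ≤ K' := by
    intro f f₀ hf P hP
    have h5 := hf _ (hH'sub (hmem1 P hP)) _ (hmem2 P hP)
    have h6 : 0 < ‖P.2‖ := norm_pos_iff.2 (hs0 P hP)
    rw [norm_mul, norm_inv, hEn, one_mul] at h5
    rw [norm_mul, norm_mul, norm_inv, hEn, inv_one, mul_one]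
    calc _ ≤ K * ‖P.2‖⁻¹ * ‖P.2‖ := by gcongr
      _ = K := by field_simp
      _ ≤ K' := h2
  -- the remainders of order one, divided by `ħ = E / s`
  obtain ⟨a, ha⟩ : ∃ a : ℂ × ℂ → ℂ, a = fun P =>
    (A (τ * P.1) (E * P.2⁻¹) - A₀ (τ * P.1)) * (P.2 * E⁻¹) := ⟨_, rfl⟩
  obtain ⟨b, hb⟩ : ∃ b : ℂ × ℂ → ℂ, b = fun P =>
    (B (τ * P.1) (E * P.2⁻¹) - B₀ (τ * P.1)) * (P.2 * E⁻¹) := ⟨_, rfl⟩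
  obtain ⟨c, hc⟩ : ∃ c : ℂ × ℂ → ℂ, c = fun P =>
    (C (τ * P.1) (E * P.2⁻¹) - C₀ (τ * P.1)) * (P.2 * E⁻¹) := ⟨_, rfl⟩
  have had : DifferentiableOn ℂ a D := ha ▸ hpull₂ A A₀ hA hA₀
  have hbd : DifferentiableOn ℂ b D := hb ▸ hpull₂ B B₀ hB hB₀
  have hcd : DifferentiableOn ℂ c D := hc ▸ hpull₂ C C₀ hC hC₀
  have hab : ∀ P ∈ D, ‖a P‖ ≤ K' := ha ▸ hbd₂ A A₀ hA₁
  have hbb : ∀ P ∈ D, ‖b P‖ ≤ K' := hb ▸ hbd₂ B B₀ hB₁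
  have hcb : ∀ P ∈ D, ‖c P‖ ≤ K' := hc ▸ hbd₂ C C₀ hC₁
  have pA := (hpull A₀ hA₀).const_mul (α : ℂ)
  have pφ := hpull φ hφ
  have pφ' := hpull _ hφ'
  have pA' := (hpull _ hA₀').const_mul (α : ℂ)
  have pm := (pA.mul pφ).const_sub 1
  have pg := hpull g hgd
  obtain ⟨Y, hYd, hYb, hY'⟩ := hw.exists_riccati_solution (σ := σ) hε0 hε2 (hσ ▸ le_max_right _ _)
    (p := fun P => τ * Complex.exp (-g (τ * P.1)) * (a P * φ (τ * P.1) ^ 2 + b P * φ (τ * P.1) +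
      c P - deriv φ (τ * P.1)))
    (q := fun P => τ * (2 * a P * ((1 - α * A₀ (τ * P.1) * φ (τ * P.1)) * φ (τ * P.1)) +
      b P * ((1 - α * A₀ (τ * P.1) * φ (τ * P.1)) - α * A₀ (τ * P.1) * φ (τ * P.1)) -
        2 * c P * (α * A₀ (τ * P.1))))
    (r := fun P => τ * Complex.exp (g (τ * P.1)) *
      (a P * (1 - α * A₀ (τ * P.1) * φ (τ * P.1)) ^ 2 -
        b P * (1 - α * A₀ (τ * P.1) * φ (τ * P.1)) * (α * A₀ (τ * P.1)) +
        c P * (α * A₀ (τ * P.1)) ^ 2 -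
      ((α * A₀ (τ * P.1)) ^ 2 * deriv φ (τ * P.1) + α * deriv A₀ (τ * P.1))))
    (by rw [← hD]
        exact (pg.neg.cexp.const_mul τ).mul
          ((((had.mul (pφ.pow 2)).add (hbd.mul pφ)).add hcd).sub pφ'))
    (by rw [← hD]
        exact ((((had.const_mul 2).mul (pm.mul pφ)).add (hbd.mul (pm.sub (pA.mul pφ)))).sub
          ((hcd.const_mul 2).mul pA)).const_mul τ)
    (by rw [← hD]
        exact (pg.cexp.const_mul τ).mul ((((had.mul (pm.pow 2)).sub ((hbd.mul pm).mul pA)).add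
          (hcd.mul (pA.pow 2))).sub (((pA.pow 2).mul pφ').add pA')))
    (by rw [← hD]
        intro P hP
        rw [norm_mul, norm_mul, hτn, one_mul, Complex.norm_exp, Complex.neg_re]
        have := (hJ _ (hmem1 P hP)).norm_constant_le (hab P hP) (hbb P hP) (hcb P hP)
        calc _ ≤ Real.exp (-(g (τ * P.1)).re) * (12 * K' ^ 3 * (1 + ‖φ (τ * P.1)‖ ^ 2)) := by gcongr
          _ = _ := by ring)
    (by rw [← hD]
        intro P hP
        rw [norm_mul, hτn, one_mul]
        exact (hJ _ (hmem1 P hP)).norm_linear_le (hab P hP) (hbb P hP) (hcb P hP))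
    (by rw [← hD]
        intro P hP
        rw [norm_mul, norm_mul, hτn, one_mul, Complex.norm_exp]
        have := (hJ _ (hmem1 P hP)).norm_quadraticTerm_le (hab P hP) (hbb P hP) (hcb P hP)
        refine le_trans (le_of_eq ?_) this
        have h5 : Real.exp (g (τ * P.1)).re * Real.exp (-(g (τ * P.1)).re) = 1 := by
          rw [← Real.exp_add, add_neg_cancel, Real.exp_zero]
        linear_combination (‖a P * (1 - α * A₀ (τ * P.1) * φ (τ * P.1)) ^ 2 -
          b P * (1 - α * A₀ (τ * P.1) * φ (τ * P.1)) * (α * A₀ (τ * P.1)) +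
          c P * (α * A₀ (τ * P.1)) ^ 2 - ((α * A₀ (τ * P.1)) ^ 2 * deriv φ (τ * P.1) +
          α * deriv A₀ (τ * P.1))‖ * (1 + ‖φ (τ * P.1)‖ ^ 2)) * h5)
  rw [← hD] at hYd hYb
  have hσ1 : 0 < 1 / σ := by positivity
  have hVH : Metric.thickening δ Q ⊆ H' := (Metric.thickening_subset_cthickening δ Q).trans hδsub
  have hτz : ∀ z : ℂ, τ * (τ⁻¹ * z) = z := fun z => mul_inv_cancel_left₀ hτ0 z
  have hEh : ∀ h : ℂ, E * (E * h⁻¹)⁻¹ = h := fun h => by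
    rw [mul_inv, inv_inv, mul_inv_cancel_left₀ hE0]
  have hPD : ∀ z ∈ H', ∀ h ∈ borelDisc θ (1 / σ), (τ⁻¹ * z, E * h⁻¹) ∈ D := by
    intro z hz h hh
    rw [hD]
    refine ⟨?_, ?_⟩
    · rw [hΩ]
      change τ * (τ⁻¹ * z) ∈ H'
      rwa [hτz]
    · have h5 : 1 / (1 / σ) < (Complex.exp (θ * Complex.I) / h).re := hh
      rw [one_div_one_div, ← hE, div_eq_mul_inv] at h5
      exact h5
  obtain ⟨y, hy⟩ : ∃ y : ℂ → ℂ → ℂ, y = fun z h => Complex.exp (g z) * Y (τ⁻¹ * z, E * h⁻¹) :=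
    ⟨_, rfl⟩
  have hyb : ∀ z ∈ Metric.thickening δ Q, ∀ h ∈ borelDisc θ (1 / σ), ‖y z h‖ ≤ ε * v := by
    intro z hz h hh
    have h5 := hYb _ (hPD z (hVH hz) h hh)
    simp only [hτz] at h5
    have h6 := hv₀ z (Metric.thickening_subset_cthickening δ Q hz)
    rw [hy, norm_mul, Complex.norm_exp]
    have h7 : Real.exp (g z).re * Real.exp (-(g z).re) = 1 := by
      rw [← Real.exp_add, add_neg_cancel, Real.exp_zero]
    calc _ ≤ Real.exp (g z).re * (ε * ((1 + ‖φ z‖ ^ 2) * Real.exp (-(g z).re))) := by gcongr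
      _ = ε * (1 + ‖φ z‖ ^ 2) := by linear_combination (ε * (1 + ‖φ z‖ ^ 2)) * h7
      _ ≤ ε * v := by rw [hv]; gcongr
  have hκy : ∀ z ∈ Metric.thickening δ Q, ∀ h ∈ borelDisc θ (1 / σ),
      ‖α * A₀ z * y z h‖ ≤ 1 / 4 := by
    intro z hz h hh
    rw [norm_mul, ← hεv]
    exact mul_le_mul (hJ z (hVH hz)).norm_kappa (hyb z hz h hh) (norm_nonneg _) (by linarith)
  have hDen : ∀ z ∈ Metric.thickening δ Q, ∀ h ∈ borelDisc θ (1 / σ),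
      3 / 4 ≤ ‖1 - α * A₀ z * y z h‖ := by
    intro z hz h hh
    have := norm_sub_norm_le 1 (α * A₀ z * y z h)
    rw [norm_one] at this
    linarith [hκy z hz h hh]
  have hDen0 : ∀ z ∈ Metric.thickening δ Q, ∀ h ∈ borelDisc θ (1 / σ),
      1 - α * A₀ z * y z h ≠ 0 := fun z hz h hh => by
    rw [← norm_pos_iff]; linarith [hDen z hz h hh]
  refine ⟨Metric.thickening δ Q, Metric.isOpen_thickening, Metric.self_subset_thickening hδ Q,
    hVH.trans hH'sub, 1 / σ, hσ1, ?_, fun z h => φ z + y z h / (1 - α * A₀ z * y z h), ?_, ?_⟩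
  · rw [one_div_le (by positivity) hd]; exact hσd
  · have q1 : ∀ f : ℂ → ℂ, DifferentiableOn ℂ f H' → DifferentiableOn ℂ (fun P : ℂ × ℂ => f P.1)
        (Metric.thickening δ Q ×ˢ borelDisc θ (1 / σ)) := fun f hf =>
      hf.comp (f := fun P : ℂ × ℂ => P.1) (by fun_prop) fun P hP => hVH hP.1
    have q2 : DifferentiableOn ℂ (fun P : ℂ × ℂ => y P.1 P.2)
        (Metric.thickening δ Q ×ˢ borelDisc θ (1 / σ)) := by
      rw [hy]
      refine (q1 g hgd).cexp.mul (hYd.comp (f := fun P : ℂ × ℂ => (τ⁻¹ * P.1, E * P.2⁻¹)) ?_ ?_)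
      · exact DifferentiableOn.prodMk (by fun_prop) (DifferentiableOn.const_mul
          (differentiableOn_inv.comp differentiableOn_snd
            fun P hP => ne_zero_of_mem_borelDisc hσ1 hP.2) _)
      · exact fun P hP => hPD _ (hVH hP.1) _ hP.2
    have q3 := (((q1 A₀ hA₀).const_mul (α : ℂ)).mul q2).const_sub 1
    have q4 := (q1 φ hφ).add (q2.mul (differentiableOn_inv.comp q3
      fun P hP => hDen0 P.1 hP.1 P.2 hP.2))
    exact q4
  · intro z hz h hh
    have hzH := hVH hz
    have hh0 := ne_zero_of_mem_borelDisc hσ1 hh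
    have hn := hH'open.mem_nhds hzH
    have hP := hPD z hzH h hh
    have J := hJ z hzH
    refine ⟨?_, ?_, ?_⟩
    · have dφ := (hφ.differentiableAt hn).hasDerivAt
      have dA := (hA₀.differentiableAt hn).hasDerivAt
      have hlin : HasDerivAt (fun z : ℂ => τ⁻¹ * z) (τ⁻¹ * 1) z := (hasDerivAt_id z).const_mul τ⁻¹
      have hP' := hP
      rw [hD] at hP'
      have dY := (hY' (τ⁻¹ * z) hP'.1 (E * h⁻¹) hP'.2).comp z hlin
      obtain ⟨p, hp⟩ : ∃ p, p = a (τ⁻¹ * z, E * h⁻¹) * φ z ^ 2 + b (τ⁻¹ * z, E * h⁻¹) * φ z +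
        c (τ⁻¹ * z, E * h⁻¹) - deriv φ z := ⟨_, rfl⟩
      obtain ⟨q, hq⟩ : ∃ q, q = 2 * a (τ⁻¹ * z, E * h⁻¹) * ((1 - α * A₀ z * φ z) * φ z) +
        b (τ⁻¹ * z, E * h⁻¹) * ((1 - α * A₀ z * φ z) - α * A₀ z * φ z) -
        2 * c (τ⁻¹ * z, E * h⁻¹) * (α * A₀ z) := ⟨_, rfl⟩
      obtain ⟨r, hr⟩ : ∃ r, r = a (τ⁻¹ * z, E * h⁻¹) * (1 - α * A₀ z * φ z) ^ 2 -
        b (τ⁻¹ * z, E * h⁻¹) * (1 - α * A₀ z * φ z) * (α * A₀ z) +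
        c (τ⁻¹ * z, E * h⁻¹) * (α * A₀ z) ^ 2 -
        ((α * A₀ z) ^ 2 * deriv φ z + α * deriv A₀ z) := ⟨_, rfl⟩
      have dy : HasDerivAt (fun z => y z h) (α * h⁻¹ * y z h +
          (p + (q + 2 * (α * A₀ z) * deriv φ z) * y z h + r * y z h ^ 2)) z := by
        rw [hy]
        refine ((hg z hzH).cexp.mul dY).congr_deriv ?_
        simp only [hτz, Function.comp_apply]
        rw [← hp, ← hq, ← hr]
        have e1 : τ⁻¹ * τ = 1 := inv_mul_cancel₀ hτ0
        have e2 : τ⁻¹ * E = α := by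
          rw [hτ, mul_inv, mul_assoc, inv_mul_cancel₀ hE0, mul_one]
          exact inv_eq_of_mul_eq_one_left (by rw [← sq, hαC])
        have e3 : Complex.exp (g z) * Complex.exp (-g z) = 1 := by
          rw [← Complex.exp_add, add_neg_cancel, Complex.exp_zero]
        generalize Complex.exp (g z) = e at *
        generalize Complex.exp (-g z) = e' at *
        generalize Y (τ⁻¹ * z, E * h⁻¹) = y₀ at *
        linear_combination (e * h⁻¹ * y₀) * e2 +
          (e * e' * p + e * q * y₀ + e ^ 2 * r * y₀ ^ 2) * e1 + p * e3
      have dF := dφ.add (dy.div (((dA.const_mul (α : ℂ)).mul dy).const_sub 1)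
        (hDen0 z hz h hh))
      have haz : ∀ (f : ℂ → ℂ → ℂ) (f₀ : ℂ → ℂ), f₀ z + h * ((f (τ * (τ⁻¹ * z)) (E * (E * h⁻¹)⁻¹) -
          f₀ (τ * (τ⁻¹ * z))) * (E * h⁻¹ * E⁻¹)) = f z h := by
        intro f f₀
        rw [hτz, hEh]
        field_simp
        ring
      have eA : A₀ z + h * a (τ⁻¹ * z, E * h⁻¹) = A z h := by rw [ha]; exact haz A A₀
      have eB : B₀ z + h * b (τ⁻¹ * z, E * h⁻¹) = B z h := by rw [hb]; exact haz B B₀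
      have eC : C₀ z + h * c (τ⁻¹ * z, E * h⁻¹) = C z h := by rw [hc]; exact haz C C₀
      refine dF.congr_deriv ?_
      rw [← eA, ← eB, ← eC]
      refine riccati_transform hαC J.root J.label hh0 (hDen0 z hz h hh) ?_
      rw [hp, hq, hr]
    · rw [add_sub_cancel_left, norm_mul, norm_div]
      have h5 : ‖y z h‖ / ‖1 - α * A₀ z * y z h‖ ≤ ε * v / (3 / 4) :=
        div_le_div₀ (by positivity) (hyb z hz h hh) (by norm_num) (hDen z hz h hh)
      have h6 : ‖A₀ z‖ * (‖y z h‖ / ‖1 - α * A₀ z * y z h‖) ≤ K' * (ε * v / (3 / 4)) :=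
        mul_le_mul J.norm_A h5 (by positivity) (by linarith)
      linarith
    · rw [add_sub_cancel_left, norm_div]
      have h5 : ‖y z h‖ / ‖1 - α * A₀ z * y z h‖ ≤ ε * v / (3 / 4) :=
        div_le_div₀ (by positivity) (hyb z hz h hh) (by norm_num) (hDen z hz h hh)
      have h6 : 1 * (ε * v) ≤ K' * (ε * v) := by gcongr
      linarith

/-! ### Gevrey bounds for solutions close to the leading-order root -/

/-- The data of the theorem, on a Borel disc: the equation, the square root `sq` of the
discriminant, and the formal solution labelled by `α`. -/
structure RiccatiData (θ d α : ℝ) (W : Set ℂ) (a b c : ℂ → ℂ → ℂ) (ahat bhat chat : ℕ → ℂ → ℂ)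
    (sq : ℂ → ℂ) (fhat : ℕ → ℂ → ℂ) : Prop where
  pos : 0 < d
  isOpen : IsOpen W
  sign : α = 1 ∨ α = -1
  holo_a : HolomorphicOn₂ a W (borelDisc θ d)
  holo_b : HolomorphicOn₂ b W (borelDisc θ d)
  holo_c : HolomorphicOn₂ c W (borelDisc θ d)
  diff_ahat : DifferentiableOn ℂ (ahat 0) W
  diff_bhat : DifferentiableOn ℂ (bhat 0) W
  diff_chat : DifferentiableOn ℂ (chat 0) W
  diff_sq : DifferentiableOn ℂ sq W
  sq_ne : ∀ x ∈ W, sq x ≠ 0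
  gevrey_a : HasGevreyBounds (borelDisc θ d) W (fun x => ‖sq x‖) a ahat
  gevrey_b : HasGevreyBounds (borelDisc θ d) W (fun x => ‖sq x‖) b bhat
  gevrey_c : HasGevreyBounds (borelDisc θ d) W (fun x => ‖sq x‖) c chat
  formal : IsLabelledFormalSolution ahat bhat chat sq α W fhat

theorem HasGevreyBounds.mono {S S' U U' : Set ℂ} {w : ℂ → ℝ} {f : ℂ → ℂ → ℂ} {fhat : ℕ → ℂ → ℂ}
    (hf : HasGevreyBounds S U w f fhat) (hS : S' ⊆ S) (hU : U' ⊆ U) :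
    HasGevreyBounds S' U' w f fhat := by
  obtain ⟨C, hC, M, hM, h⟩ := hf
  exact ⟨C, hC, M, hM, fun n x hx y hy => h n x (hU hx) y (hS hy)⟩

theorem IsFormalSolution.mono {ahat bhat chat fhat : ℕ → ℂ → ℂ} {U U' : Set ℂ}
    (hf : IsFormalSolution ahat bhat chat U fhat) (hU : U' ⊆ U) :
    IsFormalSolution ahat bhat chat U' fhat :=
  ⟨fun k => (hf.1 k).mono hU, fun x hx => hf.2 x (hU hx)⟩

theorem IsFormalSolution.leading {ahat bhat chat fhat : ℕ → ℂ → ℂ} {U : Set ℂ}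
    (hf : IsFormalSolution ahat bhat chat U fhat) {x : ℂ} (hx : x ∈ U) :
    ahat 0 x * fhat 0 x ^ 2 + bhat 0 x * fhat 0 x + chat 0 x = 0 := by
  have h := congrArg (PowerSeries.coeff 0) (hf.2 x hx)
  simp only [PowerSeries.coeff_zero_eq_constantCoeff, map_mul, map_add, map_pow,
    PowerSeries.constantCoeff_X, zero_mul] at h
  simpa [seriesAt, ← PowerSeries.coeff_zero_eq_constantCoeff_apply] using h.symm

namespace RiccatiData

variable {θ d α : ℝ} {W : Set ℂ} {a b c : ℂ → ℂ → ℂ} {ahat bhat chat : ℕ → ℂ → ℂ}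
  {sq : ℂ → ℂ} {fhat : ℕ → ℂ → ℂ}

theorem norm_sign (h : RiccatiData θ d α W a b c ahat bhat chat sq fhat) : ‖(α : ℂ)‖ = 1 := by
  rcases h.sign with rfl | rfl <;> simp

/-- A solution close to the leading-order root is Gevrey asymptotic to the formal solution, away
from the boundary. -/
theorem hasGevreyBounds (h : RiccatiData θ d α W a b c ahat bhat chat sq fhat) {L U U' : Set ℂ}
    {d₀ δ N : ℝ} {f : ℂ → ℂ → ℂ} (hd₀ : 0 < d₀) (hd₀' : d₀ ≤ d) (hL : IsCompact L) (hLW : L ⊆ W)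
    (hU : IsOpen U) (hUL : U ⊆ L) (hf : IsExactSolution a b c U (borelDisc θ d₀) f)
    (hclose : ∀ x ∈ U, ∀ y ∈ borelDisc θ d₀, ‖ahat 0 x * (f x y - fhat 0 x)‖ ≤ ‖sq x‖ / 2)
    (hbound : ∀ x ∈ U, ∀ y ∈ borelDisc θ d₀, ‖f x y - fhat 0 x‖ ≤ N)
    (hδ : 0 < δ) (hU' : ∀ x ∈ U', Metric.ball x δ ⊆ U) :
    HasGevreyBounds (borelDisc θ d₀) U' (fun _ => 1) f fhat ∧ IsUniformlyGevrey U' fhat := by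
  have hUW := hUL.trans hLW
  obtain ⟨B, hB⟩ := hL.exists_bound_of_continuousOn (h.diff_sq.continuousOn.mono hLW)
  obtain ⟨B', hB'⟩ := hL.exists_bound_of_continuousOn
    ((h.diff_sq.continuousOn.inv₀ h.sq_ne).mono hLW)
  obtain ⟨B₀, hB₀⟩ := hL.exists_bound_of_continuousOn ((h.formal.1.1 0).continuousOn.mono hLW)
  obtain ⟨μ, hμ⟩ : ∃ μ, μ = (max B' 1)⁻¹ := ⟨_, rfl⟩
  have hmax : 0 < max B' 1 := lt_max_of_lt_right one_pos
  have hμ0 : 0 < μ := by rw [hμ]; positivity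
  have hμsq : ∀ x ∈ U, μ ≤ ‖sq x‖ := fun x hx => by
    have h1 := (hB' x (hUL hx)).trans (le_max_left B' 1)
    rw [Pi.inv_apply, norm_inv] at h1
    rw [hμ]
    exact inv_le_of_inv_le₀ (norm_pos_iff.2 (h.sq_ne x (hUW hx))) h1
  have hS : ∀ ε > 0, ∃ y ∈ borelDisc θ d₀, y ≠ 0 ∧ ‖y‖ < ε := fun ε hε =>
    exists_mem_borelDisc_norm_lt hε
  have hsub := borelDisc_subset (θ := θ) hd₀ hd₀'
  obtain ⟨Ca, hCa, Ma, hMa, hta⟩ := (h.gevrey_a.mono hsub hUW).scaledRem_le hS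
  obtain ⟨Cb, hCb, Mb, hMb, htb⟩ := (h.gevrey_b.mono hsub hUW).scaledRem_le hS
  obtain ⟨Cc, hCc, Mc, hMc, htc⟩ := (h.gevrey_c.mono hsub hUW).scaledRem_le hS
  obtain ⟨C, hC⟩ : ∃ C, C = max Ca (max Cb Cc) := ⟨_, rfl⟩
  obtain ⟨M, hM⟩ : ∃ M, M = max Ma (max Mb Mc) := ⟨_, rfl⟩
  have hM0 : 0 < M := hM ▸ lt_max_of_lt_left hMa
  have hgen : ∀ {C' M' : ℝ} {t : ℂ} {x : ℂ} {m : ℕ}, 0 < C' → 0 < M' → C' ≤ C → M' ≤ M → x ∈ U →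
      ‖t‖ ≤ ‖sq x‖ * (C' * (M' ^ m * m.factorial)) → ‖t‖ ≤ B * C * (M ^ m * m.factorial) := by
    intro C' M' t x m h1 h2 h3 h4 hx ht
    have h5 := hB x (hUL hx)
    have h6 := (norm_nonneg _).trans h5
    have h7 := h1.le.trans h3
    refine ht.trans ?_
    rw [mul_assoc]
    gcongr
  have hne : ∀ y ∈ insert 0 (borelDisc θ d₀), y ≠ 0 → y ∈ borelDisc θ d₀ := fun y hy h0 =>
    hy.resolve_left h0
  have hlab := h.formal.2
  obtain ⟨L', hL', K, hK, hfin⟩ := exists_gevrey_bound (U := U) (J := insert 0 (borelDisc θ d₀)) hU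
    (mem_insert _ _) (ta := scaledRem a ahat) (tb := scaledRem b bhat) (tc := scaledRem c chat)
    (tf := scaledRem f fhat) (fun y _ x _ => remSeq_scaledRem a ahat y x)
    (fun y _ x _ => remSeq_scaledRem b bhat y x) (fun y _ x _ => remSeq_scaledRem c chat y x)
    (fun y _ x _ => remSeq_scaledRem f fhat y x)
    (fun y hy m => differentiableOn_scaledRem (fun h0 => hf.1.comp
      (f := fun x : ℂ => (x, y)) (by fun_prop) fun x hx => ⟨hx, hne y hy h0⟩)
      (fun k => (h.formal.1.1 k).mono hUW) m)
    (h.formal.1.mono hUW) (α := B * C) (M := M) (φ := B₀ + max N 0) (μ := μ / 2)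
    (fun y hy x hx => by
      by_cases h0 : y = 0
      · subst h0
        simp only [scaledRem_zero, zero_mul]
        exact (h.formal.1.leading (hUW hx)).symm
      · have e : scaledRem f fhat y 0 = fun x => f x y := funext fun x => scaledRem_order_zero h0 x
        rw [e, scaledRem_order_zero h0, scaledRem_order_zero h0, scaledRem_order_zero h0]
        exact hf.2 x hx y (hne y hy h0))
    hM0 (by positivity)
    (fun y hy x hx m => hgen hCa hMa (hC ▸ le_max_left _ _) (hM ▸ le_max_left _ _) hx
      (hta x hx y hy m))
    (fun y hy x hx m => hgen hCb hMb (hC ▸ (le_max_left _ _).trans (le_max_right _ _))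
      (hM ▸ (le_max_left _ _).trans (le_max_right _ _)) hx (htb x hx y hy m))
    (fun y hy x hx m => hgen hCc hMc (hC ▸ (le_max_right _ _).trans (le_max_right _ _))
      (hM ▸ (le_max_right _ _).trans (le_max_right _ _)) hx (htc x hx y hy m))
    (fun y hy x hx => by
      have h1 := hB₀ x (hUL hx)
      by_cases h0 : y = 0
      · subst h0
        rw [scaledRem_zero]
        linarith [le_max_right N 0]
      · rw [scaledRem_order_zero h0]
        have h2 := hbound x hx y (hne y hy h0)
        have h3 := norm_add_le (fhat 0 x) (f x y - fhat 0 x)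
        rw [add_sub_cancel] at h3
        linarith [le_max_left N 0])
    (fun y hy x hx => by
      have h1 := hμsq x hx
      have h2 : ‖(α : ℂ) * sq x‖ = ‖sq x‖ := by rw [norm_mul, h.norm_sign, one_mul]
      by_cases h0 : y = 0
      · subst h0
        rw [scaledRem_zero]
        have e : ahat 0 x * (fhat 0 x + fhat 0 x) + bhat 0 x = α * sq x := by
          rw [← hlab x (hUW hx)]; ring
        rw [e, h2]
        linarith
      · rw [scaledRem_order_zero h0]
        have e : ahat 0 x * (fhat 0 x + f x y) + bhat 0 x =
            α * sq x + ahat 0 x * (f x y - fhat 0 x) := by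
          rw [← hlab x (hUW hx)]; ring
        have h3 := hclose x hx y (hne y hy h0)
        have h4 := norm_sub_le_norm_add (α * sq x) (ahat 0 x * (f x y - fhat 0 x))
        rw [e]
        linarith)
  obtain ⟨ρ, hρ⟩ : ∃ ρ, ρ = min δ 1 := ⟨_, rfl⟩
  have hρ0 : 0 < ρ := hρ ▸ lt_min hδ one_pos
  have hfin' : ∀ x ∈ U', ∀ y ∈ insert 0 (borelDisc θ d₀), ∀ m,
      ‖scaledRem f fhat y m x‖ ≤ L' * (K / ρ) ^ m * m.factorial := by
    intro x hx y hy m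
    have h1 := hfin m y hy x ρ hρ0 (hρ ▸ min_le_right _ _)
      ((Metric.ball_subset_ball (hρ ▸ min_le_left _ _)).trans (hU' x hx))
    rw [← le_div_iff₀ (by positivity)] at h1
    refine h1.trans_eq ?_
    rw [div_pow]
    ring
  refine ⟨⟨L', hL', K / ρ, by positivity, fun m x hx y hy => ?_⟩,
    ⟨L', hL', K / ρ, by positivity, fun m x hx => ?_⟩⟩
  · have h0 := ne_zero_of_mem_borelDisc hd₀ hy
    have h1 := hfin' x hx y (mem_insert_of_mem _ hy) m
    rw [scaledRem_of_ne h0, norm_div, norm_pow,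
      div_le_iff₀ (pow_pos (norm_pos_iff.2 h0) m)] at h1
    rwa [one_mul]
  · have h1 := hfin' x hx 0 (mem_insert _ _) m
    rwa [scaledRem_zero] at h1

/-- The normalised leading-order data on the halfstrip. -/
theorem leadingData (h : RiccatiData θ d α W a b c ahat bhat chat sq fhat) {H : Set ℂ} {Ψ : ℂ → ℂ}
    (hH : IsOpen H) (hΨ : DifferentiableOn ℂ Ψ H) (hW : MapsTo Ψ H W) :
    ∃ K, LeadingData H K α (fun z => ahat 0 (Ψ z) * (sq (Ψ z))⁻¹)
        (fun z => bhat 0 (Ψ z) * (sq (Ψ z))⁻¹) (fun z => chat 0 (Ψ z) * (sq (Ψ z))⁻¹)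
        (fun z => fhat 0 (Ψ z)) ∧
      (∀ z ∈ H, ∀ y ∈ borelDisc θ d,
        ‖a (Ψ z) y * (sq (Ψ z))⁻¹ - ahat 0 (Ψ z) * (sq (Ψ z))⁻¹‖ ≤ K * ‖y‖) ∧
      (∀ z ∈ H, ∀ y ∈ borelDisc θ d,
        ‖b (Ψ z) y * (sq (Ψ z))⁻¹ - bhat 0 (Ψ z) * (sq (Ψ z))⁻¹‖ ≤ K * ‖y‖) ∧
      ∀ z ∈ H, ∀ y ∈ borelDisc θ d,
        ‖c (Ψ z) y * (sq (Ψ z))⁻¹ - chat 0 (Ψ z) * (sq (Ψ z))⁻¹‖ ≤ K * ‖y‖ := by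
  have hS : ∀ ε > 0, ∃ y ∈ borelDisc θ d, y ≠ 0 ∧ ‖y‖ < ε := fun ε hε =>
    exists_mem_borelDisc_norm_lt hε
  have hgen : ∀ {g : ℂ → ℂ → ℂ} {ghat : ℕ → ℂ → ℂ},
      HasGevreyBounds (borelDisc θ d) W (fun x => ‖sq x‖) g ghat →
      ∃ K, ∀ x ∈ W, ‖ghat 0 x * (sq x)⁻¹‖ ≤ K ∧ ∀ y ∈ borelDisc θ d,
        ‖g x y * (sq x)⁻¹ - ghat 0 x * (sq x)⁻¹‖ ≤ K * ‖y‖ := by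
    intro g ghat hg
    obtain ⟨C, hC, M, hM, hb⟩ := hg.scaledRem_le hS
    refine ⟨max C (C * M), fun x hx => ⟨?_, fun y hy => ?_⟩⟩
    · have h1 := hb x hx 0 (mem_insert _ _) 0
      have h0 := norm_pos_iff.2 (h.sq_ne x hx)
      rw [scaledRem_zero, pow_zero, one_mul, Nat.factorial_zero, Nat.cast_one, mul_one] at h1
      rw [norm_mul, norm_inv, ← div_eq_mul_inv, div_le_iff₀ h0]
      refine h1.trans ?_
      rw [mul_comm]
      gcongr
      exact le_max_left _ _
    · have h1 := hb x hx y (mem_insert_of_mem _ hy) 1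
      have h0 := norm_pos_iff.2 (h.sq_ne x hx)
      have hy0 := ne_zero_of_mem_borelDisc h.pos hy
      have hy1 := norm_pos_iff.2 hy0
      rw [scaledRem_of_ne hy0, pow_one, pow_one, Nat.factorial_one, Nat.cast_one, mul_one, norm_div,
        div_le_iff₀ hy1, remainder, Finset.sum_range_one, pow_zero, mul_one] at h1
      rw [← sub_mul, norm_mul, norm_inv, ← div_eq_mul_inv, div_le_iff₀ h0]
      refine h1.trans ?_
      have : C * M ≤ max C (C * M) := le_max_right _ _
      calc _ = C * M * ‖y‖ * ‖sq x‖ := by ring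
        _ ≤ _ := by gcongr
  obtain ⟨Ka, ha⟩ := hgen h.gevrey_a
  obtain ⟨Kb, hb⟩ := hgen h.gevrey_b
  obtain ⟨Kc, hc⟩ := hgen h.gevrey_c
  have ha' : Ka ≤ max Ka (max Kb Kc) := le_max_left _ _
  have hb' : Kb ≤ max Ka (max Kb Kc) := (le_max_left _ _).trans (le_max_right _ _)
  have hc' : Kc ≤ max Ka (max Kb Kc) := (le_max_right _ _).trans (le_max_right _ _)
  have hdiff : ∀ {g : ℂ → ℂ}, DifferentiableOn ℂ g W → DifferentiableOn ℂ
      (fun z => g (Ψ z) * (sq (Ψ z))⁻¹) H := fun {g} hg =>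
    (hg.comp hΨ hW).mul ((h.diff_sq.comp hΨ hW).inv fun z hz => h.sq_ne _ (hW hz))
  refine ⟨max Ka (max Kb Kc), ⟨hH, ?_, hdiff h.diff_ahat, hdiff h.diff_bhat, hdiff h.diff_chat,
    (h.formal.1.1 0).comp hΨ hW, fun z hz => ?_, fun z hz => ?_,
    fun z hz => ((ha _ (hW hz)).1).trans ha', fun z hz => ((hb _ (hW hz)).1).trans hb',
    fun z hz => ((hc _ (hW hz)).1).trans hc'⟩,
    fun z hz y hy => ((ha _ (hW hz)).2 y hy).trans (by gcongr),
    fun z hz y hy => ((hb _ (hW hz)).2 y hy).trans (by gcongr),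
    fun z hz y hy => ((hc _ (hW hz)).2 y hy).trans (by gcongr)⟩
  · rcases h.sign with rfl | rfl <;> norm_num
  · linear_combination (sq (Ψ z))⁻¹ * h.formal.1.leading (hW hz)
  · have h1 := h.formal.2 _ (hW hz)
    have h2 := mul_inv_cancel₀ (h.sq_ne _ (hW hz))
    linear_combination (sq (Ψ z))⁻¹ * h1 + α * h2

end RiccatiData

/-! ### Descent along the inverse Liouville transformation -/

/-- Holomorphic local sections of a map with nowhere vanishing derivative. -/
theorem exists_local_section {Ψ : ℂ → ℂ} {H V : Set ℂ} (hH : IsOpen H)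
    (hΨ : DifferentiableOn ℂ Ψ H) (hΨ' : ∀ z ∈ H, deriv Ψ z ≠ 0) {z : ℂ} (hz : z ∈ H)
    (hV : V ∈ 𝓝 z) : ∃ (N : Set ℂ) (χ : ℂ → ℂ), IsOpen N ∧ Ψ z ∈ N ∧ χ (Ψ z) = z ∧
      ∀ x ∈ N, χ x ∈ V ∧ χ x ∈ H ∧ Ψ (χ x) = x ∧ HasDerivAt χ (deriv Ψ (χ x))⁻¹ x := by
  have hs : HasStrictDerivAt Ψ (deriv Ψ z) z :=
    ((hΨ.analyticAt (hH.mem_nhds hz)).hasStrictDerivAt)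
  obtain ⟨e, he⟩ : ∃ e, e = (hs.hasStrictFDerivAt_equiv (hΨ' z hz)).toOpenPartialHomeomorph Ψ :=
    ⟨_, rfl⟩
  have hee : (e : ℂ → ℂ) = Ψ := by rw [he]; rfl
  have hze : z ∈ e.source := by
    rw [he]; exact (hs.hasStrictFDerivAt_equiv (hΨ' z hz)).mem_toOpenPartialHomeomorph_source
  have hsymm : e.symm (Ψ z) = z := by rw [← hee]; exact e.left_inv hze
  obtain ⟨V', hV', hV'o, hzV'⟩ := mem_nhds_iff.1 (inter_mem hV (hH.mem_nhds hz))
  refine ⟨e.target ∩ e.symm ⁻¹' V', e.symm, ?_, ?_, hsymm, ?_⟩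
  · exact e.symm.isOpen_inter_preimage hV'o
  · refine ⟨by rw [← hee]; exact e.map_source hze, ?_⟩
    rw [mem_preimage, hsymm]
    exact hzV'
  · rintro x ⟨hx, hxV⟩
    have hxH := (hV' hxV).2
    refine ⟨(hV' hxV).1, hxH, ?_, ?_⟩
    · rw [← hee]; exact e.right_inv hx
    · refine e.hasDerivAt_symm hx (hΨ' _ hxH) ?_
      rw [hee]
      exact (hΨ.differentiableAt (hH.mem_nhds hxH)).hasDerivAt

/-- A compact subset of the image of a local biholomorphism has a neighbourhood contained in the
image of a compact set. -/
theorem exists_isCompact_lift {Ψ : ℂ → ℂ} {H : Set ℂ} (hH : IsOpen H)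
    (hΨ : DifferentiableOn ℂ Ψ H) (hΨ' : ∀ z ∈ H, deriv Ψ z ≠ 0) {K : Set ℂ} (hK : IsCompact K)
    (hKH : K ⊆ Ψ '' H) :
    ∃ Q U, IsCompact Q ∧ Q ⊆ H ∧ IsOpen U ∧ K ⊆ U ∧ U ⊆ Ψ '' Q := by
  refine hK.induction_on (p := fun K => ∃ Q U, IsCompact Q ∧ Q ⊆ H ∧ IsOpen U ∧ K ⊆ U ∧ U ⊆ Ψ '' Q)
    ⟨∅, ∅, isCompact_empty, empty_subset _, isOpen_empty, empty_subset _, empty_subset _⟩ ?_ ?_ ?_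
  · rintro s t hst ⟨Q, U, h1, h2, h3, h4, h5⟩
    exact ⟨Q, U, h1, h2, h3, hst.trans h4, h5⟩
  · rintro s t ⟨Q, U, h1, h2, h3, h4, h5⟩ ⟨Q', U', h1', h2', h3', h4', h5'⟩
    exact ⟨Q ∪ Q', U ∪ U', h1.union h1', union_subset h2 h2', h3.union h3',
      union_subset_union h4 h4',
      by rw [image_union]; exact union_subset_union h5 h5'⟩
  · intro x hx
    obtain ⟨z, hz, rfl⟩ := hKH hx
    obtain ⟨ρ, hρ, hball⟩ := Metric.nhds_basis_closedBall.mem_iff.1 (hH.mem_nhds hz)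
    obtain ⟨N, χ, hN, hzN, -, hχ⟩ := exists_local_section hH hΨ hΨ' hz
      (Metric.closedBall_mem_nhds z hρ)
    exact ⟨N, mem_nhdsWithin_of_mem_nhds (hN.mem_nhds hzN), Metric.closedBall z ρ, N,
      isCompact_closedBall z ρ, hball, hN, Subset.rfl,
      fun x hx => ⟨χ x, (hχ x hx).1, (hχ x hx).2.2.1⟩⟩

namespace RiccatiData

variable {θ d α : ℝ} {W : Set ℂ} {a b c : ℂ → ℂ → ℂ} {ahat bhat chat : ℕ → ℂ → ℂ}
  {sq : ℂ → ℂ} {fhat : ℕ → ℂ → ℂ}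

/-- Existence of an exact solution near a compact subset, with Gevrey bounds there. The solution on
the halfstrip descends, since by Watson's lemma its values at points with the same image under `Ψ`
agree: both are Gevrey asymptotic to the formal solution. -/
theorem exists_exactSolution (h : RiccatiData θ d α W a b c ahat bhat chat sq fhat) {z₁ : ℂ} {r : ℝ}
    {Ψ : ℂ → ℂ} (hr : 0 < r) (hΨ : DifferentiableOn ℂ Ψ (halfstrip θ α z₁ r))
    (hode : ∀ z ∈ halfstrip θ α z₁ r, sq (Ψ z) * deriv Ψ z = 1)
    (himg : Ψ '' halfstrip θ α z₁ r = W) {K : Set ℂ} (hK : IsCompact K) (hKW : K ⊆ W) :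
    ∃ d₀ > 0, d₀ ≤ d ∧ ∃ f : ℂ → ℂ → ℂ, ∃ U, IsOpen U ∧ K ⊆ U ∧ U ⊆ W ∧
      IsExactSolution a b c U (borelDisc θ d₀) f ∧
      HasGevreyBounds (borelDisc θ d₀) K (fun _ => 1) f fhat ∧ IsUniformlyGevrey K fhat := by
  obtain ⟨H, hHdef⟩ : ∃ H, H = halfstrip θ α z₁ r := ⟨_, rfl⟩
  have hH : IsOpen H := hHdef ▸ isOpen_halfstrip
  have hW : MapsTo Ψ H W := fun z hz => by rw [← himg, ← hHdef]; exact mem_image_of_mem Ψ hz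
  rw [← hHdef] at hΨ hode himg
  have hΨ' : ∀ z ∈ H, deriv Ψ z ≠ 0 := fun z hz h0 => by
    have := hode z hz
    rw [h0, mul_zero] at this
    exact zero_ne_one this
  obtain ⟨Q, U, hQ, hQH, hU, hKU, hUQ⟩ := exists_isCompact_lift hH hΨ hΨ' hK (himg ▸ hKW)
  have hΨQ : IsCompact (Ψ '' Q) := hQ.image_of_continuousOn (hΨ.continuousOn.mono hQH)
  have hΨQW : Ψ '' Q ⊆ W := image_subset_iff.2 fun z hz => hW (hQH hz)
  obtain ⟨B, hL, hA₁, hB₁, hC₁⟩ := h.leadingData hH hΨ hW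
  have hlift : ∀ {g : ℂ → ℂ → ℂ}, HolomorphicOn₂ g W (borelDisc θ d) →
      HolomorphicOn₂ (fun z y => g (Ψ z) y * (sq (Ψ z))⁻¹) H (borelDisc θ d) := by
    intro g hg
    have h1 : DifferentiableOn ℂ (fun p : ℂ × ℂ => Ψ p.1) (H ×ˢ borelDisc θ d) :=
      hΨ.comp (f := fun p : ℂ × ℂ => p.1) (by fun_prop) fun p hp => hp.1
    have h2 : DifferentiableOn ℂ (fun z => (sq (Ψ z))⁻¹) H :=
      (h.diff_sq.comp hΨ hW).inv fun z hz => h.sq_ne _ (hW hz)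
    exact (hg.comp (f := fun p : ℂ × ℂ => (Ψ p.1, p.2)) (h1.prodMk differentiableOn_snd)
      fun p hp => ⟨hW hp.1, hp.2⟩).mul
        (h2.comp (f := fun p : ℂ × ℂ => p.1) (by fun_prop) fun p hp => hp.1)
  obtain ⟨V, hV, hQV, hVH, d₀, hd₀, hd₀', F, hF, hFprop⟩ := exists_exactSolution_halfstrip
    (θ := θ) (α := α) (z₁ := z₁) (r := r) h.sign hr h.pos (hHdef ▸ hL) (hHdef ▸ hlift h.holo_a)
    (hHdef ▸ hlift h.holo_b) (hHdef ▸ hlift h.holo_c) (hHdef ▸ hA₁) (hHdef ▸ hB₁) (hHdef ▸ hC₁)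
    hQ (hHdef ▸ hQH)
  rw [← hHdef] at hVH
  -- the solution read through a local section
  have hsol : ∀ {N : Set ℂ} {χ : ℂ → ℂ}, IsOpen N → (∀ x ∈ N, χ x ∈ V ∧ χ x ∈ H ∧ Ψ (χ x) = x ∧
      HasDerivAt χ (deriv Ψ (χ x))⁻¹ x) →
      IsExactSolution a b c N (borelDisc θ d₀) fun x y => F (χ x) y := by
    intro N χ hN hχ
    have hχd : DifferentiableOn ℂ χ N := fun x hx =>
      (hχ x hx).2.2.2.differentiableAt.differentiableWithinAt
    refine ⟨?_, fun x hx y hy => ?_⟩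
    · have h1 : DifferentiableOn ℂ (fun p : ℂ × ℂ => χ p.1) (N ×ˢ borelDisc θ d₀) :=
        hχd.comp (f := fun p : ℂ × ℂ => p.1) (by fun_prop) fun p hp => hp.1
      exact hF.comp (f := fun p : ℂ × ℂ => (χ p.1, p.2)) (h1.prodMk differentiableOn_snd)
        fun p hp => ⟨(hχ p.1 hp.1).1, hp.2⟩
    · obtain ⟨hxV, hxH, hΨχ, hχ'⟩ := hχ x hx
      have h1 := ((hFprop (χ x) hxV y hy).1.comp x hχ').deriv
      have h2 := hode (χ x) hxH
      have hy0 := ne_zero_of_mem_borelDisc hd₀ hy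
      rw [hΨχ] at h1 h2
      have hsq : sq x ≠ 0 := left_ne_zero_of_mul_eq_one h2
      have h3 : (deriv Ψ (χ x))⁻¹ = sq x := inv_eq_of_mul_eq_one_left h2
      rw [h3] at h1
      have h4 : deriv (fun x => F (χ x) y) x = _ := h1
      rw [h4]
      field_simp
  have hclose : ∀ z ∈ V, ∀ y ∈ borelDisc θ d₀,
      ‖ahat 0 (Ψ z) * (F z y - fhat 0 (Ψ z))‖ ≤ ‖sq (Ψ z)‖ / 2 ∧ ‖F z y - fhat 0 (Ψ z)‖ ≤ 1 := by
    intro z hz y hy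
    obtain ⟨-, h1, h2⟩ := hFprop z hz y hy
    have h0 := norm_pos_iff.2 (h.sq_ne _ (hW (hVH hz)))
    refine ⟨?_, h2⟩
    rw [mul_right_comm, norm_mul, norm_inv, ← div_eq_mul_inv, div_le_iff₀ h0] at h1
    linarith
  -- the values at points with the same image agree
  have hwell : ∀ z ∈ V, ∀ z' ∈ V, Ψ z = Ψ z' → ∀ y ∈ borelDisc θ d₀, F z y = F z' y := by
    intro z hz z' hz' hzz y hy
    obtain ⟨N, χ, hN, hzN, hχz, hχ⟩ := exists_local_section hH hΨ hΨ' (hVH hz) (hV.mem_nhds hz)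
    obtain ⟨N', χ', hN', hzN', hχz', hχ'⟩ :=
      exists_local_section hH hΨ hΨ' (hVH hz') (hV.mem_nhds hz')
    rw [← hzz] at hzN' hχz'
    have hx : Ψ z ∈ W := hW (hVH hz)
    obtain ⟨ρ, hρ, hball⟩ := Metric.nhds_basis_closedBall.mem_iff.1
      (inter_mem (h.isOpen.mem_nhds hx) (inter_mem (hN.mem_nhds hzN) (hN'.mem_nhds hzN')))
    have hb : Metric.ball (Ψ z) ρ ⊆ Metric.closedBall (Ψ z) ρ := Metric.ball_subset_closedBall
    have hone : ∀ {χ : ℂ → ℂ}, (∀ x ∈ Metric.ball (Ψ z) ρ, χ x ∈ V ∧ χ x ∈ H ∧ Ψ (χ x) = x ∧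
        HasDerivAt χ (deriv Ψ (χ x))⁻¹ x) →
        DifferentiableOn ℂ (fun y => F (χ (Ψ z)) y) (borelDisc θ d₀) ∧
        HasGevreyBounds (borelDisc θ d₀) {Ψ z} (fun _ => 1) (fun x y => F (χ x) y) fhat := by
      intro χ hχ
      have h1 := hsol Metric.isOpen_ball hχ
      refine ⟨h1.1.comp (f := fun y => (Ψ z, y)) (by fun_prop)
        fun y hy => ⟨Metric.mem_ball_self hρ, hy⟩, ?_⟩
      refine (h.hasGevreyBounds hd₀ hd₀' (isCompact_closedBall (Ψ z) ρ)
        (fun x hx => (hball hx).1) Metric.isOpen_ball hb h1 (N := 1) (fun x hx y hy => ?_)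
        (fun x hx y hy => ?_) hρ (fun x hx => ?_)).1
      · have := (hclose _ (hχ x hx).1 y hy).1
        rwa [(hχ x hx).2.2.1] at this
      · have := (hclose _ (hχ x hx).1 y hy).2
        rwa [(hχ x hx).2.2.1] at this
      · rw [mem_singleton_iff.1 hx]
    obtain ⟨h1, h2⟩ := hone fun x hx => hχ x (hball (hb hx)).2.1
    obtain ⟨h1', h2'⟩ := hone fun x hx => hχ' x (hball (hb hx)).2.2
    have := eq_of_hasGevreyBounds hd₀ (mem_singleton (Ψ z)) h1 h1' h2 h2' hy
    simpa only [hχz, hχz'] using this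
  have hσ : ∀ x ∈ U, ∃ z ∈ Q, Ψ z = x := fun x hx => hUQ hx
  choose! σ hσQ hσΨ using hσ
  have hUW : U ⊆ W := hUQ.trans hΨQW
  have hex : IsExactSolution a b c U (borelDisc θ d₀) fun x y => F (σ x) y := by
    have hloc : ∀ x ∈ U, ∃ N, IsOpen N ∧ x ∈ N ∧ ∃ χ : ℂ → ℂ,
        IsExactSolution a b c N (borelDisc θ d₀) (fun x y => F (χ x) y) ∧
        ∀ x' ∈ N, ∀ y ∈ borelDisc θ d₀, F (σ x') y = F (χ x') y := by
      intro x hx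
      have hz := hQV (hσQ x hx)
      obtain ⟨N, χ, hN, hzN, -, hχ⟩ := exists_local_section hH hΨ hΨ' (hVH hz) (hV.mem_nhds hz)
      rw [hσΨ x hx] at hzN
      refine ⟨N ∩ U, hN.inter hU, ⟨hzN, hx⟩, χ, hsol (hN.inter hU) fun x hx => hχ x hx.1,
        fun x' hx' y hy => ?_⟩
      exact hwell _ (hQV (hσQ x' hx'.2)) _ (hχ x' hx'.1).1
        ((hσΨ x' hx'.2).trans (hχ x' hx'.1).2.2.1.symm) y hy
    refine ⟨fun p hp => ?_, fun x hx y hy => ?_⟩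
    · obtain ⟨N, hN, hpN, χ, hsolχ, heq⟩ := hloc p.1 hp.1
      have hn : N ×ˢ borelDisc θ d₀ ∈ 𝓝 p :=
        (hN.prod (isOpen_borelDisc hd₀)).mem_nhds ⟨hpN, hp.2⟩
      refine (DifferentiableAt.congr_of_eventuallyEq (hsolχ.1.differentiableAt hn)
        ?_).differentiableWithinAt
      filter_upwards [hn] with q hq using heq q.1 hq.1 q.2 hq.2
    · obtain ⟨N, hN, hxN, χ, hsolχ, heq⟩ := hloc x hx
      have h1 : (fun x' => F (σ x') y) =ᶠ[𝓝 x] fun x' => F (χ x') y := by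
        filter_upwards [hN.mem_nhds hxN] with x' hx' using heq x' hx' y hy
      rw [h1.deriv_eq]
      simp only [heq x hxN y hy]
      exact hsolχ.2 x hxN y hy
  obtain ⟨δ, hδ, hδU⟩ := hK.exists_thickening_subset_open hU hKU
  refine ⟨d₀, hd₀, hd₀', fun x y => F (σ x) y, U, hU, hKU, hUW, hex, ?_⟩
  refine h.hasGevreyBounds hd₀ hd₀' hΨQ hΨQW hU hUQ hex (N := 1) (fun x hx y hy => ?_)
    (fun x hx y hy => ?_) hδ fun x hx => (Metric.ball_subset_thickening hx δ).trans hδU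
  · have := (hclose _ (hQV (hσQ x hx)) y hy).1
    rwa [hσΨ x hx] at this
  · have := (hclose _ (hQV (hσQ x hx)) y hy).2
    rwa [hσΨ x hx] at this

end RiccatiData

/-- Canonical solutions are unique: they agree on a small Borel disc by Watson's lemma, hence
everywhere by the identity theorem. -/
theorem IsCanonicalSolution.eq {θ d : ℝ} {a b c : ℂ → ℂ → ℂ} {fhat : ℕ → ℂ → ℂ} {U : Set ℂ}
    {f g : ℂ → ℂ → ℂ} (hd : 0 < d) (hf : IsCanonicalSolution θ a b c fhat U (borelDisc θ d) f)
    (hg : IsCanonicalSolution θ a b c fhat U (borelDisc θ d) g) {x : ℂ} (hx : x ∈ U) {y : ℂ}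
    (hy : y ∈ borelDisc θ d) : g x y = f x y := by
  obtain ⟨S₁, hS₁, hsec₁, hG₁⟩ := hf.2
  obtain ⟨S₂, hS₂, hsec₂, hG₂⟩ := hg.2
  obtain ⟨d₁, hd₁, hsub₁⟩ := hsec₁.exists_borelDisc
  obtain ⟨d₂, hd₂, hsub₂⟩ := hsec₂.exists_borelDisc
  obtain ⟨d', hd'⟩ : ∃ d', d' = min d₁ d₂ := ⟨_, rfl⟩
  have hd'0 : 0 < d' := hd' ▸ lt_min hd₁ hd₂
  have h1 : borelDisc θ d' ⊆ S₁ :=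
    (borelDisc_subset hd'0 (hd' ▸ min_le_left _ _)).trans hsub₁
  have h2 : borelDisc θ d' ⊆ S₂ :=
    (borelDisc_subset hd'0 (hd' ▸ min_le_right _ _)).trans hsub₂
  have hslice : ∀ {f : ℂ → ℂ → ℂ}, HolomorphicOn₂ f U (borelDisc θ d) →
      DifferentiableOn ℂ (f x) (borelDisc θ d) := fun {f} hf =>
    hf.comp (f := fun y => (x, y)) (by fun_prop) fun y hy => ⟨hx, hy⟩
  have hfd := hslice hf.1.1
  have hgd := hslice hg.1.1
  have heq : ∀ y ∈ borelDisc θ d', g x y = f x y := fun y hy =>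
    eq_of_hasGevreyBounds hd'0 hx (hgd.mono (h2.trans hS₂)) (hfd.mono (h1.trans hS₁))
      (hG₂.mono h2 Subset.rfl) (hG₁.mono h1 Subset.rfl) hy
  obtain ⟨y₀, hy₀⟩ := borelDisc_nonempty (θ := θ) hd'0
  have hopen := isOpen_borelDisc (θ := θ) hd
  exact (hgd.analyticOnNhd hopen).eqOn_of_preconnected_of_eventuallyEq (hfd.analyticOnNhd hopen)
    (convex_borelDisc hd).isPreconnected (hS₁ (h1 hy₀))
    (by filter_upwards [(isOpen_borelDisc hd'0).mem_nhds hy₀] with z hz using heq z hz) hy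

end ExactRiccati

open ExactRiccati

theorem mainTheorem2
    (θ : ℝ) (X S : Set ℂ) (hXo : IsOpen X) (hXc : IsConnected X)
    (hS : ExactRiccati.IsSectorialDomain θ S)
    (a b c : ℂ → ℂ → ℂ) (ahat bhat chat : ℕ → ℂ → ℂ)
    (ha : ExactRiccati.HolomorphicOn₂ a X S) (hb : ExactRiccati.HolomorphicOn₂ b X S)
    (hc : ExactRiccati.HolomorphicOn₂ c X S)
    (ha' : ExactRiccati.LocUnifAsymptotic θ S X a ahat)
    (hb' : ExactRiccati.LocUnifAsymptotic θ S X b bhat)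
    (hc' : ExactRiccati.LocUnifAsymptotic θ S X c chat)
    (α : ℝ) (hα : α = 1 ∨ α = -1)
    (x₀ : ℂ) (W : Set ℂ) (sq : ℂ → ℂ)
    (hx₀ : x₀ ∈ X) (hreg : ExactRiccati.discriminant ahat bhat chat x₀ ≠ 0) (hWX : W ⊆ X)
    (hsq : ExactRiccati.IsSqrtBranch (ExactRiccati.discriminant ahat bhat chat) sq W)
    (hW : ExactRiccati.IsWKBHalfstrip θ α sq x₀ W)
    (hplus : α = 1 → ∀ x ∈ W, ahat 0 x = 0 → bhat 0 x = sq x)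
    (hminus : α = -1 → ∀ x ∈ W, ahat 0 x ≠ 0)
    (haG : ExactRiccati.GevreyAsymptotic θ S W (fun x => ‖sq x‖) a ahat)
    (hbG : ExactRiccati.GevreyAsymptotic θ S W (fun x => ‖sq x‖) b bhat)
    (hcG : ExactRiccati.GevreyAsymptotic θ S W (fun x => ‖sq x‖) c chat) :
    ∃ fhat : ℕ → ℂ → ℂ,
      -- the formal solution on `W` labelled by `α`, and its uniqueness
      ExactRiccati.IsLabelledFormalSolution ahat bhat chat sq α W fhat ∧
      (∀ ghat : ℕ → ℂ → ℂ,
        ExactRiccati.IsLabelledFormalSolution ahat bhat chat sq α W ghat →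
          ∀ k, Set.EqOn (ghat k) (fhat k) W) ∧
      ∀ U₀ : Set ℂ, IsOpen U₀ → IsConnected U₀ → IsCompact (closure U₀) → closure U₀ ⊆ W →
        ∃ d₀ > 0, ExactRiccati.borelDisc θ d₀ ⊆ S ∧
        ∃ f : ℂ → ℂ → ℂ,
          -- the canonical exact solution on `U₀ × S₀`, `S₀` a Borel disc, and its uniqueness
          ExactRiccati.IsCanonicalSolution θ a b c fhat U₀ (ExactRiccati.borelDisc θ d₀) f ∧
          ExactRiccati.HasGevreyBounds (ExactRiccati.borelDisc θ d₀) U₀ (fun _ => 1) f fhat ∧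
          (∀ g : ℂ → ℂ → ℂ,
            ExactRiccati.IsCanonicalSolution θ a b c fhat U₀ (ExactRiccati.borelDisc θ d₀) g →
              ∀ x ∈ U₀, ∀ h ∈ ExactRiccati.borelDisc θ d₀, g x h = f x h) ∧
          -- the formal solution is uniformly Gevrey and uniformly Borel summable, and `f` is its
          -- uniform Borel resummation
          ExactRiccati.IsUniformlyGevrey U₀ fhat ∧
          ∃ η > 0, ∃ φ : ℂ → ℂ → ℂ,
            ExactRiccati.IsBorelResummation θ η U₀ (ExactRiccati.borelDisc θ d₀) fhat φ f ∧
            -- on the open ray, `φ` is the analytic Borel transform of `f` (minus its leading term)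
            ∀ δ ∈ Set.Ioo 0 d₀, ∀ u : ℝ, 0 < u →
              TendstoUniformlyOn
                (fun (T : ℝ) (x : ℂ) => ExactRiccati.truncatedBorel θ δ T
                  (fun h => f x h - fhat 0 x) (u * Complex.exp (θ * Complex.I)))
                (fun x => φ x (u * Complex.exp (θ * Complex.I))) Filter.atTop U₀ := by
  obtain ⟨z₁, r, Ψ, hr, -, -, hΨ, hode, himg⟩ := hW
  have hΨ' : ∀ z ∈ halfstrip θ α z₁ r, deriv Ψ z ≠ 0 := fun z hz h0 => by
    have := hode z hz
    rw [h0, mul_zero] at this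
    exact zero_ne_one this
  -- `Ψ` is open, being locally invertible
  have hWo : IsOpen W := by
    rw [← himg, isOpen_iff_mem_nhds]
    rintro _ ⟨z, hz, rfl⟩
    obtain ⟨N, χ, hN, hzN, -, hχ⟩ := exists_local_section isOpen_halfstrip hΨ hΨ' hz
      (isOpen_halfstrip.mem_nhds hz)
    exact Filter.mem_of_superset (hN.mem_nhds hzN) fun x hx => ⟨χ x, (hχ x hx).1, (hχ x hx).2.2.1⟩
  have hsq0 : ∀ x ∈ W, sq x ≠ 0 := by
    rw [← himg]
    rintro _ ⟨z, hz, rfl⟩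
    exact left_ne_zero_of_mul_eq_one (hode z hz)
  have ha₀ : ∀ k, DifferentiableOn ℂ (ahat k) W := fun k => (ha'.1 k).mono hWX
  have hb₀ : ∀ k, DifferentiableOn ℂ (bhat k) W := fun k => (hb'.1 k).mono hWX
  have hc₀ : ∀ k, DifferentiableOn ℂ (chat k) W := fun k => (hc'.1 k).mono hWX
  have hαC : (α : ℂ) ≠ 0 := by rcases hα with rfl | rfl <;> simp
  obtain ⟨f₀, hf₀, hroot, hlabel⟩ := exists_leadingTerm hWo hα (ha₀ 0) (hb₀ 0) (hc₀ 0) hsq.1 hsq0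
    hsq.2 hplus hminus
  obtain ⟨fhat, hfhat0, hformal⟩ := exists_formalSolution (s := fun x => α * sq x) hWo ha₀ hb₀ hc₀
    hf₀ (hsq.1.const_mul _) (fun x hx => mul_ne_zero hαC (hsq0 x hx)) hroot hlabel
  have hlab : IsLabelledFormalSolution ahat bhat chat sq α W fhat :=
    ⟨hformal, fun x hx => by rw [hfhat0]; exact hlabel x hx⟩
  refine ⟨fhat, hlab, fun ghat hg => formalSolution_unique (s := fun x => α * sq x) hWo hformal hg.1
    (fun x hx => mul_ne_zero hαC (hsq0 x hx)) hlab.2 hg.2, fun U₀ hU₀ _ hU₀c hU₀W => ?_⟩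
  obtain ⟨Sa, hSa, hsecA, hGa⟩ := haG
  obtain ⟨Sb, hSb, hsecB, hGb⟩ := hbG
  obtain ⟨Sc, hSc, hsecC, hGc⟩ := hcG
  obtain ⟨da, hda, hdaS⟩ := hsecA.exists_borelDisc
  obtain ⟨db, hdb, hdbS⟩ := hsecB.exists_borelDisc
  obtain ⟨dc, hdc, hdcS⟩ := hsecC.exists_borelDisc
  -- a Borel disc on which all three coefficients have Gevrey bounds
  obtain ⟨d, hd⟩ : ∃ d, d = min da (min db dc) := ⟨_, rfl⟩
  have hd0 : 0 < d := hd ▸ lt_min hda (lt_min hdb hdc)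
  have hdA := (borelDisc_subset (θ := θ) hd0 (hd ▸ min_le_left _ _)).trans hdaS
  have hdB := (borelDisc_subset (θ := θ) hd0
    (hd ▸ (min_le_right _ _).trans (min_le_left _ _))).trans hdbS
  have hdC := (borelDisc_subset (θ := θ) hd0
    (hd ▸ (min_le_right _ _).trans (min_le_right _ _))).trans hdcS
  have hdS : borelDisc θ d ⊆ S := hdA.trans hSa
  have hdata : RiccatiData θ d α W a b c ahat bhat chat sq fhat :=
    { pos := hd0
      isOpen := hWo
      sign := hα
      holo_a := ha.mono (Set.prod_mono hWX hdS)
      holo_b := hb.mono (Set.prod_mono hWX hdS)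
      holo_c := hc.mono (Set.prod_mono hWX hdS)
      diff_ahat := ha₀ 0
      diff_bhat := hb₀ 0
      diff_chat := hc₀ 0
      diff_sq := hsq.1
      sq_ne := hsq0
      gevrey_a := hGa.mono hdA Set.Subset.rfl
      gevrey_b := hGb.mono hdB Set.Subset.rfl
      gevrey_c := hGc.mono hdC Set.Subset.rfl
      formal := hlab }
  -- the bounds are taken on the compact closure of `U₀`, hence are uniform on `U₀`
  obtain ⟨d₁, hd₁, hd₁d, f, U, hU, hKU, hUW, hex, hGf, hGu⟩ :=
    hdata.exists_exactSolution hr hΨ hode himg hU₀c hU₀W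
  have hU₀U : U₀ ⊆ U := subset_closure.trans hKU
  have hGf₀ := hGf.mono Set.Subset.rfl (subset_closure (s := U₀))
  have hGu₀ : IsUniformlyGevrey U₀ fhat := by
    obtain ⟨C, hC, M, hM, hb⟩ := hGu
    exact ⟨C, hC, M, hM, fun k x hx => hb k x (subset_closure hx)⟩
  obtain ⟨d₂, hd₂, hBorel⟩ := exists_isBorelResummation hU₀ hd₁
    (hex.1.mono (Set.prod_mono hU₀U Set.Subset.rfl)) (fun k => (hformal.1 k).mono (hU₀U.trans hUW))
    hGf₀ hGu₀
  obtain ⟨d₀, hd₀⟩ : ∃ d₀, d₀ = min d₁ d₂ := ⟨_, rfl⟩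
  have hd₀0 : 0 < d₀ := hd₀ ▸ lt_min hd₁ hd₂
  have hd₀₁ : borelDisc θ d₀ ⊆ borelDisc θ d₁ := borelDisc_subset hd₀0 (hd₀ ▸ min_le_left _ _)
  have hGf₁ := hGf₀.mono hd₀₁ Set.Subset.rfl
  have hcan : IsCanonicalSolution θ a b c fhat U₀ (borelDisc θ d₀) f :=
    ⟨⟨hex.1.mono (Set.prod_mono hU₀U hd₀₁), fun x hx h hh => hex.2 x (hU₀U hx) h (hd₀₁ hh)⟩,
      borelDisc θ d₀, Set.Subset.rfl, isSectorialDomain_borelDisc hd₀0, hGf₁⟩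
  obtain ⟨η, hη, φ, hres, htrunc⟩ := hBorel d₀ hd₀0 (hd₀ ▸ min_le_right _ _)
  exact ⟨d₀, hd₀0, hd₀₁.trans ((borelDisc_subset hd₁ hd₁d).trans hdS), f, hcan, hGf₁,
    fun g hg x hx h hh => hcan.eq hd₀0 hg hx hh, hGu₀, η, hη, φ, hres, htrunc⟩
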